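/- Let $\mathbb F$ be a field of characteristic $0$, let $\mathfrak g$ be a reductive finite-dimensional Lie algebra over $\mathbb F$ with a non-degenerate symmetric invariant bilinear form $\kappa$, and let $f\in\mathfrak g$ be a non-zero nilpotent element, contained in an $\mathfrak{sl}_2$-triple $(f,h=2x,e)$. Let $\mathfrak g=\bigoplus_{i\in\frac12\mathbb Z}\mathfrak g_i$ be the $\operatorname{ad}x$-eigenspace decomposition, and $\omega(a,b)=\kappa(f|[a,b])$. For a subspace $\mathfrak l\subset\mathfrak g_{1/2}$ isotropic with respect to $\omega$, let $\mathfrak l^{\perp\omega}\subset\mathfrak g_{1/2}$ be its $\omega$-orthogonal complement in $\mathfrak g_{1/2}$, $\mathfrak m=\mathfrak l\oplus\mathfrak g_{\ge1}$, $\mathfrak n=\mathfrak l^{\perp\omega}\oplus\mathfrak g_{\ge1}$, and let $\mathfrak p\subset\mathfrak g_{\le1/2}$ be a subspace with $\mathfrak g=\mathfrak m\oplus\mathfrak p$. Let $s\in\mathfrak g$ with $[s,\mathfrak n]=0$, and $z\in\mathbb F$. Let $\mathcal V(\mathfrak g)=S(\mathbb F[\partial]\mathfrak g)$ be the affine Poisson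 vertex algebra (PVA) with $\lambda$-bracket determined by $\{a_\lambda b\}_z=[a,b]+\kappa(a|b)\lambda+z\,\kappa(s|[a,b])$ for $a,b\in\mathfrak g$, let $\mathcal V(\mathfrak p)=S(\mathbb F[\partial]\mathfrak p)\subset\mathcal V(\mathfrak g)$, and let $\rho:\mathcal V(\mathfrak g)\to\mathcal V(\mathfrak p)$ be the homomorphism of differential algebras with $\rho(a)=\pi_{\mathfrak p}(a)+\kappa(f|a)$ for $a\in\mathfrak g$, where $\pi_{\mathfrak p}$ is the projection onto $\mathfrak p$ with kernel $\mathfrak m$. The classical $\mathcal W$-algebra is $$\mathcal W=\{g\in\mathcal V(\mathfrak p)\mid \rho\{a_\lambda g\}_z=0\ \text{for all }a\in\mathfrak n\},$$ with the derivation $\partial$ and the $\lambda$-bracket $\{g_\lambda k\}_{z,\rho}=\rho\{g_\lambda k\}_z$. Let $(\mathfrak l_1,\mathfrak p_1)$ and $(\mathfrak l_2,\mathfrak p_2)$ be two such choices, with corresponding $\mathfrak n_1$ and $\mathfrak n_2$. 1. For $z=0$, and any $s_1,s_2\in\mathfrak g$ with $[s_1,\mathfrak n_1]=0$ and $[s_2,\mathfrak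 n_2]=0$, the $\mathcal W$-algebras constructed from $(\mathfrak l_1,\mathfrak p_1,s_1)$ and from $(\mathfrak l_2,\mathfrak p_2,s_2)$ are PVAs and are isomorphic as PVAs. 2. For every $z\in\mathbb F$ and every $s\in\operatorname{Ker}(\operatorname{ad}\mathfrak g_{\ge1/2})$, the $\mathcal W$-algebras constructed from $(\mathfrak l_1,\mathfrak p_1)$ and from $(\mathfrak l_2,\mathfrak p_2)$, with this same $s$ and with $\lambda$-brackets $\{\cdot\,_\lambda\,\cdot\}_{z,\rho_1}$ and $\{\cdot\,_\lambda\,\cdot\}_{z,\rho_2}$, are PVAs and are isomorphic as PVAs. -/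

import Mathlib

namespace ClassicalW

/-! ### λ-brackets and Poisson vertex algebras

For a differential algebra `A` with derivation `∂`, elements of `F[λ] ⊗ A` are represented by
`Polynomial A`, the indeterminate being `λ`. -/

section PVA

variable {F A B : Type*} [Field F] [CommRing A] [Algebra F A] [CommRing B] [Algebra F B]

/-- The operator `λ + ∂` on `F[λ] ⊗ A`. -/
noncomputable def lamD (d : Derivation F A A) (P : Polynomial A) : Polynomial A :=
  Polynomial.X * P + P.sum fun n c => Polynomial.monomial n (d c)

/-- The operator `-λ - ∂` on `F[λ] ⊗ A`. -/
noncomputable def negLamD (d : Derivation F A A) (P : Polynomial A) : Polynomial A :=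
  -lamD d P

/-- `H(λ+∂) P = ∑ cₙ (λ+∂)ⁿ P` for `H(λ) = ∑ λⁿ cₙ` (the powers of `λ+∂` act on `P` only). -/
noncomputable def substLamD (d : Derivation F A A) (H P : Polynomial A) : Polynomial A :=
  H.sum fun n c => Polynomial.C c * (lamD d)^[n] P

/-- `∑ (-λ-∂)ⁿ cₙ` for `P(λ) = ∑ λⁿ cₙ` (here `∂` acts on the coefficients). -/
noncomputable def substNegLamD (d : Derivation F A A) (P : Polynomial A) : Polynomial A :=
  P.sum fun n c => (negLamD d)^[n] (Polynomial.C c)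

/-- A Poisson vertex algebra structure on the commutative `F`-algebra `A`. In the Jacobi identity,
which holds in `A[λ, μ]`, the outer indeterminate of `Polynomial (Polynomial A)` is `μ` and the
inner one is `λ`. -/
structure PVAStructure (F A : Type*) [Field F] [CommRing A] [Algebra F A] where
  /-- the derivation `∂` -/
  der : Derivation F A A
  /-- the λ-bracket `{f_λ g}` -/
  br : A →ₗ[F] A →ₗ[F] Polynomial A
  sesqui_left : ∀ f g : A, br (der f) g = -(Polynomial.X * br f g)
  sesqui_right : ∀ f g : A, br f (der g) = lamD der (br f g)
  leibniz_left : ∀ f g h : A,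
    br f (g * h) = br f g * Polynomial.C h + br f h * Polynomial.C g
  leibniz_right : ∀ f h g : A,
    br (f * h) g = substLamD der (br f g) (Polynomial.C h)
      + substLamD der (br h g) (Polynomial.C f)
  skew : ∀ f g : A, br g f = -substNegLamD der (br f g)
  jacobi : ∀ f g h : A,
    ((br g h).sum fun m c => Polynomial.monomial m (br f c))
      = ((br f g).sum fun m c => Polynomial.C (Polynomial.X ^ m) *
          (br c h).eval₂ (Polynomial.C.comp Polynomial.C)
            (Polynomial.C Polynomial.X + Polynomial.X))
        + ((br f h).sum fun m c => Polynomial.C (Polynomial.X ^ m) *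
          (br g c).map Polynomial.C)

/-- An isomorphism of Poisson vertex algebras: an isomorphism of algebras which commutes with the
derivations and intertwines the λ-brackets. -/
structure PVAEquiv (S : PVAStructure F A) (T : PVAStructure F B) where
  /-- the underlying isomorphism of algebras -/
  toAlgEquiv : A ≃ₐ[F] B
  map_der : ∀ a : A, toAlgEquiv (S.der a) = T.der (toAlgEquiv a)
  map_br : ∀ a b : A,
    (S.br a b).map (toAlgEquiv : A →+* B) = T.br (toAlgEquiv a) (toAlgEquiv b)

end PVA

/-! ### The affine Poisson vertex algebra -/

section Affine

variable {F 𝔤 ι : Type*} [Field F] [LieRing 𝔤] [LieAlgebra F 𝔤]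

/-- The algebra of differential polynomials in the variables `uᵢ`, `i ∈ ι`; the variable
`(i, n)` is `uᵢ⁽ⁿ⁾`. When `uᵢ` runs over a basis of `𝔤`, this is `𝒱(𝔤) = S(F[∂]𝔤)`. -/
abbrev DiffPoly (ι F : Type*) [Field F] := MvPolynomial (ι × ℕ) F

/-- The derivation `∂ uᵢ⁽ⁿ⁾ = uᵢ⁽ⁿ⁺¹⁾`. -/
noncomputable def del (ι F : Type*) [Field F] :
    Derivation F (DiffPoly ι F) (DiffPoly ι F) :=
  MvPolynomial.mkDerivation F fun v => MvPolynomial.X (v.1, v.2 + 1)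

/-- The λ-bracket on differential polynomials given by the Master Formula, where
`H i j = {uᵢ _λ uⱼ}` are the brackets of the generators:
`{f_λ g} = ∑ ∂g/∂uⱼ⁽ⁿ⁾ (λ+∂)ⁿ {uᵢ _{λ+∂} uⱼ} (-λ-∂)ᵐ ∂f/∂uᵢ⁽ᵐ⁾`. It is the unique extension of the
brackets of generators by sesquilinearity and the left and right Leibniz rules. -/
noncomputable def masterBracket (H : ι → ι → Polynomial (DiffPoly ι F)) (f g : DiffPoly ι F) :
    Polynomial (DiffPoly ι F) :=
  ∑ w ∈ g.vars, ∑ v ∈ f.vars,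
    Polynomial.C (MvPolynomial.pderiv w g) *
      (lamD (del ι F))^[w.2] (substLamD (del ι F) (H v.1 w.1)
        ((negLamD (del ι F))^[v.2] (Polynomial.C (MvPolynomial.pderiv v f))))

theorem masterBracket_eq_sum (H : ι → ι → Polynomial (DiffPoly ι F)) (f g : DiffPoly ι F)
    (s : Finset (ι × ℕ)) (hs : g.vars ⊆ s) :
    masterBracket H f g = ∑ w ∈ s, ∑ v ∈ f.vars,
      Polynomial.C (MvPolynomial.pderiv w g) *
        (lamD (del ι F))^[w.2] (substLamD (del ι F) (H v.1 w.1)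
          ((negLamD (del ι F))^[v.2] (Polynomial.C (MvPolynomial.pderiv v f)))) := by
  refine Finset.sum_subset hs fun w _ hw => ?_
  simp [MvPolynomial.pderiv_eq_zero_of_notMem_vars hw]

theorem masterBracket_add (H : ι → ι → Polynomial (DiffPoly ι F)) (f g h : DiffPoly ι F) :
    masterBracket H f (g + h) = masterBracket H f g + masterBracket H f h := by
  classical
  let s := (g + h).vars ∪ (g.vars ∪ h.vars)
  rw [masterBracket_eq_sum H f (g + h) s (by grind), masterBracket_eq_sum H f g s (by grind),
    masterBracket_eq_sum H f h s (by grind)]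
  simp only [map_add, add_mul, Finset.sum_add_distrib]

theorem masterBracket_mul (H : ι → ι → Polynomial (DiffPoly ι F)) (f g h : DiffPoly ι F) :
    masterBracket H f (g * h)
      = Polynomial.C g * masterBracket H f h + Polynomial.C h * masterBracket H f g := by
  classical
  let s := (g * h).vars ∪ (g.vars ∪ h.vars)
  rw [masterBracket_eq_sum H f (g * h) s (by grind), masterBracket_eq_sum H f g s (by grind),
    masterBracket_eq_sum H f h s (by grind)]
  simp only [Derivation.leibniz, smul_eq_mul, map_add, map_mul, add_mul,
    Finset.sum_add_distrib, Finset.mul_sum, mul_assoc]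

/-- The inclusion `a ↦ a⁽ⁿ⁾ = ∂ⁿ a` of `𝔤`, with basis `u`, into `𝒱(𝔤)`. -/
noncomputable def jet (u : Module.Basis ι F 𝔤) (n : ℕ) : 𝔤 →ₗ[F] DiffPoly ι F :=
  u.constr F fun i => MvPolynomial.X (i, n)

/-- The λ-bracket `{·_λ ·}_z` of the affine Poisson vertex algebra `𝒱(𝔤, κ, z s)`, given on
generators by `{a_λ b}_z = [a, b] + κ(a|b) λ + z κ(s|[a, b])`. -/
noncomputable def affineBracket (u : Module.Basis ι F 𝔤) (κ : LinearMap.BilinForm F 𝔤)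
    (z : F) (s : 𝔤) : DiffPoly ι F → DiffPoly ι F → Polynomial (DiffPoly ι F) :=
  masterBracket fun i j =>
    Polynomial.C (jet u 0 ⁅u i, u j⁆)
      + Polynomial.C (MvPolynomial.C (κ (u i) (u j))) * Polynomial.X
      + Polynomial.C (MvPolynomial.C (z * κ s ⁅u i, u j⁆))

theorem affineBracket_add (u : Module.Basis ι F 𝔤) (κ : LinearMap.BilinForm F 𝔤)
    (z : F) (s : 𝔤) (f g h : DiffPoly ι F) :
    affineBracket u κ z s f (g + h) = affineBracket u κ z s f g + affineBracket u κ z s f h :=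
  masterBracket_add _ f g h

theorem affineBracket_mul (u : Module.Basis ι F 𝔤) (κ : LinearMap.BilinForm F 𝔤)
    (z : F) (s : 𝔤) (f g h : DiffPoly ι F) :
    affineBracket u κ z s f (g * h) = Polynomial.C g * affineBracket u κ z s f h
      + Polynomial.C h * affineBracket u κ z s f g :=
  masterBracket_mul _ f g h

end Affine

/-! ### The classical W-algebra -/

section WAlgebra

variable {F 𝔤 ι : Type*} [Field F] [LieRing 𝔤] [LieAlgebra F 𝔤]

/-- `𝔤_{k/2}`: the eigenspace of `ad h` with eigenvalue `k`, i.e. the eigenspace of `ad x` with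
eigenvalue `k/2`, where `h = 2x`. -/
noncomputable def grade (F : Type*) {𝔤 : Type*} [Field F] [LieRing 𝔤] [LieAlgebra F 𝔤]
    (h : 𝔤) (k : ℤ) : Submodule F 𝔤 :=
  Module.End.eigenspace (LieAlgebra.ad F 𝔤 h) (k : F)

/-- `𝔤_{≥ k/2}`. -/
noncomputable def gradeGE (F : Type*) {𝔤 : Type*} [Field F] [LieRing 𝔤] [LieAlgebra F 𝔤]
    (h : 𝔤) (k : ℤ) : Submodule F 𝔤 :=
  ⨆ j : ℤ, ⨆ _ : k ≤ j, grade F h j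

/-- `𝔤_{≤ k/2}`. -/
noncomputable def gradeLE (F : Type*) {𝔤 : Type*} [Field F] [LieRing 𝔤] [LieAlgebra F 𝔤]
    (h : 𝔤) (k : ℤ) : Submodule F 𝔤 :=
  ⨆ j : ℤ, ⨆ _ : j ≤ k, grade F h j

/-- The skew-symmetric form `ω(a, b) = κ(f|[a, b])`. -/
def omega (κ : LinearMap.BilinForm F 𝔤) (f a b : 𝔤) : F := κ f ⁅a, b⁆

/-- The symplectic complement of `l` in `𝔤_{1/2}` with respect to `ω`. -/
noncomputable def sympCompl (κ : LinearMap.BilinForm F 𝔤) (h f : 𝔤) (l : Submodule F 𝔤) :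
    Submodule F 𝔤 where
  carrier := {a | a ∈ grade F h 1 ∧ ∀ b ∈ l, omega κ f a b = 0}
  zero_mem' := ⟨zero_mem _, by simp [omega]⟩
  add_mem' := fun ha hb => ⟨add_mem ha.1 hb.1, fun c hc => by
    have h1 := ha.2 c hc
    have h2 := hb.2 c hc
    simp only [omega] at h1 h2 ⊢
    simp [add_lie, h1, h2]⟩
  smul_mem' := fun r a ha => ⟨Submodule.smul_mem _ r ha.1, fun c hc => by
    have h1 := ha.2 c hc
    simp only [omega] at h1 ⊢
    simp [h1]⟩

/-- The choices entering the construction of the W-algebra: an isotropic subspace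
`l ⊆ 𝔤_{1/2}`, and a subspace `p ⊆ 𝔤_{≤ 1/2}` complementary to `m = l ⊕ 𝔤_{≥ 1}` in `𝔤`. -/
structure ReductionDatum (κ : LinearMap.BilinForm F 𝔤) (h f : 𝔤) where
  l : Submodule F 𝔤
  l_le : l ≤ grade F h 1
  isotropic : ∀ a ∈ l, ∀ b ∈ l, omega κ f a b = 0
  p : Submodule F 𝔤
  p_le : p ≤ gradeLE F h 1
  isCompl : IsCompl p (l ⊔ gradeGE F h 2)

variable {κ : LinearMap.BilinForm F 𝔤} {h f : 𝔤}

/-- The subalgebra `n = l^{⊥ω} ⊕ 𝔤_{≥ 1}`, as a subspace of `𝔤`. -/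
noncomputable def ReductionDatum.n (D : ReductionDatum κ h f) : Submodule F 𝔤 :=
  sympCompl κ h f D.l ⊔ gradeGE F h 2

/-- The projection `π_p : 𝔤 → p ⊆ 𝔤` with kernel `m`. -/
noncomputable def ReductionDatum.proj (D : ReductionDatum κ h f) : 𝔤 →ₗ[F] 𝔤 :=
  D.p.projection (D.l ⊔ gradeGE F h 2) D.isCompl

/-- The differential subalgebra `𝒱(p) = S(F[∂]p)` of `𝒱(𝔤)`. -/
noncomputable def ReductionDatum.Vp (D : ReductionDatum κ h f) (u : Module.Basis ι F 𝔤) :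
    Subalgebra F (DiffPoly ι F) :=
  Algebra.adjoin F {P | ∃ a ∈ D.p, ∃ n : ℕ, P = jet u n a}

/-- The homomorphism of differential algebras `ρ : 𝒱(𝔤) → 𝒱(p) ⊆ 𝒱(𝔤)` with
`ρ(a) = π_p(a) + κ(f|a)` for `a ∈ 𝔤`. -/
noncomputable def ReductionDatum.rho (D : ReductionDatum κ h f) (u : Module.Basis ι F 𝔤) :
    DiffPoly ι F →ₐ[F] DiffPoly ι F :=
  MvPolynomial.aeval fun v =>
    (del ι F)^[v.2] (jet u 0 (D.proj (u v.1)) + MvPolynomial.C (κ f (u v.1)))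

/-- The reduced λ-bracket `{g_λ k}_{z,ρ} = ρ{g_λ k}_z`. -/
noncomputable def ReductionDatum.rhoBracket (D : ReductionDatum κ h f) (u : Module.Basis ι F 𝔤)
    (z : F) (s : 𝔤) (g k : DiffPoly ι F) : Polynomial (DiffPoly ι F) :=
  (affineBracket u κ z s g k).map (D.rho u : DiffPoly ι F →+* DiffPoly ι F)

/-- The classical W-algebra as an algebra: the elements of `𝒱(p)` annihilated by the λ-action
`a ^ρ_λ g = ρ{a_λ g}_z` of `n`. -/
noncomputable def ReductionDatum.W (D : ReductionDatum κ h f) (u : Module.Basis ι F 𝔤)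
    (z : F) (s : 𝔤) : Subalgebra F (DiffPoly ι F) where
  carrier := {g | g ∈ D.Vp u ∧ ∀ a ∈ D.n, D.rhoBracket u z s (jet u 0 a) g = 0}
  mul_mem' := fun {g k} hg hk => ⟨mul_mem hg.1 hk.1, fun a ha => by
    have h1 := hg.2 a ha
    have h2 := hk.2 a ha
    simp only [ReductionDatum.rhoBracket] at h1 h2 ⊢
    rw [affineBracket_mul, Polynomial.map_add, Polynomial.map_mul, Polynomial.map_mul, h1, h2]
    simp⟩
  add_mem' := fun {g k} hg hk => ⟨add_mem hg.1 hk.1, fun a ha => by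
    have h1 := hg.2 a ha
    have h2 := hk.2 a ha
    simp only [ReductionDatum.rhoBracket] at h1 h2 ⊢
    rw [affineBracket_add, Polynomial.map_add, h1, h2, add_zero]⟩
  algebraMap_mem' := fun c => ⟨Subalgebra.algebraMap_mem _ c, fun a _ => by
    simp [ReductionDatum.rhoBracket, affineBracket, masterBracket,
      MvPolynomial.algebraMap_eq]⟩

/-- `S` is the Poisson vertex algebra structure of the classical W-algebra: its derivation is the
restriction of `∂` and its λ-bracket is `{·_λ ·}_{z,ρ}`. These conditions determine `S`. -/
def ReductionDatum.IsWStructure (D : ReductionDatum κ h f) (u : Module.Basis ι F 𝔤)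
    (z : F) (s : 𝔤) (S : PVAStructure F (D.W u z s)) : Prop :=
  (∀ g : D.W u z s, (S.der g : DiffPoly ι F) = del ι F g) ∧
    ∀ g k : D.W u z s,
      (S.br g k).map ((D.W u z s).val : D.W u z s →+* DiffPoly ι F)
        = D.rhoBracket u z s g k

end WAlgebra

end ClassicalW

/-!
The W-algebra of a datum `D = (l, 𝔭)` consists of differential functions on the affine space
`f + 𝔪^⊥` which are invariant under the gauge action of `𝔫`. The gauge action has a slice: if the
`cⱼ` form a homogeneous basis of a complement of `[f, 𝔤_{≥1}]` in `𝔤_{≥0}`, then the elements of the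
W-algebra correspond, by restriction, to arbitrary differential polynomials on `f + span cⱼ`
(`ReductionDatum.restrictW_bijective`). The slice does not depend on `D`, so that the W-algebras of
two data are identified with one and the same algebra of differential polynomials, compatibly with
`∂`. The identification respects the λ-brackets because the datum `D₀` with `l = 0` has the largest
`𝔫` and the smallest `𝔪`: the map `ρ` of `D` sends the W-algebra of `D₀` to that of `D`, without
changing restrictions to the slice, and the reduced bracket of `ρ g₀` and `ρ k₀` is `ρ{g₀ _λ k₀}`
(`ReductionDatum.restrict_bracket`).

That the W-algebra is a Poisson vertex algebra follows from the axioms for the affine bracket, since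
for invariant `g` the operators `{g _λ ·}` and `{· _λ g}` preserve the kernel of `ρ`
(`ReductionDatum.rho_bracket_left`, `ReductionDatum.rho_bracket_right`,
`ReductionDatum.exists_isWStructure`). The affine bracket is given by the Master Formula, for which
the axioms reduce to skew-symmetry and the Jacobi identity on generators. As `F` is infinite, all
identities between λ-brackets may be checked at scalar values of `λ` and `μ`, which turns polynomial
identities into identities between the derivations `bracketAt`.

The bijectivity of the restriction to the slice is proved without integrating the action. In
coordinates `X_v⁽ⁿ⁾` dual to the basis `[f, aᵢ], cⱼ` of `𝔪^⊥`, where the `aᵢ` form a basis of `𝔫`, the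
coefficient of `λᵏ` in the λ-action of `aᵢ` is a derivation `D_{i,k}`, and `D_{i,k} = ∂/∂X_i⁽ᵏ⁾` up to
terms of higher order (`GaugeFrame.gaugeDer_X_sub_pderiv`). The `D_{i,k}` span a Lie algebra, so the
Poincaré lemma solves `D_{i,k} g = 0` order by order for prescribed `g` at `X_i⁽ᵏ⁾ = 0`. The process
stops since the `D_{i,k}` lower the conformal weight, which bounds the order
(`IsGaugeSystem.exists_invariant`); uniqueness is seen on the leading term
(`IsGaugeSystem.eq_zero`). The basis `[f, aᵢ], cⱼ` exists because `ad f` is injective on `𝔤_{≥1/2}` and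
`ω` is non-degenerate on `𝔤_{1/2}` (`exists_gaugeFrame`).

The parameter `s` enters only through `z κ(s|[a, b])`, which vanishes for `a ∈ 𝔤_{≥1/2}` in both
parts.
-/

namespace ClassicalW

/-! ### Evaluating λ-brackets at scalars -/

open Polynomial in
/-- The coefficients of a polynomial lie in a subspace as soon as its values at all scalars do. -/
theorem coeff_mem_of_eval_mem {F A : Type*} [Field F] [Infinite F] [CommRing A] [Algebra F A]
    (W : Submodule F A) (P : A[X]) (hP : ∀ t : F, P.eval (algebraMap F A t) ∈ W) (n : ℕ) :
    P.coeff n ∈ W := by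
  by_contra hn
  obtain ⟨l, hl, hW⟩ := Submodule.exists_le_ker_of_notMem hn
  -- the scalar polynomial obtained by applying a functional `l` that vanishes on `W`
  let Q : F[X] := ∑ i ∈ Finset.range (P.natDegree + 1), monomial i (l (P.coeff i))
  have hQ : Q = 0 := by
    refine Polynomial.funext fun t => ?_
    have h1 := hW (hP t)
    rw [LinearMap.mem_ker, eval_eq_sum_range, map_sum] at h1
    simp only [Q, eval_finsetSum, eval_monomial, eval_zero]
    rw [← h1]
    refine Finset.sum_congr rfl fun i _ => ?_
    rw [← map_pow, mul_comm (P.coeff i), ← Algebra.smul_def, map_smul, smul_eq_mul, mul_comm]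
  have h2 : Q.coeff n = l (P.coeff n) := by
    simp only [Q, finsetSum_coeff, coeff_monomial]
    rw [Finset.sum_ite_eq']
    split_ifs with h
    · rfl
    · rw [coeff_eq_zero_of_natDegree_lt (by simpa using h), map_zero]
  exact hl (by rw [← h2, hQ, coeff_zero])

section LambdaEval

open Polynomial

variable {F A : Type*} [Field F] [CommRing A] [Algebra F A]

/-- Evaluation of the indeterminate `λ` at a scalar `t`. -/
noncomputable def scalarEval (t : F) : A[X] →ₗ[F] A :=
  (Polynomial.leval (algebraMap F A t)).restrictScalars F

theorem scalarEval_apply (t : F) (P : A[X]) : scalarEval t P = P.eval (algebraMap F A t) := rfl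

theorem ext_scalarEval [Infinite F] {P Q : A[X]}
    (h : ∀ t : F, scalarEval t P = scalarEval t Q) : P = Q := by
  rw [← sub_eq_zero]
  ext n
  simpa using coeff_mem_of_eval_mem (⊥ : Submodule F A) (P - Q)
    (fun t => by simpa [sub_eq_zero, scalarEval_apply] using h t) n

variable (d : Derivation F A A)

/-- The operator `t + ∂` on `A`, the value of `λ + ∂` at `λ = t`. -/
noncomputable def shift (t : F) : Module.End F A := t • LinearMap.id + (d : A →ₗ[F] A)

/-- The linear map `∑ λⁿ cₙ ↦ ∑ cₙ (t+∂)ⁿ h`. -/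
noncomputable def substAt (t : F) (h : A) : A[X] →ₗ[F] A :=
  Polynomial.lsum fun n => (LinearMap.mulRight F ((shift d t ^ n) h))

/-- The linear map `∑ λⁿ cₙ ↦ ∑ (-t-∂)ⁿ cₙ`. -/
noncomputable def adjAt (t : F) : A[X] →ₗ[F] A :=
  Polynomial.lsum fun n => (-shift d t) ^ n

variable {d}

theorem shift_apply (t : F) (a : A) : shift d t a = t • a + d a := rfl

theorem shift_pow_one (t : F) (n : ℕ) : (shift d t ^ n) (1 : A) = algebraMap F A (t ^ n) := by
  induction n with
  | zero => simp
  | succ n ih =>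
    rw [pow_succ', Module.End.mul_apply, ih, shift_apply, Derivation.map_algebraMap, add_zero,
      Algebra.smul_def, ← map_mul, ← pow_succ']

theorem substAt_apply (t : F) (h : A) (P : A[X]) :
    substAt d t h P = P.sum fun n c => c * (shift d t ^ n) h := by
  simp [substAt, Polynomial.lsum_apply]

theorem substAt_monomial (t : F) (h : A) (n : ℕ) (c : A) :
    substAt d t h (monomial n c) = c * (shift d t ^ n) h := by
  rw [substAt_apply, sum_monomial_index _ _ (by simp)]

theorem adjAt_apply (t : F) (P : A[X]) :
    adjAt d t P = P.sum fun n c => ((-shift d t) ^ n) c := by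
  simp [adjAt, Polynomial.lsum_apply]

theorem adjAt_monomial (t : F) (n : ℕ) (c : A) :
    adjAt d t (monomial n c) = ((-shift d t) ^ n) c := by
  rw [adjAt_apply, sum_monomial_index _ _ (by simp)]

theorem adjAt_C (t : F) (c : A) : adjAt d t (C c) = c := by
  simpa using adjAt_monomial (d := d) t 0 c

theorem substAt_C (t : F) (h c : A) : substAt d t h (C c) = c * h := by
  simpa using substAt_monomial (d := d) t h 0 c

theorem substAt_one (t : F) (P : A[X]) : substAt d t 1 P = scalarEval t P := by
  rw [substAt_apply, scalarEval_apply, eval_eq_sum]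
  simp only [shift_pow_one, map_pow]

theorem substAt_C_mul (t : F) (h c : A) (P : A[X]) :
    substAt d t h (C c * P) = c * substAt d t h P := by
  induction P using Polynomial.induction_on' with
  | add p q hp hq => rw [mul_add, map_add, map_add, hp, hq, mul_add]
  | monomial n a => rw [C_mul_monomial, substAt_monomial, substAt_monomial, mul_assoc]

theorem lamD_add (P Q : A[X]) : lamD d (P + Q) = lamD d P + lamD d Q := by
  unfold lamD
  rw [sum_add_index P Q _ (by simp) (by simp)]
  ring

theorem lamD_monomial (n : ℕ) (c : A) :
    lamD d (monomial n c) = monomial (n + 1) c + monomial n (d c) := by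
  unfold lamD
  rw [sum_monomial_index _ _ (by simp), X_mul_monomial]

theorem lamD_coeff_zero (P : A[X]) : (lamD d P).coeff 0 = d (P.coeff 0) := by
  induction P using Polynomial.induction_on' with
  | add p q hp hq => rw [lamD_add, coeff_add, coeff_add, map_add, hp, hq]
  | monomial n a =>
    rw [lamD_monomial, coeff_add, coeff_monomial, coeff_monomial, coeff_monomial]
    split_ifs <;> simp_all

theorem lamD_coeff_succ (P : A[X]) (k : ℕ) :
    (lamD d P).coeff (k + 1) = d (P.coeff (k + 1)) + P.coeff k := by
  induction P using Polynomial.induction_on' with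
  | add p q hp hq => rw [lamD_add, coeff_add, coeff_add, coeff_add, map_add, hp, hq]; ring
  | monomial n a =>
    rw [lamD_monomial, coeff_add, coeff_monomial, coeff_monomial, coeff_monomial, coeff_monomial]
    split_ifs <;> simp_all

theorem shift_mul (t : F) (c a : A) : shift d t (c * a) = c * shift d t a + d c * a := by
  simp only [shift_apply, Derivation.leibniz, smul_eq_mul, mul_add, mul_smul_comm]
  ring

theorem substAt_lamD (t : F) (h : A) (P : A[X]) :
    substAt d t h (lamD d P) = shift d t (substAt d t h P) := by
  induction P using Polynomial.induction_on' with
  | add p q hp hq => rw [lamD_add, map_add, map_add, map_add, hp, hq]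
  | monomial n a =>
    rw [lamD_monomial, map_add, substAt_monomial, substAt_monomial, substAt_monomial, shift_mul,
      pow_succ', Module.End.mul_apply]

theorem substAt_lamD_iterate (t : F) (h : A) (n : ℕ) (P : A[X]) :
    substAt d t h ((lamD d)^[n] P) = (shift d t ^ n) (substAt d t h P) := by
  induction n with
  | zero => simp
  | succ n ih =>
    rw [Function.iterate_succ_apply', substAt_lamD, ih, pow_succ', Module.End.mul_apply]

theorem substAt_negLamD_iterate (t : F) (h : A) (n : ℕ) (P : A[X]) :
    substAt d t h ((negLamD d)^[n] P) = ((-shift d t) ^ n) (substAt d t h P) := by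
  induction n with
  | zero => simp
  | succ n ih =>
    rw [Function.iterate_succ_apply', negLamD, map_neg, substAt_lamD, ih, pow_succ',
      Module.End.mul_apply, LinearMap.neg_apply]

theorem substAt_substLamD (t : F) (h : A) (H P : A[X]) :
    substAt d t h (substLamD d H P) = substAt d t (substAt d t h P) H := by
  rw [substAt_apply t (substAt d t h P) H]
  simp only [substLamD, Polynomial.sum, map_sum, substAt_C_mul, substAt_lamD_iterate]

theorem scalarEval_substLamD (t : F) (H P : A[X]) :
    scalarEval t (substLamD d H P) = substAt d t (scalarEval t P) H := by
  rw [← substAt_one (d := d), substAt_substLamD, substAt_one]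

theorem scalarEval_lamD (t : F) (P : A[X]) :
    scalarEval t (lamD d P) = shift d t (scalarEval t P) := by
  rw [← substAt_one (d := d), substAt_lamD, substAt_one]

theorem scalarEval_C (t : F) (c : A) : scalarEval t (C c) = c := by simp [scalarEval_apply]

theorem scalarEval_X_mul (t : F) (P : A[X]) : scalarEval t (X * P) = t • scalarEval t P := by
  simp [scalarEval_apply, Algebra.smul_def]

theorem scalarEval_mul (t : F) (P Q : A[X]) :
    scalarEval t (P * Q) = scalarEval t P * scalarEval t Q := by
  simp [scalarEval_apply]

theorem scalarEval_monomial (t : F) (n : ℕ) (c : A) :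
    scalarEval t (monomial n c) = t ^ n • c := by
  simp [scalarEval_apply, Algebra.smul_def, mul_comm]

theorem scalarEval_substNegLamD (t : F) (P : A[X]) :
    scalarEval t (substNegLamD d P) = adjAt d t P := by
  rw [← substAt_one (d := d), adjAt_apply]
  simp only [substNegLamD, Polynomial.sum, map_sum, substAt_negLamD_iterate, substAt_C, mul_one]

theorem substAt_substNegLamD (t : F) (h : A) (P : A[X]) :
    substAt d t h (substNegLamD d P) = adjAt d t (P * C h) := by
  have h1 : adjAt d t (P * C h) = P.sum fun n c => ((-shift d t) ^ n) (c * h) := by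
    induction P using Polynomial.induction_on' with
    | add p q hp hq =>
      rw [add_mul, map_add, hp, hq, sum_add_index p q _ (by simp) (by simp [add_mul])]
    | monomial n a => rw [monomial_mul_C, adjAt_monomial, sum_monomial_index _ _ (by simp)]
  rw [h1]
  simp only [substNegLamD, Polynomial.sum, map_sum, substAt_negLamD_iterate, substAt_C]

theorem substAt_X_mul (t : F) (h : A) (P : A[X]) :
    substAt d t h (X * P) = substAt d t (shift d t h) P := by
  induction P using Polynomial.induction_on' with
  | add p q hp hq => rw [mul_add, map_add, map_add, hp, hq]
  | monomial n a =>
    rw [X_mul_monomial, substAt_monomial, substAt_monomial, pow_succ, Module.End.mul_apply]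

theorem substAt_add_right (t : F) (h k : A) (P : A[X]) :
    substAt d t (h + k) P = substAt d t h P + substAt d t k P := by
  simp only [substAt_apply, Polynomial.sum, ← Finset.sum_add_distrib, map_add, mul_add]

theorem adjAt_X_mul (t : F) (P : A[X]) : adjAt d t (X * P) = -shift d t (adjAt d t P) := by
  induction P using Polynomial.induction_on' with
  | add p q hp hq => rw [mul_add, map_add, map_add, map_add, hp, hq, neg_add]
  | monomial n a =>
    rw [X_mul_monomial, adjAt_monomial, adjAt_monomial, pow_succ', Module.End.mul_apply,
      LinearMap.neg_apply]

theorem adjAt_lamD (t : F) (P : A[X]) : adjAt d t (lamD d P) = -(t • adjAt d t P) := by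
  induction P using Polynomial.induction_on' with
  | add p q hp hq => rw [lamD_add, map_add, map_add, hp, hq, smul_add, neg_add]
  | monomial n a =>
    rw [lamD_monomial, map_add, adjAt_monomial, adjAt_monomial, adjAt_monomial, pow_succ,
      Module.End.mul_apply, ← map_add, LinearMap.neg_apply, shift_apply, neg_add,
      neg_add_cancel_right, map_neg, map_smul]

theorem adjAt_C_mul_lamD_iterate (t : F) (h : A) (n : ℕ) (c : A) :
    adjAt d t (C c * (lamD d)^[n] (C h)) = h * ((-shift d t) ^ n) c := by
  induction n generalizing c with
  | zero => rw [Function.iterate_zero, id, ← C_mul, adjAt_C, pow_zero, Module.End.one_apply, mul_comm]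
  | succ n ih =>
    -- move one factor `λ + ∂` to the left, past the coefficient `c`
    have h1 : ∀ Q : A[X], C c * lamD d Q = lamD d (C c * Q) - C (d c) * Q := fun Q => by
      induction Q using Polynomial.induction_on' with
      | add p q hp hq => rw [lamD_add, mul_add, mul_add, mul_add, lamD_add, hp, hq]; ring
      | monomial n a =>
        simp only [lamD_monomial, C_mul_monomial, mul_add, Derivation.leibniz, smul_eq_mul,
          map_add, mul_comm a]
        ring
    rw [Function.iterate_succ_apply', h1, map_sub, adjAt_lamD, ih, ih, pow_succ,
      Module.End.mul_apply, LinearMap.neg_apply, shift_apply, neg_add, map_add, map_neg, map_neg,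
      map_smul, mul_add, mul_neg, mul_neg, mul_smul_comm, sub_eq_add_neg]

theorem adjAt_substLamD_C (t : F) (h : A) (P : A[X]) :
    adjAt d t (substLamD d P (C h)) = h * adjAt d t P := by
  rw [adjAt_apply t P, substLamD, Polynomial.sum, Polynomial.sum, map_sum, Finset.mul_sum]
  exact Finset.sum_congr rfl fun n _ => adjAt_C_mul_lamD_iterate t h n _

theorem scalarEval_comp_X_add_C (t r : F) (P : A[X]) :
    scalarEval r (P.comp (X + C (algebraMap F A t))) = scalarEval (t + r) P := by
  simp [scalarEval_apply, eval_comp, add_comm]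

theorem adjAt_comp_X_add_C (t r : F) (P : A[X]) :
    adjAt d (t + r) (P.comp (X + C (algebraMap F A t))) = adjAt d r P := by
  induction P using Polynomial.induction_on' with
  | add p q hp hq => rw [add_comp, map_add, map_add, hp, hq]
  | monomial n a =>
    have h1 : ∀ Q : A[X], adjAt d (t + r) ((X + C (algebraMap F A t)) * Q)
        = (-shift d r) (adjAt d (t + r) Q) := fun Q => by
      rw [add_mul, map_add, adjAt_X_mul, ← algebraMap_eq, ← IsScalarTower.algebraMap_apply,
        ← Algebra.smul_def, map_smul, LinearMap.neg_apply, shift_apply, shift_apply, add_smul]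
      abel
    rw [adjAt_monomial, monomial_comp, mul_comm]
    induction n with
    | zero => simp [adjAt_C]
    | succ n ih => rw [pow_succ', mul_assoc, h1, ih, pow_succ', Module.End.mul_apply]

/-- Two elements of `A[λ, μ]` agree if they agree at all pairs of scalars. -/
theorem ext_scalarEval₂ [Infinite F] {P Q : A[X][X]}
    (h : ∀ t r : F, scalarEval t (P.eval (C (algebraMap F A r)))
      = scalarEval t (Q.eval (C (algebraMap F A r)))) : P = Q := by
  refine ext_scalarEval (F := F) fun r => ext_scalarEval (F := F) fun t => ?_
  simpa [scalarEval_apply] using h t r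

end LambdaEval

/-! ### The Poisson vertex algebra axioms for the Master Formula -/

section MasterFormula

open Polynomial

theorem substAt_smul_right {F A : Type*} [Field F] [CommRing A] [Algebra F A]
    {d : Derivation F A A} (t c : F) (h : A) (P : A[X]) :
    substAt d t (c • h) P = c • substAt d t h P := by
  simp only [substAt_apply, Polynomial.sum, Finset.smul_sum, map_smul, mul_smul_comm]

theorem substAt_zero_right {F A : Type*} [Field F] [CommRing A] [Algebra F A]
    {d : Derivation F A A} (t : F) (P : A[X]) : substAt d t 0 P = 0 := by
  simpa using substAt_smul_right (d := d) t 0 0 P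

theorem del_X {F ι : Type*} [Field F] (v : ι × ℕ) :
    del ι F (MvPolynomial.X v) = MvPolynomial.X (v.1, v.2 + 1) :=
  MvPolynomial.mkDerivation_X _ _ _

variable {F ι : Type*} [Field F] (H : ι → ι → Polynomial (DiffPoly ι F))

theorem substAt_masterBracket (t : F) (f g h : DiffPoly ι F) (s s' : Finset (ι × ℕ))
    (hs : g.vars ⊆ s) (hs' : f.vars ⊆ s') :
    substAt (del ι F) t h (masterBracket H f g) = ∑ w ∈ s, ∑ v ∈ s', MvPolynomial.pderiv w g *
      (shift (del ι F) t ^ w.2) (substAt (del ι F) t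
        (((-shift (del ι F) t) ^ v.2) (MvPolynomial.pderiv v f * h)) (H v.1 w.1)) := by
  rw [masterBracket_eq_sum H f g s hs]
  simp only [map_sum, substAt_C_mul, substAt_lamD_iterate, substAt_substLamD,
    substAt_negLamD_iterate, substAt_C]
  refine Finset.sum_congr rfl fun w _ => Finset.sum_subset hs' fun v _ hv => ?_
  simp [MvPolynomial.pderiv_eq_zero_of_notMem_vars hv, substAt_zero_right]

theorem substAt_masterBracket_add_left (t : F) (f f' g h : DiffPoly ι F) :
    substAt (del ι F) t h (masterBracket H (f + f') g)
      = substAt (del ι F) t h (masterBracket H f g)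
        + substAt (del ι F) t h (masterBracket H f' g) := by
  classical
  let s := (f + f').vars ∪ (f.vars ∪ f'.vars)
  rw [substAt_masterBracket H t _ g h _ s subset_rfl (by grind),
    substAt_masterBracket H t f g h _ s subset_rfl (by grind),
    substAt_masterBracket H t f' g h _ s subset_rfl (by grind)]
  simp only [map_add, add_mul, substAt_add_right, mul_add, Finset.sum_add_distrib]

theorem substAt_masterBracket_smul_left (t c : F) (f g h : DiffPoly ι F) :
    substAt (del ι F) t h (masterBracket H (c • f) g)
      = c • substAt (del ι F) t h (masterBracket H f g) := by
  classical
  let s := (c • f).vars ∪ f.vars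
  rw [substAt_masterBracket H t _ g h _ s subset_rfl (by grind),
    substAt_masterBracket H t f g h _ s subset_rfl (by grind)]
  simp only [Derivation.map_smul, smul_mul_assoc, map_smul, substAt_smul_right, mul_smul_comm,
    Finset.smul_sum]

theorem substAt_masterBracket_mul_left (t : F) (f f' g : DiffPoly ι F) :
    scalarEval t (masterBracket H (f * f') g)
      = substAt (del ι F) t f' (masterBracket H f g)
        + substAt (del ι F) t f (masterBracket H f' g) := by
  classical
  let s := (f * f').vars ∪ (f.vars ∪ f'.vars)
  rw [← substAt_one (d := del ι F), substAt_masterBracket H t _ g _ _ s subset_rfl (by grind),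
    substAt_masterBracket H t f g _ _ s subset_rfl (by grind),
    substAt_masterBracket H t f' g _ _ s subset_rfl (by grind)]
  simp only [Derivation.leibniz, smul_eq_mul, mul_one, map_add, substAt_add_right, mul_add,
    Finset.sum_add_distrib]
  rw [add_comm]
  simp only [mul_comm]

theorem masterBracket_C_right (f : DiffPoly ι F) (c : F) :
    masterBracket H f (MvPolynomial.C c) = 0 := by
  simp [masterBracket]

theorem masterBracket_C_left (g : DiffPoly ι F) (c : F) :
    masterBracket H (MvPolynomial.C c) g = 0 := by
  simp [masterBracket]

variable [Infinite F]

theorem masterBracket_add_left (f f' g : DiffPoly ι F) :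
    masterBracket H (f + f') g = masterBracket H f g + masterBracket H f' g :=
  ext_scalarEval (F := F) fun t => by
    rw [map_add]
    simpa only [substAt_one] using substAt_masterBracket_add_left H t f f' g 1

theorem masterBracket_smul_left (c : F) (f g : DiffPoly ι F) :
    masterBracket H (c • f) g = c • masterBracket H f g :=
  ext_scalarEval (F := F) fun t => by
    rw [map_smul]
    simpa only [substAt_one] using substAt_masterBracket_smul_left H t c f g 1

theorem masterBracket_mul_left (f f' g : DiffPoly ι F) :
    masterBracket H (f * f') g = substLamD (del ι F) (masterBracket H f g) (C f')
      + substLamD (del ι F) (masterBracket H f' g) (C f) :=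
  ext_scalarEval (F := F) fun t => by
    rw [map_add, scalarEval_substLamD, scalarEval_substLamD, scalarEval_C, scalarEval_C,
      substAt_masterBracket_mul_left]

/-- The λ-bracket given by the Master Formula, as a bilinear map. -/
noncomputable def masterLin : DiffPoly ι F →ₗ[F] DiffPoly ι F →ₗ[F] (DiffPoly ι F)[X] :=
  LinearMap.mk₂ F (masterBracket H) (masterBracket_add_left H) (masterBracket_smul_left H)
    (masterBracket_add H) (fun c f g => by
      rw [MvPolynomial.smul_eq_C_mul, masterBracket_mul, masterBracket_C_right, mul_zero, add_zero]
      ext n : 1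
      rw [coeff_C_mul, coeff_smul, MvPolynomial.smul_eq_C_mul])

theorem masterLin_apply (f g : DiffPoly ι F) : masterLin H f g = masterBracket H f g := rfl

/-- The value `{f_t g}` of the λ-bracket at a scalar `t`, as a derivation in `g`. -/
noncomputable def bracketAt (t : F) (f : DiffPoly ι F) :
    Derivation F (DiffPoly ι F) (DiffPoly ι F) :=
  Derivation.mk' (scalarEval t ∘ₗ masterLin H f) fun a b => by
    simp only [LinearMap.comp_apply, masterLin_apply, masterBracket_mul, map_add, scalarEval_mul,
      scalarEval_C, smul_eq_mul]

theorem bracketAt_apply (t : F) (f g : DiffPoly ι F) :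
    bracketAt H t f g = scalarEval t (masterBracket H f g) := rfl

theorem bracketAt_add (t : F) (f f' g : DiffPoly ι F) :
    bracketAt H t (f + f') g = bracketAt H t f g + bracketAt H t f' g := by
  simp only [bracketAt_apply, masterBracket_add_left, map_add]

theorem bracketAt_smul (t c : F) (f g : DiffPoly ι F) :
    bracketAt H t (c • f) g = c • bracketAt H t f g := by
  simp only [bracketAt_apply, masterBracket_smul_left, map_smul]

theorem bracketAt_neg (t : F) (f g : DiffPoly ι F) :
    bracketAt H t (-f) g = -bracketAt H t f g := by
  rw [← neg_one_smul F, bracketAt_smul, neg_one_smul]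

theorem bracketAt_C (t c : F) (g : DiffPoly ι F) : bracketAt H t (MvPolynomial.C c) g = 0 := by
  rw [bracketAt_apply, masterBracket_C_left, map_zero]

theorem bracketAt_zero (t : F) (g : DiffPoly ι F) : bracketAt H t 0 g = 0 := by
  simpa using bracketAt_smul H t 0 0 g

theorem bracketAt_mul_left (t : F) (f f' g : DiffPoly ι F) :
    bracketAt H t (f * f') g = substAt (del ι F) t f' (masterBracket H f g)
        + substAt (del ι F) t f (masterBracket H f' g) :=
  substAt_masterBracket_mul_left H t f f' g

theorem bracketAt_X (t : F) (f : DiffPoly ι F) (j : ι) (n : ℕ) :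
    bracketAt H t f (MvPolynomial.X (j, n + 1))
      = shift (del ι F) t (bracketAt H t f (MvPolynomial.X (j, n))) := by
  classical
  simp only [bracketAt_apply, ← substAt_one (d := del ι F)]
  rw [substAt_masterBracket H t f _ 1 {(j, n + 1)} _ (by simp [MvPolynomial.vars_X]) subset_rfl,
    substAt_masterBracket H t f _ 1 {(j, n)} _ (by simp [MvPolynomial.vars_X]) subset_rfl]
  simp only [Finset.sum_singleton, MvPolynomial.pderiv_X_self, one_mul, map_sum, pow_succ',
    Module.End.mul_apply]

theorem bracketAt_del_right (t : F) (f g : DiffPoly ι F) :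
    bracketAt H t f (del ι F g) = shift (del ι F) t (bracketAt H t f g) := by
  induction g using MvPolynomial.induction_on with
  | C a => simp
  | add p q hp hq => rw [map_add, map_add, hp, hq, map_add, map_add]
  | mul_X p v hp =>
    simp only [Derivation.leibniz, smul_eq_mul, map_add, hp, del_X, bracketAt_X, shift_mul]
    rw [← del_X]
    simp only [shift_apply]
    ring

theorem bracketAt_del_left_X (t : F) (v : ι × ℕ) (g : DiffPoly ι F) :
    bracketAt H t (del ι F (MvPolynomial.X v)) g = -(t • bracketAt H t (MvPolynomial.X v) g) := by
  classical
  simp only [bracketAt_apply, ← substAt_one (d := del ι F), del_X]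
  rw [substAt_masterBracket H t _ g 1 _ {(v.1, v.2 + 1)} subset_rfl (by simp [MvPolynomial.vars_X]),
    substAt_masterBracket H t _ g 1 _ {v} subset_rfl (by simp [MvPolynomial.vars_X])]
  simp only [Finset.sum_singleton, MvPolynomial.pderiv_X_self, one_mul, pow_succ,
    Module.End.mul_apply, LinearMap.neg_apply, shift_apply, Derivation.map_one_eq_zero, add_zero,
    ← neg_smul, map_smul, substAt_smul_right, mul_smul_comm, ← Finset.smul_sum]

theorem bracketAt_del_left (t : F) (f g : DiffPoly ι F) :
    bracketAt H t (del ι F f) g = -(t • bracketAt H t f g) := by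
  induction f using MvPolynomial.induction_on generalizing t with
  | C a =>
    rw [MvPolynomial.derivation_C, bracketAt_C, smul_zero, neg_zero, bracketAt_zero]
  | add p q hp hq => rw [map_add, bracketAt_add, bracketAt_add, hp, hq, smul_add, neg_add]
  | mul_X p v hp =>
    have h1 : masterBracket H (del ι F p) g = -(X * masterBracket H p g) :=
      ext_scalarEval (F := F) fun t => by
        rw [map_neg, scalarEval_X_mul]
        exact hp t
    have h2 : masterBracket H (del ι F (MvPolynomial.X v)) g
        = -(X * masterBracket H (MvPolynomial.X v) g) :=
      ext_scalarEval (F := F) fun t => by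
        rw [map_neg, scalarEval_X_mul]
        exact bracketAt_del_left_X H t v g
    simp only [Derivation.leibniz, smul_eq_mul, bracketAt_add, bracketAt_mul_left, h1, h2, map_neg,
      substAt_X_mul, shift_apply, substAt_add_right, substAt_smul_right, smul_add]
    abel

theorem masterBracket_del_left (f g : DiffPoly ι F) :
    masterBracket H (del ι F f) g = -(X * masterBracket H f g) :=
  ext_scalarEval (F := F) fun t => by
    rw [map_neg, scalarEval_X_mul]
    exact bracketAt_del_left H t f g

theorem masterBracket_del_right (f g : DiffPoly ι F) :
    masterBracket H f (del ι F g) = lamD (del ι F) (masterBracket H f g) :=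
  ext_scalarEval (F := F) fun t => by
    rw [scalarEval_lamD]
    exact bracketAt_del_right H t f g

variable {H}

section Skew

variable (hskew : ∀ i j (t : F), bracketAt H t (MvPolynomial.X (j, 0)) (MvPolynomial.X (i, 0))
  = -adjAt (del ι F) t (masterBracket H (MvPolynomial.X (i, 0)) (MvPolynomial.X (j, 0))))
include hskew

theorem bracketAt_skew_of_generator (t : F) (f : DiffPoly ι F) (j : ι) :
    bracketAt H t (MvPolynomial.X (j, 0)) f
      = -adjAt (del ι F) t (masterBracket H f (MvPolynomial.X (j, 0))) := by
  induction f using MvPolynomial.induction_on with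
  | C a => rw [MvPolynomial.derivation_C, masterBracket_C_left, map_zero, neg_zero]
  | add p q hp hq => rw [map_add, masterBracket_add_left, map_add, hp, hq, neg_add]
  | mul_X p v hp =>
    have h1 : bracketAt H t (MvPolynomial.X (j, 0)) (MvPolynomial.X v)
        = -adjAt (del ι F) t (masterBracket H (MvPolynomial.X v) (MvPolynomial.X (j, 0))) := by
      obtain ⟨i, n⟩ := v
      induction n with
      | zero => exact hskew i j t
      | succ n ih =>
        rw [← del_X (i, n), bracketAt_del_right, masterBracket_del_left, ih, map_neg, map_neg,
          adjAt_X_mul, neg_neg]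
    rw [Derivation.leibniz, masterBracket_mul_left, map_add, adjAt_substLamD_C,
      adjAt_substLamD_C, hp, h1, smul_eq_mul, smul_eq_mul]
    ring

/-- Skew-symmetry of the Master Formula bracket, given skew-symmetry on generators. -/
theorem bracketAt_skew (t : F) (f g : DiffPoly ι F) :
    bracketAt H t g f = -adjAt (del ι F) t (masterBracket H f g) := by
  induction g using MvPolynomial.induction_on generalizing t with
  | C a => rw [bracketAt_C, masterBracket_C_right, map_zero, neg_zero]
  | add p q hp hq => rw [bracketAt_add, masterBracket_add, map_add, hp, hq, neg_add]
  | mul_X p v hp =>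
    have hX : ∀ t : F, bracketAt H t (MvPolynomial.X v) f
        = -adjAt (del ι F) t (masterBracket H f (MvPolynomial.X v)) := fun t => by
      obtain ⟨j, n⟩ := v
      induction n with
      | zero => exact bracketAt_skew_of_generator hskew t f j
      | succ n ih =>
        rw [← del_X (j, n), bracketAt_del_left, masterBracket_del_right, ih, adjAt_lamD, smul_neg]
    have h1 : masterBracket H p f = -substNegLamD (del ι F) (masterBracket H f p) :=
      ext_scalarEval (F := F) fun t => by
        rw [map_neg, scalarEval_substNegLamD]
        exact hp t
    have h2 : masterBracket H (MvPolynomial.X v) f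
        = -substNegLamD (del ι F) (masterBracket H f (MvPolynomial.X v)) :=
      ext_scalarEval (F := F) fun t => by
        rw [map_neg, scalarEval_substNegLamD]
        exact hX t
    rw [bracketAt_mul_left, h1, h2, map_neg, map_neg, substAt_substNegLamD, substAt_substNegLamD,
      masterBracket_mul, map_add, mul_comm (C p), mul_comm (C (MvPolynomial.X v))]
    abel

end Skew

variable (H) in
/-- The Jacobi identity for `f, g, h`, with `λ` and `μ` evaluated at the scalars `t` and `r`. -/
def JacobiAt (t r : F) (f g h : DiffPoly ι F) : Prop :=
  bracketAt H t f (bracketAt H r g h)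
    = bracketAt H (t + r) (bracketAt H t f g) h + bracketAt H r g (bracketAt H t f h)

theorem bracketAt_shift_right (t r : F) (f g : DiffPoly ι F) :
    bracketAt H t f (shift (del ι F) r g) = shift (del ι F) (t + r) (bracketAt H t f g) := by
  simp only [shift_apply, map_add, Derivation.map_smul, bracketAt_del_right, add_smul]
  abel

theorem bracketAt_shift_left (t r : F) (f g : DiffPoly ι F) :
    bracketAt H (t + r) (shift (del ι F) r f) g = -(t • bracketAt H (t + r) f g) := by
  simp only [shift_apply, bracketAt_add, bracketAt_smul, bracketAt_del_left, add_smul]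
  abel

/-- For `f`, `g` fixed, the defect of the Jacobi identity is a derivation in the last argument,
compatible with `∂`; so the identity only has to be checked on generators. -/
theorem JacobiAt.of_generators {t r : F} {f g : DiffPoly ι F}
    (hJ : ∀ k, JacobiAt H t r f g (MvPolynomial.X (k, 0))) (h : DiffPoly ι F) :
    JacobiAt H t r f g h := by
  induction h using MvPolynomial.induction_on with
  | C a => simp [JacobiAt]
  | add p q hp hq =>
    simp only [JacobiAt, map_add] at hp hq ⊢
    rw [hp, hq]
    abel
  | mul_X p v hp =>
    have hX : JacobiAt H t r f g (MvPolynomial.X v) := by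
      obtain ⟨k, n⟩ := v
      induction n with
      | zero => exact hJ k
      | succ n ih =>
        simp only [JacobiAt] at ih ⊢
        rw [← del_X (k, n), bracketAt_del_right, bracketAt_del_right, bracketAt_del_right,
          bracketAt_shift_right, bracketAt_shift_right, ih, map_add, add_comm r t]
    simp only [JacobiAt] at hp hX ⊢
    simp only [Derivation.leibniz, map_add, smul_eq_mul, hp, hX]
    ring

section Jacobi

variable (hs : ∀ (t : F) (f g : DiffPoly ι F),
  bracketAt H t g f = -adjAt (del ι F) t (masterBracket H f g))
include hs

theorem bracketAt_bracketAt_swap (t r : F) (f g h : DiffPoly ι F) :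
    bracketAt H (t + r) (bracketAt H r g f) h
      = -bracketAt H (t + r) (bracketAt H t f g) h := by
  have h1 : ∀ P : (DiffPoly ι F)[X], bracketAt H (t + r) (adjAt (del ι F) r P) h
      = bracketAt H (t + r) (scalarEval t P) h := fun P => by
    induction P using Polynomial.induction_on' with
    | add p q hp hq => rw [map_add, map_add, bracketAt_add, bracketAt_add, hp, hq]
    | monomial n a =>
      rw [adjAt_monomial, scalarEval_monomial, bracketAt_smul]
      induction n with
      | zero => simp
      | succ n ih =>
        rw [pow_succ', Module.End.mul_apply, LinearMap.neg_apply, bracketAt_neg,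
          bracketAt_shift_left, neg_neg, ih, smul_smul, pow_succ']
  rw [hs r f g, bracketAt_neg, h1]
  rfl

theorem JacobiAt.swap_left {f g h : DiffPoly ι F} (hJ : ∀ t r, JacobiAt H t r f g h) (t r : F) :
    JacobiAt H t r g f h := by
  have h1 := hJ r t
  simp only [JacobiAt] at h1 ⊢
  rw [add_comm t r, bracketAt_bracketAt_swap hs, h1]
  abel

/-- Exchanging the last two arguments amounts, by skew-symmetry, to the substitution
`μ ↦ -λ-μ-∂`. -/
theorem JacobiAt.swap_right {f g h : DiffPoly ι F} (hJ : ∀ t r, JacobiAt H t r f h g) (t r : F) :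
    JacobiAt H t r f g h := by
  let P₁ : (DiffPoly ι F)[X] := (masterBracket H h g).sum fun n c => monomial n (bracketAt H t f c)
  let P₂ := (masterBracket H (bracketAt H t f h) g).comp (X + C (algebraMap F _ t))
  let P₃ := masterBracket H h (bracketAt H t f g)
  have h0 : ∀ P : (DiffPoly ι F)[X],
      (∀ s : F, scalarEval s (P.sum fun n c => monomial n (bracketAt H t f c))
        = bracketAt H t f (scalarEval s P)) ∧
      ∀ s : F, adjAt (del ι F) (t + s) (P.sum fun n c => monomial n (bracketAt H t f c))
        = bracketAt H t f (adjAt (del ι F) s P) := fun P => by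
    induction P using Polynomial.induction_on' with
    | add p q hp hq =>
      simp only [sum_add_index p q (fun n c => monomial n (bracketAt H t f c)) (by simp) (by simp),
        map_add, hp.1, hp.2, hq.1, hq.2, implies_true, and_self]
    | monomial n a =>
      rw [sum_monomial_index _ _ (by simp)]
      refine ⟨fun s => ?_, fun s => ?_⟩
      · rw [scalarEval_monomial, scalarEval_monomial, Derivation.map_smul]
      · rw [adjAt_monomial, adjAt_monomial]
        induction n with
        | zero => simp
        | succ n ih =>
          rw [pow_succ', Module.End.mul_apply, ih, pow_succ', Module.End.mul_apply,
            LinearMap.neg_apply, LinearMap.neg_apply, map_neg, bracketAt_shift_right]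
  have hP : P₁ = P₂ + P₃ := ext_scalarEval (F := F) fun s => by
    rw [map_add, scalarEval_comp_X_add_C, (h0 _).1]
    exact hJ t s
  have h1 := congrArg (adjAt (del ι F) (t + r)) hP
  rw [map_add, adjAt_comp_X_add_C, (h0 _).2] at h1
  rw [JacobiAt, hs r h g, hs (t + r) h (bracketAt H t f g), map_neg, hs r (bracketAt H t f h) g,
    h1]
  abel

/-- The Jacobi identity for the Master Formula bracket follows from skew-symmetry and the Jacobi
identity on generators. -/
theorem JacobiAt.of_skew_of_generators
    (hJ : ∀ i j k (t r : F), JacobiAt H t r (MvPolynomial.X (i, 0)) (MvPolynomial.X (j, 0))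
      (MvPolynomial.X (k, 0))) (t r : F) (f g h : DiffPoly ι F) : JacobiAt H t r f g h := by
  have h1 : ∀ i g h (t r : F), JacobiAt H t r (MvPolynomial.X (i, 0)) g h := fun i g h t r =>
    JacobiAt.of_generators (fun j => JacobiAt.swap_right hs (fun t r =>
      JacobiAt.of_generators (fun k => hJ i j k t r) g) t r) h
  exact JacobiAt.of_generators (fun k => JacobiAt.swap_right hs
    (JacobiAt.swap_left hs fun t r => h1 k f g t r) t r) h

end Jacobi

end MasterFormula

/-! ### The affine Poisson vertex algebra -/

section Affine

open Polynomial

theorem masterBracket_X_X {F ι : Type*} [Field F] [Infinite F]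
    (H : ι → ι → Polynomial (DiffPoly ι F)) (i j : ι) :
    masterBracket H (MvPolynomial.X (i, 0)) (MvPolynomial.X (j, 0)) = H i j := by
  refine ext_scalarEval (F := F) fun t => ?_
  rw [← substAt_one (d := del ι F), substAt_masterBracket H t _ _ 1 {(j, 0)} {(i, 0)}
    (by simp [MvPolynomial.vars_X]) (by simp [MvPolynomial.vars_X])]
  simp [substAt_one]

variable {F 𝔤 ι : Type*} [Field F] [LieRing 𝔤] [LieAlgebra F 𝔤]

theorem form_lie_right {κ : LinearMap.BilinForm F 𝔤} (hinv : κ.lieInvariant 𝔤) (a b c : 𝔤) :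
    κ a ⁅b, c⁆ = κ ⁅a, b⁆ c := by
  rw [← lie_skew a b, map_neg, LinearMap.neg_apply, hinv, neg_neg]

theorem jet_basis (u : Module.Basis ι F 𝔤) (n : ℕ) (i : ι) :
    jet u n (u i) = MvPolynomial.X (i, n) := by
  simp [jet]

theorem del_jet (u : Module.Basis ι F 𝔤) (n : ℕ) (a : 𝔤) :
    del ι F (jet u n a) = jet u (n + 1) a := by
  have h1 : (del ι F : DiffPoly ι F →ₗ[F] DiffPoly ι F) ∘ₗ jet u n = jet u (n + 1) :=
    u.ext fun i => by simp [jet_basis, del_X]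
  exact congrArg (fun l => l a) h1

theorem del_iterate_jet (u : Module.Basis ι F 𝔤) (n m : ℕ) (a : 𝔤) :
    (del ι F)^[n] (jet u m a) = jet u (m + n) a := by
  induction n with
  | zero => rfl
  | succ n ih => rw [Function.iterate_succ_apply', ih, del_jet, add_assoc]

variable (u : Module.Basis ι F 𝔤) (κ : LinearMap.BilinForm F 𝔤) (z : F) (s : 𝔤)

/-- The λ-brackets of the generators of the affine Poisson vertex algebra. -/
noncomputable def affineGen (i j : ι) : Polynomial (DiffPoly ι F) :=
  Polynomial.C (jet u 0 ⁅u i, u j⁆)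
    + Polynomial.C (MvPolynomial.C (κ (u i) (u j))) * Polynomial.X
    + Polynomial.C (MvPolynomial.C (z * κ s ⁅u i, u j⁆))

theorem affineBracket_eq (f g : DiffPoly ι F) :
    affineBracket u κ z s f g = masterBracket (affineGen u κ z s) f g := rfl

variable [Infinite F]

theorem masterBracket_jet_jet (a b : 𝔤) :
    masterBracket (affineGen u κ z s) (jet u 0 a) (jet u 0 b)
      = C (jet u 0 ⁅a, b⁆) + C (MvPolynomial.C (κ a b)) * X
        + C (MvPolynomial.C (z * κ s ⁅a, b⁆)) := by
  refine ext_scalarEval (F := F) fun t => ?_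
  -- both sides are bilinear in `a` and `b`
  let L : 𝔤 →ₗ[F] 𝔤 →ₗ[F] DiffPoly ι F :=
    (masterLin (affineGen u κ z s)).compl₁₂ (jet u 0) (jet u 0) |>.compr₂ (scalarEval t)
  let e : 𝔤 →ₗ[F] 𝔤 →ₗ[F] 𝔤 := (LieAlgebra.ad F 𝔤 : 𝔤 →ₗ[F] Module.End F 𝔤)
  let c : F →ₗ[F] DiffPoly ι F := Algebra.linearMap F (DiffPoly ι F)
  let R : 𝔤 →ₗ[F] 𝔤 →ₗ[F] DiffPoly ι F :=
    e.compr₂ (jet u 0) + t • κ.compr₂ c + e.compr₂ (z • (c ∘ₗ κ s))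
  have hR : ∀ a b, R a b = scalarEval t (C (jet u 0 ⁅a, b⁆) + C (MvPolynomial.C (κ a b)) * X
      + C (MvPolynomial.C (z * κ s ⁅a, b⁆))) := fun a b => by
    rw [map_add, map_add, scalarEval_C, scalarEval_C, mul_comm, scalarEval_X_mul, scalarEval_C]
    simp [R, e, c, MvPolynomial.algebraMap_eq, MvPolynomial.smul_eq_C_mul]
  have hL : L = R := u.ext fun i => u.ext fun j => by
    rw [hR]
    simp only [L, LinearMap.compr₂_apply, LinearMap.compl₁₂_apply, jet_basis, masterLin_apply,
      masterBracket_X_X]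
    rfl
  rw [← hR, ← hL]
  rfl

theorem bracketAt_jet_jet (t : F) (a b : 𝔤) :
    bracketAt (affineGen u κ z s) t (jet u 0 a) (jet u 0 b)
      = jet u 0 ⁅a, b⁆ + MvPolynomial.C (t * κ a b + z * κ s ⁅a, b⁆) := by
  rw [bracketAt_apply, masterBracket_jet_jet, map_add, map_add, scalarEval_C, scalarEval_C,
    mul_comm, scalarEval_X_mul, scalarEval_C, MvPolynomial.smul_eq_C_mul]
  simp only [map_add, map_mul, add_assoc]

theorem adjAt_affine (t : F) (a b : 𝔤) :
    adjAt (del ι F) t (masterBracket (affineGen u κ z s) (jet u 0 a) (jet u 0 b))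
      = jet u 0 ⁅a, b⁆ + MvPolynomial.C (-(t * κ a b) + z * κ s ⁅a, b⁆) := by
  rw [masterBracket_jet_jet, map_add, map_add, adjAt_C, adjAt_C,
    mul_comm, adjAt_X_mul, adjAt_C, shift_apply, MvPolynomial.derivation_C, add_zero,
    MvPolynomial.smul_eq_C_mul]
  simp only [map_add, map_mul, map_neg, add_assoc]

variable (hsymm : κ.IsSymm) (hinv : κ.lieInvariant 𝔤)

include hsymm in
/-- Skew-symmetry of the affine Poisson vertex algebra. -/
theorem affine_skew (t : F) (f g : DiffPoly ι F) :
    bracketAt (affineGen u κ z s) t g f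
      = -adjAt (del ι F) t (masterBracket (affineGen u κ z s) f g) := by
  refine bracketAt_skew (fun i j t => ?_) t f g
  rw [← jet_basis u, ← jet_basis u, adjAt_affine, bracketAt_jet_jet, ← lie_skew (u i), map_neg,
    map_neg, ← hsymm.eq (u i)]
  simp
  ring

include hsymm hinv in
/-- The Jacobi identity of the affine Poisson vertex algebra. -/
theorem affine_jacobi (t r : F) (f g h : DiffPoly ι F) :
    JacobiAt (affineGen u κ z s) t r f g h := by
  refine JacobiAt.of_skew_of_generators (affine_skew u κ z s hsymm) (fun i j k t r => ?_) t r f g h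
  simp only [JacobiAt, ← jet_basis u, bracketAt_jet_jet, map_add, bracketAt_add, bracketAt_C,
    MvPolynomial.derivation_C, add_zero]
  have h1 := form_lie_right hinv (u i) (u j) (u k)
  have h2 : κ (u j) ⁅u i, u k⁆ = -κ ⁅u i, u j⁆ (u k) := by rw [hinv, neg_neg]
  rw [h1, h2, leibniz_lie (u i) (u j) (u k)]
  simp only [map_add, map_neg, map_mul]
  ring

end Affine

/-! ### The grading by `ad h` -/

section Grading

variable {F 𝔤 : Type*} [Field F] [LieRing 𝔤] [LieAlgebra F 𝔤] {κ : LinearMap.BilinForm F 𝔤}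
  {h e f : 𝔤}

theorem mem_grade {k : ℤ} {a : 𝔤} : a ∈ grade F h k ↔ ⁅h, a⁆ = (k : F) • a := by
  simp [grade]

theorem lie_mem_grade {j k : ℤ} {a b : 𝔤} (ha : a ∈ grade F h j) (hb : b ∈ grade F h k) :
    ⁅a, b⁆ ∈ grade F h (j + k) := by
  rw [mem_grade] at *
  rw [leibniz_lie, ha, hb, smul_lie, lie_smul, ← add_smul, Int.cast_add]

theorem grade_le_gradeGE {j k : ℤ} (hjk : j ≤ k) : grade F h k ≤ gradeGE F h j :=
  le_iSup₂_of_le k hjk le_rfl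

theorem grade_le_gradeLE {j k : ℤ} (hjk : k ≤ j) : grade F h k ≤ gradeLE F h j :=
  le_iSup₂_of_le k hjk le_rfl

theorem gradeGE_le_iff {k : ℤ} {M : Submodule F 𝔤} :
    gradeGE F h k ≤ M ↔ ∀ j, k ≤ j → grade F h j ≤ M :=
  iSup₂_le_iff

theorem gradeLE_le_iff {k : ℤ} {M : Submodule F 𝔤} :
    gradeLE F h k ≤ M ↔ ∀ j, j ≤ k → grade F h j ≤ M :=
  iSup₂_le_iff

theorem gradeGE_mono {j k : ℤ} (hjk : j ≤ k) : gradeGE F h k ≤ gradeGE F h j :=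
  gradeGE_le_iff.2 fun _ hi => grade_le_gradeGE (hjk.trans hi)

theorem gradeLE_eq_sup (k : ℤ) : gradeLE F h (k + 1) = grade F h (k + 1) ⊔ gradeLE F h k := by
  refine le_antisymm (gradeLE_le_iff.2 fun j hj => ?_)
    (sup_le (grade_le_gradeLE le_rfl) (gradeLE_le_iff.2 fun j hj => grade_le_gradeLE (by omega)))
  rcases hj.lt_or_eq with hj | rfl
  · exact (grade_le_gradeLE (by omega)).trans le_sup_right
  · exact le_sup_left

/-- A bilinear condition on `𝔤_{≥ j} × 𝔤_{≥ k}` may be checked on homogeneous elements. -/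
theorem gradeGE_induction₂ {j k : ℤ} {M : Submodule F 𝔤} {a b : 𝔤}
    (hM : ∀ j' k', j ≤ j' → k ≤ k' → ∀ a ∈ grade F h j', ∀ b ∈ grade F h k', ⁅a, b⁆ ∈ M)
    (ha : a ∈ gradeGE F h j) (hb : b ∈ gradeGE F h k) : ⁅a, b⁆ ∈ M := by
  have h1 : ∀ j', j ≤ j' → ∀ a ∈ grade F h j', ⁅a, b⁆ ∈ M := fun j' hj' a ha => by
    have : gradeGE F h k ≤ M.comap (LieAlgebra.ad F 𝔤 a) :=
      gradeGE_le_iff.2 fun k' hk' b hb => by simpa using hM j' k' hj' hk' a ha b hb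
    simpa using this hb
  have : gradeGE F h j ≤ M.comap (LieAlgebra.ad F 𝔤 b) :=
    gradeGE_le_iff.2 fun j' hj' a ha => by
      rw [Submodule.mem_comap, LieAlgebra.ad_apply, ← lie_skew]
      exact M.neg_mem (h1 j' hj' a ha)
  have h2 := this ha
  rw [Submodule.mem_comap, LieAlgebra.ad_apply, ← lie_skew] at h2
  exact neg_mem_iff.1 h2

theorem lie_mem_gradeGE {j k : ℤ} {a b : 𝔤} (ha : a ∈ gradeGE F h j) (hb : b ∈ gradeGE F h k) :
    ⁅a, b⁆ ∈ gradeGE F h (j + k) :=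
  gradeGE_induction₂ (fun _ _ hj hk _ ha _ hb =>
    grade_le_gradeGE (by omega) (lie_mem_grade ha hb)) ha hb

theorem IsSl2Triple.f_mem_grade (ht : IsSl2Triple h e f) : f ∈ grade F h (-2) := by
  rw [mem_grade, ht.lie_lie_smul_f F]
  simp

section Form

variable [CharZero F] (hinv : κ.lieInvariant 𝔤)
include hinv

theorem form_eq_zero_of_grade {j k : ℤ} (hjk : j + k ≠ 0) {a b : 𝔤} (ha : a ∈ grade F h j)
    (hb : b ∈ grade F h k) : κ a b = 0 := by
  rw [mem_grade] at *
  have h1 := hinv h a b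
  rw [ha, hb, map_smul, map_smul, LinearMap.smul_apply, smul_eq_mul, smul_eq_mul] at h1
  have h2 : ((j + k : ℤ) : F) * κ a b = 0 := by
    push_cast
    linear_combination h1
  exact (mul_eq_zero.1 h2).resolve_left (by exact_mod_cast hjk)

theorem form_eq_zero_of_gradeGE {j k : ℤ} (hjk : 0 < j + k) {a b : 𝔤} (ha : a ∈ gradeGE F h j)
    (hb : b ∈ gradeGE F h k) : κ a b = 0 := by
  have h1 : ∀ j', j ≤ j' → ∀ a ∈ grade F h j', κ a b = 0 := fun j' hj' a ha => by
    have : gradeGE F h k ≤ LinearMap.ker (κ a) := gradeGE_le_iff.2 fun k' hk' b hb =>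
      form_eq_zero_of_grade hinv (by omega) ha hb
    exact this hb
  have : gradeGE F h j ≤ LinearMap.ker (κ.flip b) := gradeGE_le_iff.2 h1
  exact this ha

theorem form_eq_zero_of_gradeLE {j k : ℤ} (hjk : j + k < 0) {a b : 𝔤} (ha : a ∈ grade F h j)
    (hb : b ∈ gradeLE F h k) : κ a b = 0 := by
  have : gradeLE F h k ≤ LinearMap.ker (κ a) := gradeLE_le_iff.2 fun k' hk' b hb =>
    form_eq_zero_of_grade hinv (by omega) ha hb
  exact this hb

end Form

section Proj

variable [CharZero F]

theorem iSupIndep_grade (h : 𝔤) : iSupIndep fun k : ℤ => grade F h k :=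
  (Module.End.eigenspaces_iSupIndep (LieAlgebra.ad F 𝔤 h)).comp Int.cast_injective

variable (htop : ⨆ k : ℤ, grade F h k = ⊤)
include htop

omit [CharZero F] in
theorem ext_grade {M : Type*} [AddCommGroup M] [Module F M] {L L' : 𝔤 →ₗ[F] M}
    (hL : ∀ k, ∀ a ∈ grade F h k, L a = L' a) : L = L' := by
  have h1 : ⨆ k : ℤ, grade F h k ≤ LinearMap.ker (L - L') :=
    iSup_le fun k a ha => by simp [hL k a ha]
  rw [htop, top_le_iff, LinearMap.ker_eq_top, sub_eq_zero] at h1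
  exact h1

theorem isCompl_grade (k : ℤ) : IsCompl (grade F h k) (⨆ j, ⨆ _ : j ≠ k, grade F h j) :=
  ⟨iSupIndep_grade h k, codisjoint_iff_le_sup.2 <| htop ▸ iSup_le fun j => by
    by_cases hj : j = k
    · exact hj ▸ le_sup_left
    · exact le_trans (le_iSup₂ (f := fun (j : ℤ) (_ : j ≠ k) => grade F h j) j hj) le_sup_right⟩

/-- The projection onto the component of degree `k` of the grading. -/
noncomputable def gradeProj (k : ℤ) : 𝔤 →ₗ[F] 𝔤 :=
  (grade F h k).projection _ (isCompl_grade htop k)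

theorem gradeProj_mem (k : ℤ) (a : 𝔤) : gradeProj htop k a ∈ grade F h k :=
  Submodule.projection_apply_mem _ _

theorem gradeProj_of_mem {k : ℤ} {a : 𝔤} (ha : a ∈ grade F h k) : gradeProj htop k a = a :=
  Submodule.projection_apply_of_mem_left _ ha

theorem gradeProj_of_ne {j k : ℤ} (hjk : j ≠ k) {a : 𝔤} (ha : a ∈ grade F h j) :
    gradeProj htop k a = 0 :=
  Submodule.projection_apply_of_mem_right _ ((le_iSup₂_of_le j hjk le_rfl :
    grade F h j ≤ ⨆ j, ⨆ _ : j ≠ k, grade F h j) ha)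

theorem gradeProj_of_mem_gradeGE {j k : ℤ} (hjk : k < j) {a : 𝔤} (ha : a ∈ gradeGE F h j) :
    gradeProj htop k a = 0 := by
  have : gradeGE F h j ≤ LinearMap.ker (gradeProj htop k) := gradeGE_le_iff.2 fun i hi a ha =>
    gradeProj_of_ne htop (by omega) ha
  exact this ha

variable (hinv : κ.lieInvariant 𝔤) (hnondeg : κ.Nondegenerate)
include hinv hnondeg

theorem eq_zero_of_gradeProj {a : 𝔤} (ha : ∀ k, gradeProj htop k a = 0) : a = 0 := by
  refine hnondeg.2 a fun b => ?_
  have h1 : κ.flip a = 0 := ext_grade htop fun k b hb => by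
    have h2 : κ b = κ b ∘ₗ gradeProj htop (-k) := ext_grade htop fun j c hc => by
      by_cases hj : j = -k
      · subst hj
        rw [LinearMap.comp_apply, gradeProj_of_mem htop hc]
      · rw [LinearMap.comp_apply, gradeProj_of_ne htop hj hc, map_zero,
          form_eq_zero_of_grade hinv (by omega) hb hc]
    rw [LinearMap.zero_apply]
    change κ b a = 0
    rw [h2, LinearMap.comp_apply, ha, map_zero]
  exact congrArg (fun l => l b) h1

omit htop hnondeg hinv in
theorem eq_zero_of_lie_f_of_grade [Module.Finite F 𝔤] (ht : IsSl2Triple h e f) {k : ℤ}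
    (hk : 1 ≤ k) {a : 𝔤} (ha : a ∈ grade F h k) (hfa : ⁅f, a⁆ = 0) : a = 0 := by
  by_contra ha0
  have hp : ht.symm.HasPrimitiveVectorWith a (-(k : F)) :=
    ⟨ha0, by rw [neg_lie, mem_grade.1 ha, neg_smul], hfa⟩
  obtain ⟨n, hn⟩ := hp.exists_nat
  have : -k = (n : ℤ) := by exact_mod_cast hn
  omega

/-- `ad f` is injective on the positive part of the grading: an element of its kernel would be a
lowest weight vector of positive weight. -/
theorem eq_zero_of_lie_f [Module.Finite F 𝔤] (ht : IsSl2Triple h e f) {a : 𝔤}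
    (ha : a ∈ gradeGE F h 1) (hfa : ⁅f, a⁆ = 0) : a = 0 := by
  refine eq_zero_of_gradeProj htop hinv hnondeg fun k => ?_
  by_cases hk : 1 ≤ k
  · refine eq_zero_of_lie_f_of_grade ht hk (gradeProj_mem htop k a) ?_
    have h1 : (LieAlgebra.ad F 𝔤 f : 𝔤 →ₗ[F] 𝔤) ∘ₗ gradeProj htop k
        = gradeProj htop (-2 + k) ∘ₗ (LieAlgebra.ad F 𝔤 f : 𝔤 →ₗ[F] 𝔤) :=
      ext_grade htop fun j b hb => by
        have h2 := lie_mem_grade (IsSl2Triple.f_mem_grade (F := F) ht) hb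
        by_cases hj : j = k
        · subst hj
          simp [gradeProj_of_mem htop hb, gradeProj_of_mem htop h2]
        · simp [gradeProj_of_ne htop hj hb,
            gradeProj_of_ne htop (show -2 + j ≠ -2 + k by omega) h2]
    have h2 := congrArg (fun l => l a) h1
    simpa [hfa] using h2
  · exact gradeProj_of_mem_gradeGE htop (by omega) ha

end Proj

end Grading

/-! ### Reduction data, slices and gauge frames -/

section Datum

variable {F 𝔤 : Type*} [Field F] [LieRing 𝔤] [LieAlgebra F 𝔤] {κ : LinearMap.BilinForm F 𝔤}
  {h e f : 𝔤} (D : ReductionDatum κ h f)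

theorem mem_sympCompl {l : Submodule F 𝔤} {a : 𝔤} :
    a ∈ sympCompl κ h f l ↔ a ∈ grade F h 1 ∧ ∀ b ∈ l, omega κ f a b = 0 := Iff.rfl

theorem ReductionDatum.m_le_n : D.l ⊔ gradeGE F h 2 ≤ D.n :=
  sup_le_sup_right (fun _ ha => ⟨D.l_le ha, D.isotropic _ ha⟩) _

theorem ReductionDatum.n_le : D.n ≤ gradeGE F h 1 :=
  sup_le (fun _ ha => grade_le_gradeGE le_rfl ha.1) (gradeGE_mono (by norm_num))

theorem ReductionDatum.m_le : D.l ⊔ gradeGE F h 2 ≤ gradeGE F h 1 := D.m_le_n.trans D.n_le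

theorem ReductionDatum.proj_mem (a : 𝔤) : D.proj a ∈ D.p := Submodule.projection_apply_mem _ _

theorem ReductionDatum.proj_of_mem_p {a : 𝔤} (ha : a ∈ D.p) : D.proj a = a :=
  Submodule.projection_apply_of_mem_left _ ha

theorem ReductionDatum.proj_of_mem_m {a : 𝔤} (ha : a ∈ D.l ⊔ gradeGE F h 2) : D.proj a = 0 :=
  Submodule.projection_apply_of_mem_right _ ha

theorem ReductionDatum.sub_proj_mem (a : 𝔤) : a - D.proj a ∈ D.l ⊔ gradeGE F h 2 := by
  rw [← Submodule.projection_apply_eq_zero_iff D.isCompl, map_sub]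
  exact sub_eq_zero.2 (D.proj_of_mem_p (D.proj_mem a)).symm

theorem ReductionDatum.iSup_grade (D : ReductionDatum κ h f) : ⨆ k : ℤ, grade F h k = ⊤ := by
  rw [← top_le_iff, ← D.isCompl.sup_eq_top]
  refine sup_le (D.p_le.trans (gradeLE_le_iff.2 fun j _ => le_iSup _ j))
    (D.m_le.trans (gradeGE_le_iff.2 fun j _ => le_iSup _ j))

theorem ReductionDatum.lie_mem_m {a b : 𝔤} (ha : a ∈ D.n) (hb : b ∈ D.l ⊔ gradeGE F h 2) :
    ⁅a, b⁆ ∈ D.l ⊔ gradeGE F h 2 :=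
  le_sup_right (a := D.l) (lie_mem_gradeGE (D.n_le ha) (D.m_le hb) : ⁅a, b⁆ ∈ gradeGE F h (1 + 1))

theorem ReductionDatum.lie_mem_n {a b : 𝔤} (ha : a ∈ D.n) (hb : b ∈ D.n) : ⁅a, b⁆ ∈ D.n :=
  le_sup_right (a := sympCompl κ h f D.l)
    (lie_mem_gradeGE (D.n_le ha) (D.n_le hb) : ⁅a, b⁆ ∈ gradeGE F h (1 + 1))

variable [CharZero F] (hinv : κ.lieInvariant 𝔤) (ht : IsSl2Triple h e f)
include hinv

theorem ReductionDatum.form_n_m {a b : 𝔤} (ha : a ∈ D.n) (hb : b ∈ D.l ⊔ gradeGE F h 2) :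
    κ a b = 0 :=
  form_eq_zero_of_gradeGE hinv (by norm_num) (D.n_le ha) (D.m_le hb)

include ht

theorem ReductionDatum.form_f_p {a : 𝔤} (ha : a ∈ D.p) : κ f a = 0 :=
  form_eq_zero_of_gradeLE hinv (by norm_num) (IsSl2Triple.f_mem_grade ht) (D.p_le ha)

theorem form_f_gradeGE {a : 𝔤} (ha : a ∈ gradeGE F h 3) : κ f a = 0 :=
  form_eq_zero_of_gradeGE hinv (by norm_num)
    (grade_le_gradeGE le_rfl (IsSl2Triple.f_mem_grade (F := F) ht)) ha

/-- `κ(f|·)` is a character of `𝔪` which is invariant under `𝔫`. -/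
theorem ReductionDatum.form_f_lie {a b : 𝔤} (ha : a ∈ D.n) (hb : b ∈ D.l ⊔ gradeGE F h 2) :
    κ f ⁅a, b⁆ = 0 := by
  obtain ⟨a₁, ha₁, a₂, ha₂, rfl⟩ := Submodule.mem_sup.1 ha
  obtain ⟨b₁, hb₁, b₂, hb₂, rfl⟩ := Submodule.mem_sup.1 hb
  have h1 : κ f ⁅a₁, b₁⁆ = 0 := ha₁.2 b₁ hb₁
  have h2 : κ f ⁅a₁, b₂⁆ = 0 := form_f_gradeGE hinv ht
    (lie_mem_gradeGE (grade_le_gradeGE le_rfl ha₁.1) hb₂ : _ ∈ gradeGE F h (1 + 2))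
  have h3 : κ f ⁅a₂, b₁ + b₂⁆ = 0 := form_f_gradeGE hinv ht
    (lie_mem_gradeGE ha₂ (D.m_le hb) : _ ∈ gradeGE F h (2 + 1))
  rw [add_lie, map_add, h3, lie_add, map_add, h1, h2, add_zero, add_zero]

end Datum

section Slice

variable {F 𝔤 : Type*} [Field F] [CharZero F] [LieRing 𝔤] [LieAlgebra F 𝔤] [Module.Finite F 𝔤]
  {κ : LinearMap.BilinForm F 𝔤} {h e f : 𝔤}

/-- A homogeneous basis `cⱼ` of a complement of `[f, 𝔤_{≥ 1}]` in `𝔤_{≥ 0}`; the affine space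
`f + span cⱼ` is a transversal slice for the gauge action. -/
structure Slice (F : Type*) {𝔤 : Type*} [Field F] [LieRing 𝔤] [LieAlgebra F 𝔤] (h f : 𝔤)
    (J : Type*) where
  c : J → 𝔤
  deg : J → ℤ
  mem : ∀ j, c j ∈ grade F h (deg j)
  deg_nonneg : ∀ j, 0 ≤ deg j
  linearIndependent : LinearIndependent F c
  disjoint : Disjoint (Submodule.span F (Set.range c))
    ((gradeGE F h 2).map (LieAlgebra.ad F 𝔤 f))
  le_sup : gradeGE F h 0 ≤ Submodule.span F (Set.range c) ⊔
    (gradeGE F h 2).map (LieAlgebra.ad F 𝔤 f)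

omit [CharZero F] in
theorem exists_slice (ht : IsSl2Triple h e f) :
    ∃ J : Set 𝔤, J.Finite ∧ Nonempty (Slice F h f J) := by
  let s : Set 𝔤 := {v | ∃ k : ℤ, 2 ≤ k ∧ ∃ a ∈ grade F h k, v = ⁅f, a⁆}
  let t : Set 𝔤 := {v | ∃ k : ℤ, 0 ≤ k ∧ v ∈ grade F h k}
  have hst : s ⊆ t := by
    rintro _ ⟨k, hk, a, ha, rfl⟩
    exact ⟨-2 + k, by omega, lie_mem_grade (IsSl2Triple.f_mem_grade ht) ha⟩
  have hs : Submodule.span F s = (gradeGE F h 2).map (LieAlgebra.ad F 𝔤 f) := by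
    refine le_antisymm (Submodule.span_le.2 ?_) (Submodule.map_le_iff_le_comap.2
      (gradeGE_le_iff.2 fun k hk a ha => Submodule.subset_span ⟨k, hk, a, ha, rfl⟩))
    rintro _ ⟨k, hk, a, ha, rfl⟩
    exact ⟨a, grade_le_gradeGE hk ha, rfl⟩
  have ht' : gradeGE F h 0 ≤ Submodule.span F t :=
    gradeGE_le_iff.2 fun k hk a ha => Submodule.subset_span ⟨k, hk, ha⟩
  obtain ⟨b, hbs, hspan, hb⟩ := exists_linearIndependent F s
  obtain ⟨b', hb't, hbb', htb', hb'⟩ := exists_linearIndepOn_extension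
    (v := id) (s := b) (t := t) hb (hbs.trans hst)
  simp only [Set.image_id] at htb'
  have hmem : ∀ v : ↥(b' \ b), ∃ k : ℤ, 0 ≤ k ∧ (v : 𝔤) ∈ grade F h k := fun v => hb't v.2.1
  choose deg hdeg hmem using hmem
  refine ⟨b' \ b, (LinearIndependent.setFinite hb').subset Set.sdiff_subset,
    ⟨⟨Subtype.val, deg, hmem, hdeg, hb'.mono Set.sdiff_subset, ?_, ?_⟩⟩⟩
  · rw [← hs, ← hspan, Subtype.range_coe]
    have h1 := hb'.linearIndependent.disjoint_span_image
      (s := Subtype.val ⁻¹' (b' \ b)) (t := Subtype.val ⁻¹' b)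
      (Set.disjoint_left.2 fun x hx hx' => hx.2 hx')
    convert h1 using 2
    · ext x
      simp +contextual
    · ext x
      simpa using fun hx => hbb' hx
  · rw [← hs, ← hspan, ← Submodule.span_union, Subtype.range_coe, Set.sdiff_union_of_subset hbb']
    exact ht'.trans (Submodule.span_le.2 htb')

variable (D : ReductionDatum κ h f) (hsymm : κ.IsSymm) (hinv : κ.lieInvariant 𝔤)
  (hnondeg : κ.Nondegenerate) (ht : IsSl2Triple h e f)
include hinv hnondeg ht

/-- The form `ω` is non-degenerate on `𝔤_{1/2}`, so that `l` is its own double symplectic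
complement. -/
theorem mem_of_omega_sympCompl {l : Submodule F 𝔤} (hl : l ≤ grade F h 1)
    (htop : ⨆ k : ℤ, grade F h k = ⊤) {b : 𝔤} (hb : b ∈ grade F h 1)
    (hω : ∀ a ∈ sympCompl κ h f l, omega κ f a b = 0) : b ∈ l := by
  let B : LinearMap.BilinForm F (grade F h 1) := LinearMap.mk₂ F (fun a b => κ f ⁅(a : 𝔤), (b : 𝔤)⁆)
    (by simp) (by simp) (by simp) (by simp)
  have hB : ∀ a b, B a b = κ f ⁅(a : 𝔤), (b : 𝔤)⁆ := fun _ _ => rfl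
  have hskew : ∀ a b, B a b = -B b a := fun a b => by
    rw [hB, hB, ← lie_skew, map_neg]
  have hrefl : B.IsRefl := fun a b hab => by rw [hskew, hab, neg_zero]
  have hleft : LinearMap.SeparatingLeft B := fun a ha => by
    refine Subtype.ext (eq_zero_of_lie_f_of_grade ht le_rfl a.2 (hnondeg.1 _ fun b => ?_))
    have hfa := lie_mem_grade (IsSl2Triple.f_mem_grade (F := F) ht) a.2
    -- `[f, a]` has degree `-1/2`, and only the component of `b` of degree `1/2` matters
    have h1 : κ ⁅f, (a : 𝔤)⁆ = 0 := ext_grade htop fun j b hb => by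
      by_cases hj : j = 1
      · subst hj
        rw [← form_lie_right hinv]
        exact ha ⟨b, hb⟩
      · exact form_eq_zero_of_grade hinv (by omega) hfa hb
    rw [h1, LinearMap.zero_apply]
  have hBn : B.Nondegenerate := ⟨hleft, fun b hb => hleft b fun a => by
    rw [hskew, hb, neg_zero]⟩
  have h2 := LinearMap.BilinForm.orthogonal_orthogonal hBn hrefl (l.comap (grade F h 1).subtype)
  have h3 : (⟨b, hb⟩ : grade F h 1) ∈ l.comap (grade F h 1).subtype := by
    rw [← h2]
    intro a ha
    refine hω a ⟨a.2, fun c hc => ?_⟩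
    have h4 := hrefl _ _ (ha ⟨c, hl hc⟩ hc)
    exact h4
  exact h3

omit ht hinv in
include hsymm in
/-- A linearly independent family of homogeneous vectors has a homogeneous dual family. -/
theorem exists_homogeneous_dual (htop : ⨆ k : ℤ, grade F h k = ⊤) {K : Type*} {w : K → 𝔤}
    {dw : K → ℤ} (hlin : LinearIndependent F w) (hw : ∀ v, w v ∈ grade F h (dw v)) (v : K) :
    ∃ b : 𝔤, κ (w v) b = 1 ∧ (∀ v', v' ≠ v → κ (w v') b = 0) ∧
      ∀ k : ℤ, k ≠ dw v → ∀ x ∈ grade F h k, κ x b = 0 := by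
  obtain ⟨l, hlv, hl⟩ := Submodule.exists_le_ker_of_notMem
    (hlin.notMem_span_image (s := {v}ᶜ) (x := v) (by simp))
  let ξ : Module.Dual F 𝔤 := (l (w v))⁻¹ • l ∘ₗ gradeProj htop (dw v)
  let b := (LinearMap.BilinForm.toDual κ hnondeg).symm ξ
  have hb : ∀ x, κ x b = (l (w v))⁻¹ * l (gradeProj htop (dw v) x) := fun x =>
    (hsymm.eq x b).trans (LinearMap.BilinForm.apply_toDual_symm_apply (hB := hnondeg) ξ x)
  refine ⟨b, ?_, fun v' hv' => ?_, fun k hk x hx => ?_⟩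
  · rw [hb, gradeProj_of_mem htop (hw v), inv_mul_cancel₀ hlv]
  · rw [hb]
    by_cases hd : dw v' = dw v
    · have h1 : l (w v') = 0 := hl (Submodule.subset_span ⟨v', hv', rfl⟩)
      rw [← hd, gradeProj_of_mem htop (hw v'), h1, mul_zero]
    · rw [gradeProj_of_ne htop hd (hw v'), map_zero, mul_zero]
  · rw [hb, gradeProj_of_ne htop hk hx, map_zero, mul_zero]

omit hinv hnondeg in
/-- `[f, 𝔫]` meets the slice directions only in `0`. -/
theorem disjoint_lie_f_slice {J : Type*} (S : Slice F h f J) :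
    Disjoint (D.n.map (LieAlgebra.ad F 𝔤 f)) (Submodule.span F (Set.range S.c)) := by
  have htop := D.iSup_grade
  have hf := IsSl2Triple.f_mem_grade (F := F) ht
  rw [Submodule.disjoint_def]
  rintro _ ⟨x, hx, rfl⟩ hx'
  obtain ⟨x₁, hx₁, x₂, hx₂, rfl⟩ := Submodule.mem_sup.1 hx
  rw [LieAlgebra.ad_apply] at hx' ⊢
  have hfx₁ : ⁅f, x₁⁆ ∈ grade F h (-1) := by simpa using lie_mem_grade hf hx₁.1
  have hfx₂ : ⁅f, x₂⁆ ∈ gradeGE F h 0 := by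
    simpa using lie_mem_gradeGE (grade_le_gradeGE le_rfl hf) hx₂
  -- the component of degree `-1/2` vanishes since the slice lies in non-negative degrees
  have h1 : gradeProj htop (-1) ⁅f, x₁ + x₂⁆ = ⁅f, x₁⁆ := by
    rw [lie_add, map_add, gradeProj_of_mem htop hfx₁,
      gradeProj_of_mem_gradeGE htop (by norm_num) hfx₂, add_zero]
  have hle : Submodule.span F (Set.range S.c) ≤ gradeGE F h 0 := by
    refine Submodule.span_le.2 ?_
    rintro _ ⟨j, rfl⟩
    exact grade_le_gradeGE (S.deg_nonneg j) (S.mem j)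
  have h2 : gradeProj htop (-1) ⁅f, x₁ + x₂⁆ = 0 :=
    gradeProj_of_mem_gradeGE htop (by norm_num) (hle hx')
  have h3 : x₁ = 0 := eq_zero_of_lie_f_of_grade ht le_rfl hx₁.1 (h1.symm.trans h2)
  subst h3
  rw [zero_add] at hx' ⊢
  exact (Submodule.disjoint_def.1 S.disjoint) _ hx' ⟨x₂, hx₂, rfl⟩

/-- `𝔪` is the orthogonal of the span of `[f, 𝔫]` and of the slice directions. -/
theorem mem_m_of_form_eq_zero {J : Type*} (S : Slice F h f J) {q : 𝔤}
    (hn : ∀ a ∈ D.n, κ ⁅f, a⁆ q = 0) (hc : ∀ j, κ (S.c j) q = 0) : q ∈ D.l ⊔ gradeGE F h 2 := by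
  have htop := D.iSup_grade
  -- only the `𝔭`-component of `q` matters, and it lies in `𝔤_{≤ 1/2}`
  have hn' : ∀ a ∈ D.n, κ ⁅f, a⁆ (D.proj q) = 0 := fun a ha => by
    have h1 := D.form_f_lie hinv ht ha (D.sub_proj_mem q)
    rwa [form_lie_right hinv, map_sub, hn a ha, zero_sub, neg_eq_zero] at h1
  have hc' : ∀ j, κ (S.c j) (D.proj q) = 0 := fun j => by
    have h1 := form_eq_zero_of_gradeGE hinv (by norm_num)
      (grade_le_gradeGE (S.deg_nonneg j) (S.mem j)) (D.m_le (D.sub_proj_mem q))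
    rwa [map_sub, hc j, zero_sub, neg_eq_zero] at h1
  have hle : Submodule.span F (Set.range S.c) ⊔ (gradeGE F h 2).map (LieAlgebra.ad F 𝔤 f)
      ≤ LinearMap.ker (κ.flip (D.proj q)) := by
    refine sup_le (Submodule.span_le.2 ?_) ?_
    · rintro _ ⟨j, rfl⟩
      exact hc' j
    · rintro _ ⟨a, ha, rfl⟩
      exact hn' a (le_sup_right (a := sympCompl κ h f D.l) ha)
  have hnonneg : ∀ x ∈ gradeGE F h 0, κ x (D.proj q) = 0 := fun x hx => hle (S.le_sup hx)
  have hp := D.p_le (D.proj_mem q)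
  rw [show (1 : ℤ) = 0 + 1 from rfl, gradeLE_eq_sup] at hp
  obtain ⟨x, hx, y, hy, hxy⟩ := Submodule.mem_sup.1 hp
  have hy0 : y = 0 := by
    refine hnondeg.2 y fun c => ?_
    have h1 : κ.flip y = 0 := ext_grade htop fun k c hc => by
      change κ c y = 0
      by_cases hk : 0 ≤ k
      · have h2 := hnonneg c (grade_le_gradeGE hk hc)
        rwa [← hxy, map_add, form_eq_zero_of_grade hinv (by omega) hc hx, zero_add] at h2
      · exact form_eq_zero_of_gradeLE hinv (by omega) hc hy
    exact congrArg (fun l => l c) h1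
  rw [hy0, add_zero] at hxy
  have hxl : x ∈ D.l := mem_of_omega_sympCompl hinv hnondeg ht D.l_le htop hx fun a ha => by
    rw [omega, form_lie_right hinv, hxy]
    exact hn' a (le_sup_left (a := sympCompl κ h f D.l) ha)
  rw [← sub_add_cancel q (D.proj q)]
  exact Submodule.add_mem _ (D.sub_proj_mem q) (hxy ▸ le_sup_left (b := gradeGE F h 2) hxl)

/-- Coordinates on the affine space `f + 𝔪^⊥` adapted to the gauge action of `𝔫`: a homogeneous
basis `aᵢ` of `𝔫`, and homogeneous elements `bᵥ` of `𝔤` dual to the basis `[f, aᵢ], cⱼ` of `𝔪^⊥`.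
The degrees are those of `aᵢ` and of the basis of `𝔪^⊥`. -/
structure GaugeFrame {J : Type*} (S : Slice F h f J) (D : ReductionDatum κ h f) (I : Type*) where
  a : I → 𝔤
  degA : I → ℤ
  a_mem : ∀ i, a i ∈ grade F h (degA i)
  degA_pos : ∀ i, 1 ≤ degA i
  span_a : Submodule.span F (Set.range a) = D.n
  b : I ⊕ J → 𝔤
  dual_self : ∀ v, κ (Sum.elim (fun i => ⁅f, a i⁆) S.c v) (b v) = 1
  dual_ne : ∀ v v', v ≠ v' → κ (Sum.elim (fun i => ⁅f, a i⁆) S.c v) (b v') = 0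
  b_homogeneous : ∀ v (k : ℤ), k ≠ Sum.elim (fun i => degA i - 2) S.deg v →
    ∀ x ∈ grade F h k, κ x (b v) = 0
  mem_m_iff : ∀ q, q ∈ D.l ⊔ gradeGE F h 2 ↔
    ∀ v, κ (Sum.elim (fun i => ⁅f, a i⁆) S.c v) q = 0

include hsymm in
theorem exists_gaugeFrame {J : Type*} (S : Slice F h f J) :
    ∃ I : Set 𝔤, I.Finite ∧ Nonempty (GaugeFrame S D I) := by
  have htop := D.iSup_grade
  let s : Set 𝔤 := {v | v ∈ D.n ∧ ∃ k : ℤ, 1 ≤ k ∧ v ∈ grade F h k}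
  obtain ⟨I, hIs, hIspan, hI⟩ := exists_linearIndependent F s
  have hspan : Submodule.span F (Set.range fun i : I => (i : 𝔤)) = D.n := by
    rw [Subtype.range_coe, hIspan]
    refine le_antisymm (Submodule.span_le.2 fun v hv => hv.1) (sup_le (fun v hv => ?_) ?_)
    · exact Submodule.subset_span ⟨le_sup_left (a := sympCompl κ h f D.l) hv, 1, le_rfl, hv.1⟩
    · exact gradeGE_le_iff.2 fun k hk v hv => Submodule.subset_span
        ⟨le_sup_right (a := sympCompl κ h f D.l) (grade_le_gradeGE hk hv), k, by omega, hv⟩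
  have hdeg : ∀ i : I, ∃ k : ℤ, 1 ≤ k ∧ (i : 𝔤) ∈ grade F h k := fun i => (hIs i.2).2
  choose degA hdegA hmemA using hdeg
  let w : I ⊕ J → 𝔤 := Sum.elim (fun i => ⁅f, (i : 𝔤)⁆) S.c
  have hw : ∀ v, w v ∈ grade F h (Sum.elim (fun i => degA i - 2) S.deg v) := by
    rintro (i | j)
    · have := lie_mem_grade (IsSl2Triple.f_mem_grade (F := F) ht) (hmemA i)
      rwa [neg_add_eq_sub] at this
    · exact S.mem j
  have hlinA : LinearIndependent F fun i : I => ⁅f, (i : 𝔤)⁆ := by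
    refine LinearIndependent.map_injOn (v := fun i : I => (i : 𝔤)) hI
      (LieAlgebra.ad F 𝔤 f : 𝔤 →ₗ[F] 𝔤) fun x hx y hy hxy => ?_
    rw [hspan] at hx hy
    refine sub_eq_zero.1 (eq_zero_of_lie_f htop hinv hnondeg ht
      (Submodule.sub_mem _ (D.n_le hx) (D.n_le hy)) ?_)
    rw [lie_sub, sub_eq_zero]
    exact hxy
  have hadf : Submodule.span F (Set.range fun i : I => ⁅f, (i : 𝔤)⁆)
      = D.n.map (LieAlgebra.ad F 𝔤 f) := by
    rw [← hspan, Submodule.map_span, ← Set.range_comp]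
    rfl
  have hlin : LinearIndependent F w := LinearIndependent.sum_type hlinA S.linearIndependent
    (hadf ▸ disjoint_lie_f_slice D ht S)
  choose b hb hb' hb'' using exists_homogeneous_dual hsymm hnondeg htop hlin hw
  refine ⟨I, LinearIndependent.setFinite hI, ⟨⟨fun i => i, degA, hmemA, hdegA, hspan, b, hb,
    fun v v' hv => hb' v' v hv, hb'', fun q => ⟨?_, fun hq => ?_⟩⟩⟩⟩
  · rintro hq (i | j)
    · simp only [Sum.elim_inl]
      rw [← form_lie_right hinv]
      exact D.form_f_lie hinv ht (hIs i.2).1 hq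
    · exact form_eq_zero_of_gradeGE hinv (by norm_num)
        (grade_le_gradeGE (S.deg_nonneg j) (S.mem j)) (D.m_le hq)
  · refine mem_m_of_form_eq_zero D hinv hnondeg ht S (fun a ha => ?_) fun j => hq (Sum.inr j)
    have h1 : Submodule.span F (Set.range fun i : I => ⁅f, (i : 𝔤)⁆)
        ≤ LinearMap.ker (κ.flip q) := by
      refine Submodule.span_le.2 ?_
      rintro _ ⟨i, rfl⟩
      exact hq (Sum.inl i)
    rw [hadf] at h1
    exact h1 ⟨a, ha, rfl⟩

end Slice

/-! ### The map `ρ` and invariants of the λ-action of `𝔫` -/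

section

open Polynomial

section Map

variable {F A B : Type*} [Field F] [CommRing A] [Algebra F A] [CommRing B] [Algebra F B]
  {d : Derivation F A A} {d' : Derivation F B B} (ψ : A →ₐ[F] B)

theorem scalarEval_map (t : F) (P : A[X]) :
    scalarEval t (P.map (ψ : A →+* B)) = ψ (scalarEval t P) := by
  rw [scalarEval_apply, scalarEval_apply, ← ψ.commutes t]
  exact eval_map_apply (f := (ψ : A →+* B)) _

theorem scalarEval_map_algEquiv (E : A ≃ₐ[F] B) (t : F) (P : A[X]) :
    scalarEval t (P.map (E : A →+* B)) = E (scalarEval t P) :=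
  scalarEval_map (E : A →ₐ[F] B) t P

variable (hψ : ∀ a, ψ (d a) = d' (ψ a))
include hψ

theorem map_shift (t : F) (a : A) : ψ (shift d t a) = shift d' t (ψ a) := by
  rw [shift_apply, shift_apply, map_add, map_smul, hψ]

theorem map_shift_pow (t : F) (n : ℕ) (a : A) :
    ψ ((shift d t ^ n) a) = (shift d' t ^ n) (ψ a) := by
  induction n with
  | zero => rfl
  | succ n ih =>
    rw [pow_succ', Module.End.mul_apply, map_shift ψ hψ, ih, pow_succ', Module.End.mul_apply]

theorem map_substAt (t : F) (h : A) (P : A[X]) :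
    ψ (substAt d t h P) = substAt d' t (ψ h) (P.map (ψ : A →+* B)) := by
  induction P using Polynomial.induction_on' with
  | add p q hp hq => rw [map_add, map_add, hp, hq, Polynomial.map_add, map_add]
  | monomial n a =>
    rw [substAt_monomial, map_monomial, substAt_monomial, map_mul, map_shift_pow ψ hψ]
    rfl

theorem map_adjAt (t : F) (P : A[X]) :
    ψ (adjAt d t P) = adjAt d' t (P.map (ψ : A →+* B)) := by
  induction P using Polynomial.induction_on' with
  | add p q hp hq => rw [map_add, map_add, hp, hq, Polynomial.map_add, map_add]
  | monomial n a =>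
    rw [adjAt_monomial, map_monomial, adjAt_monomial]
    induction n with
    | zero => rfl
    | succ n ih =>
      rw [pow_succ', Module.End.mul_apply, LinearMap.neg_apply, map_neg, map_shift ψ hψ, ih,
        pow_succ', Module.End.mul_apply, LinearMap.neg_apply]

end Map

section Jacobi

variable {F B : Type*} [Field F] [CommRing B] [Algebra F B] (φ : B →ₗ[F] B[X]) (t r : F)

theorem scalarEval_jacobi_left (P : B[X]) :
    scalarEval t ((P.sum fun m c => monomial m (φ c)).eval (C (algebraMap F B r)))
      = scalarEval t (φ (scalarEval r P)) := by
  induction P using Polynomial.induction_on' with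
  | add p q hp hq =>
    rw [sum_add_index p q _ (by simp) (by simp), eval_add, map_add, hp, hq, map_add, map_add,
      map_add]
  | monomial n a =>
    rw [sum_monomial_index _ _ (by simp), eval_monomial, scalarEval_monomial, map_smul, map_smul]
    simp [scalarEval_apply, Algebra.smul_def, mul_comm]

theorem scalarEval_jacobi_middle (P : B[X]) :
    scalarEval t ((P.sum fun m c => C (X ^ m) *
      (φ c).eval₂ (C.comp C) (C X + X)).eval (C (algebraMap F B r)))
      = scalarEval (t + r) (φ (scalarEval t P)) := by
  induction P using Polynomial.induction_on' with
  | add p q hp hq =>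
    rw [sum_add_index p q _ (by simp) (by simp [mul_add]), eval_add, map_add, hp, hq, map_add,
      map_add, map_add]
  | monomial n a =>
    let ev : B[X][X] →+* B :=
      (evalRingHom (algebraMap F B t)).comp (evalRingHom (C (algebraMap F B r)))
    have hev : ∀ Q, ev Q = scalarEval t (Q.eval (C (algebraMap F B r))) := fun Q => rfl
    have h1 : ev.comp (C.comp C) = RingHom.id B := by
      ext x
      simp [ev]
    rw [sum_monomial_index _ _ (by simp), ← hev, map_mul, hom_eval₂, h1, scalarEval_monomial,
      map_smul, map_smul]
    simp [ev, scalarEval_apply, Algebra.smul_def, eval₂_id]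

theorem scalarEval_jacobi_right (P : B[X]) :
    scalarEval t ((P.sum fun m c => C (X ^ m) * (φ c).map C).eval (C (algebraMap F B r)))
      = scalarEval r (φ (scalarEval t P)) := by
  induction P using Polynomial.induction_on' with
  | add p q hp hq =>
    rw [sum_add_index p q _ (by simp) (by simp [mul_add]), eval_add, map_add, hp, hq, map_add,
      map_add, map_add]
  | monomial n a =>
    rw [sum_monomial_index _ _ (by simp), scalarEval_monomial, map_smul, map_smul, eval_mul,
      scalarEval_mul, eval_map_apply]
    simp [scalarEval_apply, Algebra.smul_def]

end Jacobi

section Rho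

variable {F 𝔤 ι : Type*} [Field F] [LieRing 𝔤] [LieAlgebra F 𝔤] {κ : LinearMap.BilinForm F 𝔤}
  {h e f : 𝔤} (D : ReductionDatum κ h f) (u : Module.Basis ι F 𝔤)

/-- An algebra homomorphism commutes with the derivations as soon as it does so on generators. -/
theorem algHom_del {ι' : Type*} (ψ : DiffPoly ι F →ₐ[F] DiffPoly ι' F)
    (hψ : ∀ i n, ψ (MvPolynomial.X (i, n + 1)) = del ι' F (ψ (MvPolynomial.X (i, n))))
    (P : DiffPoly ι F) : ψ (del ι F P) = del ι' F (ψ P) := by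
  induction P using MvPolynomial.induction_on with
  | C a => simp [← MvPolynomial.algebraMap_eq]
  | add p q hp hq => simp only [map_add, hp, hq]
  | mul_X p v hp =>
    simp only [Derivation.leibniz, smul_eq_mul, map_add, map_mul, hp, del_X]
    rw [hψ v.1 v.2]

theorem ReductionDatum.rho_X (v : ι × ℕ) : D.rho u (MvPolynomial.X v)
    = (del ι F)^[v.2] (jet u 0 (D.proj (u v.1)) + MvPolynomial.C (κ f (u v.1))) :=
  MvPolynomial.aeval_X _ _

theorem ReductionDatum.rho_del (P : DiffPoly ι F) :
    D.rho u (del ι F P) = del ι F (D.rho u P) :=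
  algHom_del (D.rho u) (fun i n => by
    rw [D.rho_X, D.rho_X, Function.iterate_succ_apply']) P

theorem ReductionDatum.rho_C (c : F) :
    D.rho u (MvPolynomial.C c) = MvPolynomial.C c := (D.rho u).commutes c

theorem ReductionDatum.rho_jet_zero (a : 𝔤) :
    D.rho u (jet u 0 a) = jet u 0 (D.proj a) + MvPolynomial.C (κ f a) := by
  have h1 : (D.rho u).toLinearMap ∘ₗ jet u 0
      = jet u 0 ∘ₗ D.proj + Algebra.linearMap F (DiffPoly ι F) ∘ₗ κ f := u.ext fun i => by
    simp [jet_basis, D.rho_X, MvPolynomial.algebraMap_eq]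
  exact congrArg (fun l => l a) h1

theorem algHom_del_iterate {ι' : Type*} (ψ : DiffPoly ι F →ₐ[F] DiffPoly ι' F)
    (hψ : ∀ P, ψ (del ι F P) = del ι' F (ψ P)) (n : ℕ) (P : DiffPoly ι F) :
    ψ ((del ι F)^[n] P) = (del ι' F)^[n] (ψ P) := by
  induction n with
  | zero => rfl
  | succ n ih => rw [Function.iterate_succ_apply', hψ, ih, Function.iterate_succ_apply']

theorem jet_eq_iterate (n : ℕ) (a : 𝔤) : jet u n a = (del ι F)^[n] (jet u 0 a) := by
  rw [del_iterate_jet, zero_add]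

theorem ReductionDatum.rho_jet_of_mem_m {n : ℕ} {a : 𝔤} (ha : a ∈ D.l ⊔ gradeGE F h 2)
    (hfa : κ f a = 0) : D.rho u (jet u n a) = 0 := by
  rw [jet_eq_iterate, algHom_del_iterate _ (D.rho_del u), rho_jet_zero, D.proj_of_mem_m ha, hfa,
    map_zero, map_zero, add_zero, iterate_map_zero]

theorem ReductionDatum.jet_mem_Vp {a : 𝔤} (ha : a ∈ D.p) (n : ℕ) : jet u n a ∈ D.Vp u :=
  Algebra.subset_adjoin ⟨a, ha, n, rfl⟩

theorem ReductionDatum.del_mem_Vp {P : DiffPoly ι F} (hP : P ∈ D.Vp u) : del ι F P ∈ D.Vp u := by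
  induction hP using Algebra.adjoin_induction with
  | mem x hx =>
    obtain ⟨a, ha, n, rfl⟩ := hx
    rw [del_jet]
    exact D.jet_mem_Vp u ha _
  | algebraMap r => simp
  | add x y _ _ hx hy =>
    rw [map_add]
    exact add_mem hx hy
  | mul x y hx' hy' hx hy =>
    rw [Derivation.leibniz]
    exact add_mem (mul_mem hx' hy) (mul_mem hy' hx)

theorem ReductionDatum.rho_mem_Vp (P : DiffPoly ι F) : D.rho u P ∈ D.Vp u := by
  induction P using MvPolynomial.induction_on with
  | C a =>
    rw [rho_C]
    exact Subalgebra.algebraMap_mem _ a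
  | add p q hp hq =>
    rw [map_add]
    exact add_mem hp hq
  | mul_X p v hp =>
    rw [map_mul]
    refine mul_mem hp ?_
    obtain ⟨i, n⟩ := v
    induction n with
    | zero =>
      rw [rho_X]
      exact add_mem (D.jet_mem_Vp u (D.proj_mem _) 0) (Subalgebra.algebraMap_mem _ _)
    | succ n ih =>
      rw [← del_X (i, n), rho_del]
      exact D.del_mem_Vp u ih

variable [CharZero F] (hsymm : κ.IsSymm) (hinv : κ.lieInvariant 𝔤) (ht : IsSl2Triple h e f)
include hinv ht

theorem ReductionDatum.rho_of_mem_Vp {P : DiffPoly ι F} (hP : P ∈ D.Vp u) : D.rho u P = P := by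
  induction hP using Algebra.adjoin_induction with
  | mem x hx =>
    obtain ⟨a, ha, n, rfl⟩ := hx
    rw [jet_eq_iterate, algHom_del_iterate _ (D.rho_del u), rho_jet_zero, D.proj_of_mem_p ha,
      D.form_f_p hinv ht ha, map_zero, add_zero]
  | algebraMap r => exact (D.rho u).commutes r
  | add x y _ _ hx hy => rw [map_add, hx, hy]
  | mul x y _ _ hx hy => rw [map_mul, hx, hy]

theorem ReductionDatum.rho_rho (P : DiffPoly ι F) : D.rho u (D.rho u P) = D.rho u P :=
  D.rho_of_mem_Vp u hinv ht (D.rho_mem_Vp u P)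

variable (z : F) (s : 𝔤)

omit hinv ht [CharZero F] in
/-- `g` is invariant under the λ-action of `𝔫`, modulo the kernel of `ρ`. -/
def ReductionDatum.IsInvariant [Infinite F] (g : DiffPoly ι F) : Prop :=
  ∀ a ∈ D.n, ∀ t : F, D.rho u (bracketAt (affineGen u κ z s) t (jet u 0 a) g) = 0

omit hinv ht in
theorem ReductionDatum.mem_W_iff {g : DiffPoly ι F} :
    g ∈ D.W u z s ↔ g ∈ D.Vp u ∧ D.IsInvariant u z s g := by
  refine and_congr_right fun _ => forall₂_congr fun a _ => ⟨fun h1 t => ?_, fun h1 => ?_⟩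
  · rw [bracketAt_apply, ← scalarEval_map, ← affineBracket_eq]
    exact (congrArg (scalarEval t) h1).trans (map_zero _)
  · refine ext_scalarEval (F := F) fun t => ?_
    rw [map_zero, ← h1 t, bracketAt_apply, ← scalarEval_map]
    rfl

/-- The kernel of `ρ` is stable under the λ-action of `𝔫`, since `κ(f|·)` is an `𝔫`-invariant
character of `𝔪`. -/
theorem ReductionDatum.rho_bracket_n (hs : ∀ a ∈ gradeGE F h 1, ∀ b : 𝔤, z * κ s ⁅a, b⁆ = 0)
    {a : 𝔤} (ha : a ∈ D.n) (t : F) (P : DiffPoly ι F) :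
    D.rho u (bracketAt (affineGen u κ z s) t (jet u 0 a) (D.rho u P))
      = D.rho u (bracketAt (affineGen u κ z s) t (jet u 0 a) P) := by
  induction P using MvPolynomial.induction_on with
  | C c => rw [rho_C]
  | add p q hp hq => simp only [map_add, hp, hq]
  | mul_X p v hp =>
    have hX : D.rho u (bracketAt (affineGen u κ z s) t (jet u 0 a) (D.rho u (MvPolynomial.X v)))
        = D.rho u (bracketAt (affineGen u κ z s) t (jet u 0 a) (MvPolynomial.X v)) := by
      obtain ⟨i, n⟩ := v
      induction n with
      | zero =>
        rw [← jet_basis u, rho_jet_zero, map_add, MvPolynomial.derivation_C, add_zero]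
        have hm := D.sub_proj_mem (u i)
        have h1 : D.rho u (bracketAt (affineGen u κ z s) t (jet u 0 a)
            (jet u 0 (u i - D.proj (u i)))) = 0 := by
          rw [bracketAt_jet_jet, hs a (D.n_le ha), D.form_n_m hinv ha hm, map_add,
            D.rho_jet_of_mem_m u (D.lie_mem_m ha hm) (D.form_f_lie hinv ht ha hm), mul_zero,
            add_zero, map_zero, map_zero, add_zero]
        rw [map_sub, map_sub, map_sub, sub_eq_zero] at h1
        exact h1.symm
      | succ n ih =>
        rw [← del_X (i, n), rho_del, bracketAt_del_right, bracketAt_del_right,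
          map_shift _ (D.rho_del u), map_shift _ (D.rho_del u), ih]
    simp only [map_mul, Derivation.leibniz, smul_eq_mul, map_add, D.rho_rho u hinv ht, hp, hX]

/-- Bracketing with an invariant element on the right preserves the kernel of `ρ`. -/
theorem ReductionDatum.rho_bracket_left {k : DiffPoly ι F} (hk : D.IsInvariant u z s k) (t : F)
    (P : DiffPoly ι F) :
    D.rho u (bracketAt (affineGen u κ z s) t (D.rho u P) k)
      = D.rho u (bracketAt (affineGen u κ z s) t P k) := by
  induction P using MvPolynomial.induction_on generalizing t with
  | C c => rw [rho_C]
  | add p q hp hq => simp only [map_add, bracketAt_add, hp, hq]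
  | mul_X p v hp =>
    have hX : ∀ t, D.rho u (bracketAt (affineGen u κ z s) t (D.rho u (MvPolynomial.X v)) k)
        = D.rho u (bracketAt (affineGen u κ z s) t (MvPolynomial.X v) k) := fun t => by
      obtain ⟨i, n⟩ := v
      induction n with
      | zero =>
        rw [← jet_basis u, rho_jet_zero, bracketAt_add, bracketAt_C, add_zero]
        have h1 := hk _ (D.m_le_n (D.sub_proj_mem (u i))) t
        rw [map_sub, sub_eq_add_neg, bracketAt_add, bracketAt_neg, map_add, map_neg,
          ← sub_eq_add_neg, sub_eq_zero] at h1
        exact h1.symm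
      | succ n ih =>
        rw [← del_X (i, n), rho_del, bracketAt_del_left, bracketAt_del_left, map_neg, map_neg,
          map_smul, map_smul, ih]
    have hpoly : ∀ {P Q : DiffPoly ι F}, (∀ t, D.rho u (bracketAt (affineGen u κ z s) t P k)
          = D.rho u (bracketAt (affineGen u κ z s) t Q k)) →
        (masterBracket (affineGen u κ z s) P k).map (D.rho u : DiffPoly ι F →+* DiffPoly ι F)
          = (masterBracket (affineGen u κ z s) Q k).map _ := fun hPQ =>
      ext_scalarEval (F := F) fun t => by
        rw [scalarEval_map, scalarEval_map]
        exact hPQ t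
    simp only [map_mul, bracketAt_mul_left, map_add, map_substAt _ (D.rho_del u),
      D.rho_rho u hinv ht, hpoly hp, hpoly hX]

include hsymm in
/-- Bracketing with an invariant element on the left preserves the kernel of `ρ`. -/
theorem ReductionDatum.rho_bracket_right {g : DiffPoly ι F} (hg : D.IsInvariant u z s g) (t : F)
    (P : DiffPoly ι F) :
    D.rho u (bracketAt (affineGen u κ z s) t g (D.rho u P))
      = D.rho u (bracketAt (affineGen u κ z s) t g P) := by
  have h1 : (masterBracket (affineGen u κ z s) (D.rho u P) g).map
        (D.rho u : DiffPoly ι F →+* DiffPoly ι F)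
      = (masterBracket (affineGen u κ z s) P g).map (D.rho u : DiffPoly ι F →+* DiffPoly ι F) :=
    ext_scalarEval (F := F) fun t => by
      rw [scalarEval_map, scalarEval_map]
      exact D.rho_bracket_left u hinv ht z s hg t P
  rw [affine_skew u κ z s hsymm, affine_skew u κ z s hsymm, map_neg, map_neg,
    map_adjAt _ (D.rho_del u), map_adjAt _ (D.rho_del u), h1]

include hsymm in
theorem ReductionDatum.IsInvariant.bracket
    (hs : ∀ a ∈ gradeGE F h 1, ∀ b : 𝔤, z * κ s ⁅a, b⁆ = 0) {g k : DiffPoly ι F}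
    (hg : D.IsInvariant u z s g) (hk : D.IsInvariant u z s k) (r : F) :
    D.IsInvariant u z s (D.rho u (bracketAt (affineGen u κ z s) r g k)) := by
  intro a ha t
  rw [D.rho_bracket_n u hinv ht z s hs ha, affine_jacobi u κ z s hsymm hinv t r, map_add,
    ← D.rho_bracket_left u hinv ht z s hk, hg a ha,
    ← D.rho_bracket_right u hsymm hinv ht z s hg, hk a ha, map_zero, map_zero, add_zero,
    bracketAt_zero, map_zero]

end Rho

end

/-! ### The Poisson vertex algebra structure of the W-algebra -/

section

open Polynomial

section Subalgebra

variable {F A : Type*} [Field F] [Infinite F] [CommRing A] [Algebra F A]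

omit [Infinite F] in
theorem exists_polynomial_map_val (W : Subalgebra F A) {P : A[X]}
    (hP : ∀ n, P.coeff n ∈ W) : ∃ Q : W[X], Q.map (W.val : W →+* A) = P := by
  refine ⟨∑ n ∈ Finset.range (P.natDegree + 1), monomial n ⟨P.coeff n, hP n⟩, ?_⟩
  rw [Polynomial.map_sum]
  simp only [map_monomial]
  exact (P.as_sum_range).symm

/-- A Poisson vertex algebra structure on a subalgebra `W`, from a λ-bracket on the whole algebra
which satisfies the axioms on `W`. The axioms are expressed at scalar values of `λ` and `μ`. -/
theorem exists_pvaStructure (W : Subalgebra F A) (d : Derivation F A A) (b : A →ₗ[F] A →ₗ[F] A[X])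
    (hd : ∀ g ∈ W, d g ∈ W) (hmem : ∀ g ∈ W, ∀ k ∈ W, ∀ t : F, scalarEval t (b g k) ∈ W)
    (sesqui_left : ∀ g ∈ W, ∀ k ∈ W, ∀ t : F,
      scalarEval t (b (d g) k) = -(t • scalarEval t (b g k)))
    (sesqui_right : ∀ g ∈ W, ∀ k ∈ W, ∀ t : F,
      scalarEval t (b g (d k)) = shift d t (scalarEval t (b g k)))
    (leibniz_left : ∀ f ∈ W, ∀ g ∈ W, ∀ h ∈ W, ∀ t : F,
      scalarEval t (b f (g * h)) = scalarEval t (b f g) * h + scalarEval t (b f h) * g)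
    (leibniz_right : ∀ f ∈ W, ∀ h ∈ W, ∀ g ∈ W, ∀ t : F,
      scalarEval t (b (f * h) g) = substAt d t h (b f g) + substAt d t f (b h g))
    (skew : ∀ f ∈ W, ∀ g ∈ W, ∀ t : F, scalarEval t (b g f) = -adjAt d t (b f g))
    (jacobi : ∀ f ∈ W, ∀ g ∈ W, ∀ h ∈ W, ∀ t r : F,
      scalarEval t (b f (scalarEval r (b g h))) = scalarEval (t + r) (b (scalarEval t (b f g)) h)
        + scalarEval r (b g (scalarEval t (b f h)))) :
    ∃ S : PVAStructure F W, (∀ g : W, (S.der g : A) = d g) ∧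
      ∀ g k : W, (S.br g k).map (W.val : W →+* A) = b g k := by
  have hinj : Function.Injective (Polynomial.map (W.val : W →+* A)) :=
    Polynomial.map_injective _ Subtype.val_injective
  have hlift : ∀ g k : W, ∃ Q : W[X], Q.map (W.val : W →+* A) = b g k := fun g k =>
    exists_polynomial_map_val W fun n =>
      coeff_mem_of_eval_mem (Subalgebra.toSubmodule W) _ (fun t => hmem g g.2 k k.2 t) n
  choose br₀ hbr₀ using hlift
  have hmap : ∀ (c : F) (Q : W[X]), (c • Q).map (W.val : W →+* A)
      = c • Q.map (W.val : W →+* A) := fun c Q => map_smul (mapAlgHom W.val) c Q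
  obtain ⟨br, hbr⟩ : ∃ br : W →ₗ[F] W →ₗ[F] W[X],
      ∀ g k, (br g k).map (W.val : W →+* A) = b g k :=
    ⟨LinearMap.mk₂ F br₀ (fun g g' k => hinj (by simp [hbr₀]))
      (fun c g k => hinj (by simp [hbr₀, hmap])) (fun g k k' => hinj (by simp [hbr₀]))
      (fun c g k => hinj (by simp [hbr₀, hmap])), hbr₀⟩
  let dW : Derivation F W W := Derivation.mk'
    ((d : A →ₗ[F] A).restrict (p := Subalgebra.toSubmodule W) (q := Subalgebra.toSubmodule W) hd)
    fun g k => Subtype.ext (d.leibniz (g : A) (k : A))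
  have hdW : ∀ g : W, W.val (dW g) = d (W.val g) := fun g => rfl
  have hE : ∀ (t : F) (g k : W), W.val (scalarEval t (br g k)) = scalarEval t (b g k) :=
    fun t g k => by rw [← scalarEval_map, hbr]
  have hinj' : ∀ {x y : W}, W.val x = W.val y → x = y := fun h => Subtype.ext h
  refine ⟨⟨dW, br, fun f g => ?_, fun f g => ?_, fun f g h => ?_, fun f h g => ?_, fun f g => ?_,
    fun f g h => ?_⟩, hdW, hbr⟩
  · refine ext_scalarEval (F := F) fun t => hinj' ?_
    rw [map_neg, map_neg, scalarEval_X_mul, map_smul, hE, hE]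
    exact sesqui_left f f.2 g g.2 t
  · refine ext_scalarEval (F := F) fun t => hinj' ?_
    rw [scalarEval_lamD, map_shift W.val hdW, hE, hE]
    exact sesqui_right f f.2 g g.2 t
  · refine ext_scalarEval (F := F) fun t => hinj' ?_
    rw [map_add (scalarEval t), map_add W.val, scalarEval_mul, scalarEval_mul, scalarEval_C,
      scalarEval_C, map_mul W.val, map_mul W.val, hE, hE, hE]
    exact leibniz_left f f.2 g g.2 h h.2 t
  · refine ext_scalarEval (F := F) fun t => hinj' ?_
    rw [map_add, map_add, scalarEval_substLamD, scalarEval_substLamD, scalarEval_C, scalarEval_C,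
      map_substAt W.val hdW, map_substAt W.val hdW, hbr, hbr, hE]
    exact leibniz_right f f.2 h h.2 g g.2 t
  · refine ext_scalarEval (F := F) fun t => hinj' ?_
    rw [map_neg, map_neg, scalarEval_substNegLamD, map_adjAt W.val hdW, hbr, hE]
    exact skew f f.2 g g.2 t
  · refine ext_scalarEval₂ (F := F) fun t r => hinj' ?_
    have hmid := scalarEval_jacobi_middle (br.flip h) t r (br f g)
    simp only [LinearMap.flip_apply] at hmid
    rw [eval_add, map_add (scalarEval t), scalarEval_jacobi_left (br f), hmid,
      scalarEval_jacobi_right (br g)]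
    have h1 := jacobi f f.2 g g.2 h h.2 t r
    rw [← hE, ← hE, ← hE] at h1
    exact (hE t f _).trans (h1.trans ((congrArg₂ (· + ·) (hE _ _ h) (hE r g _)).symm.trans
      (map_add W.val _ _).symm))

end Subalgebra

section WStructure

variable {F 𝔤 ι : Type*} [Field F] [CharZero F] [LieRing 𝔤] [LieAlgebra F 𝔤]
  {κ : LinearMap.BilinForm F 𝔤} {h e f : 𝔤} (D : ReductionDatum κ h f) (u : Module.Basis ι F 𝔤)
  (hsymm : κ.IsSymm) (hinv : κ.lieInvariant 𝔤) (ht : IsSl2Triple h e f) (z : F) (s : 𝔤)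
  (hs : ∀ a ∈ gradeGE F h 1, ∀ b : 𝔤, z * κ s ⁅a, b⁆ = 0)

include hsymm hinv ht hs

/-- The classical W-algebra is a Poisson vertex algebra. -/
theorem ReductionDatum.exists_isWStructure :
    ∃ S : PVAStructure F (D.W u z s), D.IsWStructure u z s S := by
  let b : DiffPoly ι F →ₗ[F] DiffPoly ι F →ₗ[F] (DiffPoly ι F)[X] :=
    (masterLin (affineGen u κ z s)).compr₂ (mapAlgHom (D.rho u)).toLinearMap
  have hb : ∀ g k, b g k = (masterBracket (affineGen u κ z s) g k).map
    (D.rho u : DiffPoly ι F →+* DiffPoly ι F) := fun g k => rfl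
  have hbt : ∀ (t : F) g k, scalarEval t (b g k)
      = D.rho u (bracketAt (affineGen u κ z s) t g k) := fun t g k => by
    rw [hb, scalarEval_map, bracketAt_apply]
  have hρ : ∀ g ∈ D.W u z s, D.rho u g = g := fun g hg =>
    D.rho_of_mem_Vp u hinv ht ((D.mem_W_iff u z s).1 hg).1
  have hI : ∀ g ∈ D.W u z s, D.IsInvariant u z s g := fun g hg => ((D.mem_W_iff u z s).1 hg).2
  refine exists_pvaStructure (D.W u z s) (del ι F) b (fun g hg => ?_) (fun g hg k hk t => ?_)
    (fun g hg k hk t => ?_) (fun g hg k hk t => ?_) (fun f hf g hg h hh t => ?_)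
    (fun f hf h hh g hg t => ?_) (fun f hf g hg t => ?_) (fun f hf g hg h hh t r => ?_)
  · rw [D.mem_W_iff] at hg ⊢
    refine ⟨D.del_mem_Vp u hg.1, fun a ha t => ?_⟩
    rw [bracketAt_del_right, map_shift _ (D.rho_del u), hg.2 a ha, map_zero]
  · rw [hbt, D.mem_W_iff]
    exact ⟨D.rho_mem_Vp u _, (hI g hg).bracket D u hsymm hinv ht z s hs (hI k hk) t⟩
  · rw [hbt, hbt, bracketAt_del_left, map_neg, map_smul]
  · rw [hbt, hbt, bracketAt_del_right, map_shift _ (D.rho_del u)]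
  · rw [hbt, hbt, hbt, Derivation.leibniz, map_add, smul_eq_mul, smul_eq_mul, map_mul, map_mul,
      hρ g hg, hρ h hh]
    ring
  · rw [hbt, bracketAt_mul_left, map_add, map_substAt _ (D.rho_del u),
      map_substAt _ (D.rho_del u), hρ f hf, hρ h hh]
    rfl
  · rw [hbt, affine_skew u κ z s hsymm, map_neg, map_adjAt _ (D.rho_del u)]
    rfl
  · simp only [hbt]
    rw [D.rho_bracket_right u hsymm hinv ht z s (hI f hf),
      D.rho_bracket_left u hinv ht z s (hI h hh),
      D.rho_bracket_right u hsymm hinv ht z s (hI g hg),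
      affine_jacobi u κ z s hsymm hinv t r, map_add]

end WStructure

end

/-! ### Invariants of systems of derivations with a gauge fixing -/

section GaugeFixing

open MvPolynomial

variable {F σ : Type*} [Field F]

/-- The span of the monomials whose weight is at least `n`. -/
noncomputable abbrev weightGE (F : Type*) [Field F] {σ : Type*} (Γ : σ → ℕ) (n : ℕ) :
    Submodule F (MvPolynomial σ F) :=
  restrictSupport F {m | n ≤ Finsupp.weight Γ m}

/-- The span of the monomials of weight at most `n - k`; this is zero when `n < k`. -/
noncomputable abbrev weightLE (F : Type*) [Field F] {σ : Type*} (Δ : σ → ℕ) (n k : ℕ) :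
    Submodule F (MvPolynomial σ F) :=
  restrictSupport F {m | Finsupp.weight Δ m + k ≤ n}

theorem mem_restrictSupport_iff_coeff {s : Set (σ →₀ ℕ)} {P : MvPolynomial σ F} :
    P ∈ restrictSupport F s ↔ ∀ m, coeff m P ≠ 0 → m ∈ s := by
  rw [mem_restrictSupport_iff]
  exact ⟨fun h m hm => h (by simpa using hm), fun h m hm => h m (by simpa using hm)⟩

theorem mul_mem_restrictSupport {s t r : Set (σ →₀ ℕ)} {P Q : MvPolynomial σ F}
    (hP : P ∈ restrictSupport F s) (hQ : Q ∈ restrictSupport F t)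
    (hst : ∀ a ∈ s, ∀ b ∈ t, a + b ∈ r) : P * Q ∈ restrictSupport F r := by
  classical
  rw [mem_restrictSupport_iff] at *
  intro m hm
  obtain ⟨a, ha, b, hb, rfl⟩ := Finset.mem_add.1 (support_mul P Q hm)
  exact hst a (hP ha) b (hQ hb)

theorem mem_weightGE_zero (Γ : σ → ℕ) (P : MvPolynomial σ F) : P ∈ weightGE F Γ 0 :=
  mem_restrictSupport_iff_coeff.2 fun _ _ => Nat.zero_le _

theorem weightGE_mono (Γ : σ → ℕ) {n k : ℕ} (hnk : n ≤ k) : weightGE F Γ k ≤ weightGE F Γ n :=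
  restrictSupport_mono _ fun _ hm => hnk.trans hm

/-- To map the span of a set of monomials into a subspace it suffices to do so for each monomial. -/
theorem restrictSupport_le_of_monomial {s : Set (σ →₀ ℕ)} {M : Submodule F (MvPolynomial σ F)}
    {L : MvPolynomial σ F →ₗ[F] MvPolynomial σ F} (h : ∀ m ∈ s, L (monomial m 1) ∈ M)
    {P : MvPolynomial σ F} (hP : P ∈ restrictSupport F s) : L P ∈ M := by
  have h1 : restrictSupport F s ≤ M.comap L := by
    rw [restrictSupport_eq_span, Submodule.span_le]
    rintro _ ⟨m, hm, rfl⟩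
    exact h m hm
  exact h1 hP

/-- A derivation maps a monomial to a combination of monomials as prescribed by its values on the
variables. -/
theorem derivation_monomial_mem {D : Derivation F (MvPolynomial σ F) (MvPolynomial σ F)}
    {m : σ →₀ ℕ} {t : Set (σ →₀ ℕ)} {r : σ → Set (σ →₀ ℕ)}
    (hD : ∀ v, D (X v) ∈ restrictSupport F (r v))
    (ht : ∀ v, m v ≠ 0 → ∀ a ∈ r v, m - Finsupp.single v 1 + a ∈ t) :
    D (monomial m 1) ∈ restrictSupport F t := by
  have h1 : D = mkDerivation F fun v => D (X v) := derivation_ext fun v => by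
    rw [mkDerivation_X]
  rw [h1, mkDerivation_monomial, one_smul]
  refine Submodule.sum_mem _ fun v hv => ?_
  refine mul_mem_restrictSupport (s := {m - Finsupp.single v 1}) ?_ (hD v) ?_
  · exact (monomial_mem_restrictSupport F).2 (Or.inl rfl)
  · rintro _ rfl a ha
    exact ht v (by simpa using hv) a ha

theorem weight_sub_single_add (w : σ → ℕ) {m : σ →₀ ℕ} {v : σ} (hv : m v ≠ 0) :
    Finsupp.weight w (m - Finsupp.single v 1) + w v = Finsupp.weight w m := by
  have h1 : m - Finsupp.single v 1 + Finsupp.single v 1 = m :=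
    tsub_add_cancel_of_le (by simpa [Nat.one_le_iff_ne_zero] using hv)
  conv_rhs => rw [← h1]
  rw [map_add, Finsupp.weight_single, one_smul]

variable [CharZero F] (Γ Δ : σ → ℕ) (Y : Set σ)
  (D : σ → Derivation F (MvPolynomial σ F) (MvPolynomial σ F))

/-- Derivations `D_y`, `y ∈ Y`, which to leading order with respect to the weight `Γ` are the
partial derivatives `∂/∂y`, which lower the weight `Δ`, and whose commutators are of higher order
as long as they are combinations of the `D_y`. The commutator condition is stated in terms of
the elements on which all `D_y` take values of high order. -/
structure IsGaugeSystem : Prop where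
  weight_le : ∀ v, Γ v ≤ Δ v
  finite : ∀ w, {y | y ∈ Y ∧ Δ y ≤ w}.Finite
  sub_pderiv : ∀ y ∈ Y, ∀ v, D y (X v) - pderiv y (X v) ∈ weightGE F Γ (Γ v + 1 - Γ y)
  lower : ∀ y ∈ Y, ∀ v, D y (X v) ∈ weightLE F Δ (Δ v) (Δ y)
  commutator : ∀ y ∈ Y, ∀ y' ∈ Y, ∀ (g : MvPolynomial σ F) (n : ℕ),
    (∀ y ∈ Y, D y g ∈ weightGE F Γ (n - Γ y)) →
      D y (D y' g) - D y' (D y g) ∈ weightGE F Γ (n + 1 - Γ y - Γ y')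

variable {Γ Δ Y D} (hD : IsGaugeSystem Γ Δ Y D)
include hD

omit [CharZero F] in
theorem IsGaugeSystem.sub_pderiv_mem {y : σ} (hy : y ∈ Y) {P : MvPolynomial σ F} {n : ℕ}
    (hP : P ∈ weightGE F Γ n) : D y P - pderiv y P ∈ weightGE F Γ (n + 1 - Γ y) := by
  refine restrictSupport_le_of_monomial
    (L := ((D y - pderiv y : Derivation F _ _) : MvPolynomial σ F →ₗ[F] MvPolynomial σ F))
    (fun m hm => ?_) hP
  refine derivation_monomial_mem (D := D y - pderiv y)
    (fun v => by simpa only [Derivation.sub_apply] using hD.sub_pderiv y hy v) fun v hv a ha => ?_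
  have h1 := weight_sub_single_add Γ hv
  simp only [Set.mem_ofPred_eq, map_add] at hm ha ⊢
  omega

omit [CharZero F] in
theorem IsGaugeSystem.lower_mem {y : σ} (hy : y ∈ Y) {P : MvPolynomial σ F} {n : ℕ}
    (hP : P ∈ weightLE F Δ n 0) : D y P ∈ weightLE F Δ n (Δ y) := by
  refine restrictSupport_le_of_monomial
    (L := (D y : MvPolynomial σ F →ₗ[F] MvPolynomial σ F)) (fun m hm => ?_) hP
  refine derivation_monomial_mem (fun v => hD.lower y hy v) fun v hv a ha => ?_
  have h1 := weight_sub_single_add Δ hv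
  simp only [Set.mem_ofPred_eq, map_add] at hm ha ⊢
  omega

/-- An invariant all of whose monomials involve a gauge variable vanishes: the leading term is
killed by all `∂/∂y`. -/
theorem IsGaugeSystem.eq_zero {g : MvPolynomial σ F}
    (hg : g ∈ restrictSupport F {m | ∃ y ∈ Y, m y ≠ 0}) (hDg : ∀ y ∈ Y, D y g = 0) : g = 0 := by
  have h1 : ∀ n, g ∈ weightGE F Γ n := fun n => by
    induction n with
    | zero => exact mem_weightGE_zero Γ g
    | succ n ih =>
      refine mem_restrictSupport_iff_coeff.2 fun m hm => ?_
      have h2 : n ≤ Finsupp.weight Γ m := mem_restrictSupport_iff_coeff.1 ih m hm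
      obtain ⟨y, hy, hmy⟩ := mem_restrictSupport_iff_coeff.1 hg m hm
      have h3 := hD.sub_pderiv_mem hy ih
      rw [hDg y hy, zero_sub, neg_mem_iff] at h3
      have h4 : m - Finsupp.single y 1 + Finsupp.single y 1 = m :=
        tsub_add_cancel_of_le (by simpa [Nat.one_le_iff_ne_zero] using hmy)
      have h5 := mem_restrictSupport_iff_coeff.1 h3 (m - Finsupp.single y 1) (by
        rw [coeff_pderiv, h4]
        exact mul_ne_zero hm (Nat.cast_add_one_ne_zero _))
      have h6 := weight_sub_single_add Γ hmy
      simp only [Set.mem_ofPred_eq] at h5 ⊢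
      omega
  by_contra hg0
  obtain ⟨m, hm⟩ := ne_zero_iff.1 hg0
  have h2 := mem_restrictSupport_iff_coeff.1 (h1 (Finsupp.weight Γ m + 1)) m hm
  simp only [Set.mem_ofPred_eq] at h2
  omega

omit [CharZero F] in
/-- To leading order, the values `D_y g` form a closed one-form. -/
theorem IsGaugeSystem.coeff_symm {g : MvPolynomial σ F} {n : ℕ}
    (hg : ∀ y ∈ Y, D y g ∈ weightGE F Γ (n - Γ y)) {y y' : σ} (hy : y ∈ Y) (hy' : y' ∈ Y)
    {m : σ →₀ ℕ} (hm : Finsupp.weight Γ m = n) (hmy : m y ≠ 0) (hmy' : m y' ≠ 0) :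
    coeff (m - Finsupp.single y 1) (D y g) * m y'
      = coeff (m - Finsupp.single y' 1) (D y' g) * m y := by
  classical
  by_cases hne : y = y'
  · rw [hne]
  have h1 := hD.commutator y hy y' hy' g n hg
  have h2 := hD.sub_pderiv_mem hy (hg y' hy')
  have h3 := hD.sub_pderiv_mem hy' (hg y hy)
  have h4 : pderiv y (D y' g) - pderiv y' (D y g) ∈ weightGE F Γ (n + 1 - Γ y - Γ y') := by
    have h5 := Submodule.add_mem _ (Submodule.sub_mem _ h1 (weightGE_mono Γ (by omega) h2))
      (weightGE_mono Γ (by omega) h3)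
    convert h5 using 1
    ring
  obtain ⟨m₀, rfl⟩ : ∃ m₀, m = m₀ + Finsupp.single y 1 + Finsupp.single y' 1 := by
    refine ⟨m - Finsupp.single y 1 - Finsupp.single y' 1, ?_⟩
    ext v
    have hne' : y' ≠ y := fun h => hne h.symm
    simp only [Finsupp.add_apply, Finsupp.tsub_apply, Finsupp.single_apply]
    split_ifs with ha hb hb <;> grind
  have h5 : coeff m₀ (pderiv y (D y' g) - pderiv y' (D y g)) = 0 := by
    by_contra h6
    have h7 := mem_restrictSupport_iff_coeff.1 h4 m₀ h6
    simp only [Set.mem_ofPred_eq, map_add, Finsupp.weight_single, one_smul] at h7 hm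
    omega
  have h6 : m₀ + Finsupp.single y 1 + Finsupp.single y' 1 - Finsupp.single y 1
      = m₀ + Finsupp.single y' 1 := by
    rw [add_right_comm, add_tsub_cancel_right]
  rw [coeff_sub, coeff_pderiv, coeff_pderiv, sub_eq_zero] at h5
  rw [h6, add_tsub_cancel_right]
  have hne' : y' ≠ y := fun h => hne h.symm
  simp only [Finsupp.add_apply, Finsupp.single_apply, if_neg hne, if_neg hne', if_true, add_zero,
    Nat.cast_add, Nat.cast_one]
  exact h5.symm

/-- An approximately invariant element can be corrected to be invariant to one order more. The
correction is a primitive of the leading term of `-D_y g`, given by the Poincaré lemma. -/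
theorem IsGaugeSystem.exists_correction {g : MvPolynomial σ F} {n w : ℕ}
    (hgw : g ∈ weightLE F Δ w 0) (hg : ∀ y ∈ Y, D y g ∈ weightGE F Γ (n - Γ y)) :
    ∃ c ∈ weightLE F Δ w 0, c ∈ restrictSupport F {m | ∃ y ∈ Y, m y ≠ 0} ∧
      ∀ y ∈ Y, D y (g + c) ∈ weightGE F Γ (n + 1 - Γ y) := by
  classical
  have hsub : ∀ {m : σ →₀ ℕ} {y : σ}, m y ≠ 0 →
      m - Finsupp.single y 1 + Finsupp.single y 1 = m := fun hm =>
    tsub_add_cancel_of_le (by simpa [Nat.one_le_iff_ne_zero] using hm)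
  -- the coefficient of the correction at `m`; it does not depend on the variable `y` chosen
  let p : (σ →₀ ℕ) → Prop := fun m => Finsupp.weight Γ m = n ∧ ∃ y ∈ Y, m y ≠ 0
  let val : (σ →₀ ℕ) → F := fun m => if hm : p m then
    -(coeff (m - Finsupp.single hm.2.choose 1) (D hm.2.choose g)) / m hm.2.choose else 0
  have hval : ∀ m y, y ∈ Y → m y ≠ 0 → Finsupp.weight Γ m = n →
      val m * m y = -coeff (m - Finsupp.single y 1) (D y g) := fun m y hy hmy hm => by
    have hp : p m := ⟨hm, y, hy, hmy⟩
    have h1 := hp.2.choose_spec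
    have h2 := hD.coeff_symm hg h1.1 hy hm h1.2 hmy
    have h3 : (m hp.2.choose : F) ≠ 0 := by exact_mod_cast h1.2
    simp only [val, dif_pos hp]
    rw [div_mul_eq_mul_div, div_eq_iff h3, neg_mul, neg_mul, h2]
  have hval0 : ∀ m, val m ≠ 0 → p m ∧ ∃ y ∈ Y, m y ≠ 0 ∧
      coeff (m - Finsupp.single y 1) (D y g) ≠ 0 := fun m hm => by
    by_cases hp : p m
    · refine ⟨hp, hp.2.choose, hp.2.choose_spec.1, hp.2.choose_spec.2, fun h0 => hm ?_⟩
      simp only [val, dif_pos hp, h0, neg_zero, zero_div]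
    · exact absurd (dif_neg hp) hm
  have hvalΔ : ∀ m, val m ≠ 0 → Finsupp.weight Δ m ≤ w := fun m hm => by
    obtain ⟨-, y, hy, hmy, h1⟩ := hval0 m hm
    have h2 := mem_restrictSupport_iff_coeff.1 (hD.lower_mem hy hgw) _ h1
    have h3 := weight_sub_single_add Δ hmy
    simp only [Set.mem_ofPred_eq] at h2
    omega
  let M : Finset (σ →₀ ℕ) := (hD.finite w).toFinset.biUnion fun y =>
    (D y g).support.image (· + Finsupp.single y 1)
  have hM : ∀ m, val m ≠ 0 → m ∈ M := fun m hm => by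
    obtain ⟨-, y, hy, hmy, h1⟩ := hval0 m hm
    have h2 := hvalΔ m hm
    have h3 := weight_sub_single_add Δ hmy
    simp only [M, Finset.mem_biUnion, Set.Finite.mem_toFinset, Set.mem_ofPred_eq, Finset.mem_image]
    exact ⟨y, ⟨hy, by omega⟩, _, mem_support_iff.2 h1, hsub hmy⟩
  let c : MvPolynomial σ F := ∑ m ∈ M, monomial m (val m)
  have hc : ∀ m, coeff m c = val m := fun m => by
    simp only [c, coeff_sum, coeff_monomial, Finset.sum_ite_eq']
    split_ifs with h
    · rfl
    · by_contra h1
      exact h (hM m fun h2 => h1 h2.symm)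
  have hcn : c ∈ weightGE F Γ n := mem_restrictSupport_iff_coeff.2 fun m hm => by
    rw [hc] at hm
    exact (hval0 m hm).1.1.ge
  refine ⟨c, mem_restrictSupport_iff_coeff.2 fun m hm => ?_,
    mem_restrictSupport_iff_coeff.2 fun m hm => ?_, fun y hy => ?_⟩
  · rw [hc] at hm
    exact hvalΔ m hm
  · rw [hc] at hm
    exact (hval0 m hm).1.2
  · have h1 := hD.sub_pderiv_mem hy hcn
    have h2 : D y g + pderiv y c ∈ weightGE F Γ (n + 1 - Γ y) :=
      mem_restrictSupport_iff_coeff.2 fun m hm => by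
        by_contra hlt
        simp only [Set.mem_ofPred_eq] at hlt
        have hw : Finsupp.weight Γ (m + Finsupp.single y 1) = Finsupp.weight Γ m + Γ y := by
          rw [map_add, Finsupp.weight_single, one_smul]
        have hmy : (m + Finsupp.single y 1 : σ →₀ ℕ) y = m y + 1 := by simp
        have h3 : coeff m (pderiv y c) = val (m + Finsupp.single y 1) * (m y + 1) := by
          rw [coeff_pderiv, hc]
        rw [coeff_add, h3] at hm
        by_cases hn : Finsupp.weight Γ m + Γ y = n
        · have h4 := hval (m + Finsupp.single y 1) y hy (by omega) (hw.trans hn)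
          rw [hmy, Nat.cast_add, Nat.cast_one, add_tsub_cancel_right] at h4
          rw [h4, add_neg_cancel] at hm
          exact hm rfl
        · have h4 : val (m + Finsupp.single y 1) = 0 := by
            by_contra h5
            exact hn (hw.symm.trans (hval0 _ h5).1.1)
          rw [h4, zero_mul, add_zero] at hm
          have h5 := mem_restrictSupport_iff_coeff.1 (hg y hy) m hm
          simp only [Set.mem_ofPred_eq] at h5
          omega
    have h3 := Submodule.add_mem _ h1 h2
    convert h3 using 1
    rw [map_add]
    ring

/-- Every polynomial is congruent to an invariant modulo the monomials which involve a gauge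
variable. -/
theorem IsGaugeSystem.exists_invariant (P : MvPolynomial σ F) :
    ∃ g, g - P ∈ restrictSupport F {m | ∃ y ∈ Y, m y ≠ 0} ∧ ∀ y ∈ Y, D y g = 0 := by
  obtain ⟨w, hw⟩ : ∃ w, P ∈ weightLE F Δ w 0 :=
    ⟨P.support.sup (Finsupp.weight Δ), mem_restrictSupport_iff_coeff.2 fun m hm =>
      Finset.le_sup (f := Finsupp.weight Δ) (mem_support_iff.2 hm)⟩
  have h1 : ∀ n, ∃ g ∈ weightLE F Δ w 0, g - P ∈ restrictSupport F {m | ∃ y ∈ Y, m y ≠ 0} ∧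
      ∀ y ∈ Y, D y g ∈ weightGE F Γ (n - Γ y) := fun n => by
    induction n with
    | zero => exact ⟨P, hw, by simp, fun y _ => by simpa using mem_weightGE_zero Γ _⟩
    | succ n ih =>
      obtain ⟨g, hgw, hgP, hg⟩ := ih
      obtain ⟨c, hcw, hc, hgc⟩ := hD.exists_correction hgw hg
      refine ⟨g + c, Submodule.add_mem _ hgw hcw, ?_, hgc⟩
      rw [add_sub_right_comm]
      exact Submodule.add_mem _ hgP hc
  -- since `Γ ≤ Δ`, an error of high order vanishes
  obtain ⟨g, hgw, hgP, hg⟩ := h1 (w + 1)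
  refine ⟨g, hgP, fun y hy => ?_⟩
  by_contra h2
  obtain ⟨m, hm⟩ := ne_zero_iff.1 h2
  have h3 := mem_restrictSupport_iff_coeff.1 (hg y hy) m hm
  have h4 := mem_restrictSupport_iff_coeff.1 (hD.lower_mem hy hgw) m hm
  have h5 : Finsupp.weight Γ m ≤ Finsupp.weight Δ m := by
    rw [Finsupp.weight_apply, Finsupp.weight_apply]
    exact Finset.sum_le_sum fun v _ => Nat.mul_le_mul_left _ (hD.weight_le v)
  have h6 := hD.weight_le y
  simp only [Set.mem_ofPred_eq] at h3 h4
  omega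

end GaugeFixing

/-! ### Differential functions on `f + 𝔪^⊥` -/

section JetHom

variable {F 𝔤 ι K : Type*} [Field F] [LieRing 𝔤] [LieAlgebra F 𝔤] (u : Module.Basis ι F 𝔤)
  (L : 𝔤 →ₗ[F] DiffPoly K F)

/-- The homomorphism of differential algebras `𝒱(𝔤) → DiffPoly K F` extending a linear map on
`𝔤`. -/
noncomputable def jetHom : DiffPoly ι F →ₐ[F] DiffPoly K F :=
  MvPolynomial.aeval fun v => (del K F)^[v.2] (L (u v.1))

theorem jetHom_X (v : ι × ℕ) : jetHom u L (MvPolynomial.X v) = (del K F)^[v.2] (L (u v.1)) :=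
  MvPolynomial.aeval_X _ _

theorem jetHom_del (P : DiffPoly ι F) : jetHom u L (del ι F P) = del K F (jetHom u L P) :=
  algHom_del (jetHom u L) (fun i n => by
    rw [jetHom_X, jetHom_X, Function.iterate_succ_apply']) P

theorem jetHom_jet_zero (a : 𝔤) : jetHom u L (jet u 0 a) = L a := by
  have h1 : (jetHom u L).toLinearMap ∘ₗ jet u 0 = L := u.ext fun i => by
    simp [jet_basis, jetHom_X]
  exact congrArg (fun l => l a) h1

/-- Homomorphisms of differential algebras are determined by their values on generators. -/
theorem diffAlgHom_ext {A : Type*} [CommRing A] [Algebra F A] {d : Derivation F A A}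
    {φ ψ : DiffPoly K F →ₐ[F] A} (hφ : ∀ P, φ (del K F P) = d (φ P))
    (hψ : ∀ P, ψ (del K F P) = d (ψ P))
    (h : ∀ i, φ (MvPolynomial.X (i, 0)) = ψ (MvPolynomial.X (i, 0))) : φ = ψ := by
  refine MvPolynomial.algHom_ext fun v => ?_
  obtain ⟨i, n⟩ := v
  induction n with
  | zero => exact h i
  | succ n ih => rw [← del_X (i, n), hφ, hψ, ih]

end JetHom

section Coordinates

open MvPolynomial

variable {F 𝔤 ι I J : Type*} [Field F] [LieRing 𝔤] [LieAlgebra F 𝔤]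
  {κ : LinearMap.BilinForm F 𝔤} {h e f : 𝔤} {S : Slice F h f J} {D : ReductionDatum κ h f}

/-- An element of `𝔤`, as a function on the affine space `f + span cⱼ`. -/
noncomputable def Slice.coordLin [Fintype J] (S : Slice F h f J) (κ : LinearMap.BilinForm F 𝔤) :
    𝔤 →ₗ[F] DiffPoly J F :=
  Algebra.linearMap F _ ∘ₗ κ f + ∑ j, (κ (S.c j)).smulRight (X (j, 0))

theorem Slice.coordLin_apply [Fintype J] (b : 𝔤) :
    S.coordLin κ b = C (κ f b) + ∑ j, κ (S.c j) b • X (j, 0) := by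
  simp [coordLin, algebraMap_eq]

/-- Restriction of differential polynomials on `𝔤` to the slice `f + span cⱼ`. -/
noncomputable def Slice.restrict [Fintype J] (S : Slice F h f J) (κ : LinearMap.BilinForm F 𝔤)
    (u : Module.Basis ι F 𝔤) : DiffPoly ι F →ₐ[F] DiffPoly J F :=
  jetHom u (S.coordLin κ)

namespace GaugeFrame

variable (G : GaugeFrame S D I)

/-- The basis `[f, aᵢ], cⱼ` of `𝔪^⊥`. -/
def w : I ⊕ J → 𝔤 := Sum.elim (fun i => ⁅f, G.a i⁆) S.c

/-- The degrees of the basis of `𝔪^⊥`. -/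
def degW : I ⊕ J → ℤ := Sum.elim (fun i => G.degA i - 2) S.deg

theorem a_mem_n (i : I) : G.a i ∈ D.n := G.span_a ▸ Submodule.subset_span ⟨i, rfl⟩

theorem w_mem (ht : IsSl2Triple h e f) (v : I ⊕ J) : G.w v ∈ grade F h (G.degW v) := by
  obtain i | j := v
  · have := lie_mem_grade (IsSl2Triple.f_mem_grade (F := F) ht) (G.a_mem i)
    rwa [neg_add_eq_sub] at this
  · exact S.mem j

variable [Fintype I] [Fintype J]

/-- An element of `𝔤`, as a function on the affine space `f + 𝔪^⊥`, in the coordinates of the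
frame. -/
noncomputable def coordLin : 𝔤 →ₗ[F] DiffPoly (I ⊕ J) F :=
  Algebra.linearMap F _ ∘ₗ κ f + ∑ v, (κ (G.w v)).smulRight (X (v, 0))

theorem coordLin_apply (b : 𝔤) : G.coordLin b = C (κ f b) + ∑ v, κ (G.w v) b • X (v, 0) := by
  simp [coordLin, algebraMap_eq]

theorem coordLin_b (v : I ⊕ J) : G.coordLin (G.b v) = C (κ f (G.b v)) + X (v, 0) := by
  classical
  rw [coordLin_apply, Finset.sum_eq_single v (fun v' _ hv' => ?_) (by simp)]
  · rw [w, G.dual_self, one_smul]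
  · rw [w, G.dual_ne v' v hv', zero_smul]

variable (u : Module.Basis ι F 𝔤)

/-- Restriction of differential polynomials on `𝔤` to `f + 𝔪^⊥`, in the coordinates of the
frame. -/
noncomputable def coord : DiffPoly ι F →ₐ[F] DiffPoly (I ⊕ J) F := jetHom u G.coordLin

theorem coord_del (P : DiffPoly ι F) : G.coord u (del ι F P) = del (I ⊕ J) F (G.coord u P) :=
  jetHom_del u _ P

theorem coord_jet_zero (a : 𝔤) : G.coord u (jet u 0 a) = G.coordLin a := jetHom_jet_zero u _ a

omit [Fintype I] [Fintype J] in
/-- The coordinates of the frame, as elements of `𝒱(𝔭)`. -/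
noncomputable def lift : DiffPoly (I ⊕ J) F →ₐ[F] DiffPoly ι F :=
  aeval fun v => (del ι F)^[v.2] (jet u 0 (D.proj (G.b v.1)))

omit [Fintype I] [Fintype J] in
theorem lift_X (v : (I ⊕ J) × ℕ) :
    G.lift u (X v) = (del ι F)^[v.2] (jet u 0 (D.proj (G.b v.1))) := aeval_X _ _

omit [Fintype I] [Fintype J] in
theorem lift_del (P : DiffPoly (I ⊕ J) F) : G.lift u (del (I ⊕ J) F P) = del ι F (G.lift u P) :=
  algHom_del (G.lift u) (fun i n => by
    rw [lift_X, lift_X, Function.iterate_succ_apply']) P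

omit [Fintype I] [Fintype J] in
theorem lift_mem_Vp (P : DiffPoly (I ⊕ J) F) : G.lift u P ∈ D.Vp u := by
  induction P using MvPolynomial.induction_on with
  | C a =>
    rw [← algebraMap_eq, AlgHom.commutes]
    exact Subalgebra.algebraMap_mem _ a
  | add p q hp hq =>
    rw [map_add]
    exact add_mem hp hq
  | mul_X p v hp =>
    rw [map_mul, lift_X, del_iterate_jet]
    exact mul_mem hp (D.jet_mem_Vp u (D.proj_mem _) _)

theorem lift_coord (P : DiffPoly ι F) : G.lift u (G.coord u P) = D.rho u P := by
  refine congrArg (fun φ : DiffPoly ι F →ₐ[F] DiffPoly ι F => φ P) (diffAlgHom_ext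
    (φ := (G.lift u).comp (G.coord u)) (d := del ι F) (fun P => ?_) (D.rho_del u) fun i => ?_)
  · rw [AlgHom.comp_apply, coord_del, lift_del]
    rfl
  · have h1 : u i - ∑ v, κ (G.w v) (u i) • G.b v ∈ D.l ⊔ gradeGE F h 2 := by
      classical
      refine (G.mem_m_iff _).2 fun v => ?_
      rw [map_sub, map_sum, Finset.sum_eq_single v (fun v' _ hv' => ?_) (by simp)]
      · rw [map_smul, G.dual_self, smul_eq_mul, mul_one, sub_eq_zero]
        rfl
      · rw [map_smul, G.dual_ne v v' hv'.symm, smul_zero]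
    have h2 := D.proj_of_mem_m h1
    rw [map_sub, sub_eq_zero] at h2
    rw [← jet_basis u, AlgHom.comp_apply, coord_jet_zero, coordLin_apply, D.rho_jet_zero, h2,
      map_add, map_sum, map_sum, map_sum, ← algebraMap_eq, AlgHom.commutes, add_comm]
    congr 1
    refine Finset.sum_congr rfl fun v _ => ?_
    rw [map_smul, map_smul, map_smul, lift_X]
    rfl

variable [CharZero F] (hinv : κ.lieInvariant 𝔤) (ht : IsSl2Triple h e f)
include hinv ht

/-- Functions on `f + 𝔪^⊥` only see the projection to `𝔭`. -/
theorem coordLin_proj (b : 𝔤) : C (κ f b) + G.coordLin (D.proj b) = G.coordLin b := by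
  rw [coordLin_apply, coordLin_apply, D.form_f_p hinv ht (D.proj_mem b), map_zero, zero_add]
  congr 1
  refine Finset.sum_congr rfl fun v _ => ?_
  have h1 := (G.mem_m_iff _).1 (D.sub_proj_mem b) v
  rw [map_sub, sub_eq_zero] at h1
  rw [w, h1]

theorem coord_rho (P : DiffPoly ι F) : G.coord u (D.rho u P) = G.coord u P := by
  refine congrArg (fun φ : DiffPoly ι F →ₐ[F] DiffPoly (I ⊕ J) F => φ P) (diffAlgHom_ext
    (φ := (G.coord u).comp (D.rho u)) (d := del (I ⊕ J) F) (fun P => ?_) (G.coord_del u)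
    fun i => ?_)
  · rw [AlgHom.comp_apply, D.rho_del, coord_del]
    rfl
  · rw [← jet_basis u, AlgHom.comp_apply, D.rho_jet_zero, map_add, coord_jet_zero, coord_jet_zero,
      ← G.coordLin_proj hinv ht (u i), add_comm, ← algebraMap_eq, AlgHom.commutes]
    rfl

theorem coord_lift (P : DiffPoly (I ⊕ J) F) : G.coord u (G.lift u P) = P := by
  refine congrArg (fun φ : DiffPoly (I ⊕ J) F →ₐ[F] DiffPoly (I ⊕ J) F => φ P) (diffAlgHom_ext
    (φ := (G.coord u).comp (G.lift u)) (ψ := AlgHom.id F _) (d := del (I ⊕ J) F) (fun P => ?_)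
    (fun P => rfl) fun v => ?_)
  · rw [AlgHom.comp_apply, lift_del, coord_del]
    rfl
  · have h1 := G.coordLin_proj hinv ht (G.b v)
    rw [coordLin_b] at h1
    rw [AlgHom.comp_apply, lift_X, Function.iterate_zero_apply, coord_jet_zero]
    exact add_left_cancel h1

end GaugeFrame

end Coordinates

/-! ### The derivations of the gauge action -/

section GaugeDerivations

open MvPolynomial

theorem del_mem_restrictSupport {F K : Type*} [Field F] {w : K × ℕ → ℕ} {c : ℕ}
    (hw : ∀ v, w (v.1, v.2 + 1) = w v + c) {r t : Set (K × ℕ →₀ ℕ)}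
    (hrt : ∀ m ∈ r, ∀ m', Finsupp.weight w m' = Finsupp.weight w m + c → m' ∈ t)
    {P : DiffPoly K F} (hP : P ∈ restrictSupport F r) : del K F P ∈ restrictSupport F t := by
  refine restrictSupport_le_of_monomial (L := (del K F : DiffPoly K F →ₗ[F] DiffPoly K F))
    (fun m hm => ?_) hP
  refine derivation_monomial_mem (D := del K F) (r := fun v => {Finsupp.single (v.1, v.2 + 1) 1})
    (fun v => ?_) fun v hv a ha => hrt m hm _ ?_
  · rw [del_X]
    exact (monomial_mem_restrictSupport F).2 (Or.inl rfl)
  · have h1 := weight_sub_single_add w hv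
    rw [Set.mem_singleton_iff] at ha
    simp only [map_add, ha, Finsupp.weight_single, hw, one_smul]
    omega

/-- Pascal's rule: binomial commutation relations between two families of derivations, which commute
with `d` up to a shift of the index, carry over from `x` to `d x`. -/
theorem choose_commutator_step {F R : Type*} [Field F] [CommRing R] [Algebra F R]
    {d : Derivation F R R} {A B E : ℕ → Derivation F R R}
    (hA₀ : ∀ x, A 0 (d x) = d (A 0 x)) (hA : ∀ k x, A (k + 1) (d x) = d (A (k + 1) x) + A k x)
    (hB₀ : ∀ x, B 0 (d x) = d (B 0 x)) (hB : ∀ k x, B (k + 1) (d x) = d (B (k + 1) x) + B k x)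
    (hE₀ : ∀ x, E 0 (d x) = d (E 0 x)) (hE : ∀ k x, E (k + 1) (d x) = d (E (k + 1) x) + E k x)
    {x : R} (hx : ∀ k l, A k (B l x) - B l (A k x) = (k + l).choose k • E (k + l) x) (k l : ℕ) :
    A k (B l (d x)) - B l (A k (d x)) = (k + l).choose k • E (k + l) (d x) := by
  have hd : d (A k (B l x)) - d (B l (A k x)) = (k + l).choose k • d (E (k + l) x) := by
    rw [← map_sub, hx, map_nsmul]
  obtain _ | k := k <;> obtain _ | l := l
  · rw [hB₀, hA₀, hA₀, hB₀, hE₀, hd]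
  · have h1 := hx 0 l
    simp only [← add_assoc, zero_add, Nat.choose_zero_right, one_smul, hA₀, hB, hE, map_add]
      at h1 hd ⊢
    rw [← hd, ← h1]
    abel
  · have h1 := hx k 0
    simp only [add_zero, Nat.choose_self, one_smul, hB₀, hA, hE, map_add] at h1 hd ⊢
    rw [← hd, ← h1]
    abel
  · have h1 := hx k (l + 1)
    have h2 := hx (k + 1) l
    rw [show k + (l + 1) = k + l + 1 by ring] at h1
    rw [show k + 1 + l = k + l + 1 by ring] at h2
    rw [show k + 1 + (l + 1) = k + l + 1 + 1 by ring] at hd ⊢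
    simp only [hA, hB, map_add]
    rw [hE, smul_add, ← hd, Nat.choose_succ_succ, add_smul, ← h1, ← h2]
    abel

variable {F 𝔤 ι I J : Type*} [Field F] [CharZero F] [LieRing 𝔤] [LieAlgebra F 𝔤]
  {κ : LinearMap.BilinForm F 𝔤} {h e f : 𝔤} {S : Slice F h f J} {D : ReductionDatum κ h f}

namespace GaugeFrame

variable (G : GaugeFrame S D I) [Fintype I] [Fintype J] (u : Module.Basis ι F 𝔤)
  (hinv : κ.lieInvariant 𝔤) (ht : IsSl2Triple h e f) (z : F) (s : 𝔤)

include hinv ht in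
/-- The coefficient of `λᵏ` in the λ-action of `a`, as a derivation of the algebra of
differential functions on `f + 𝔪^⊥`. -/
noncomputable def gaugeDer (a : 𝔤) (k : ℕ) :
    Derivation F (DiffPoly (I ⊕ J) F) (DiffPoly (I ⊕ J) F) :=
  Derivation.mk' ((G.coord u).toLinearMap ∘ₗ (Polynomial.lcoeff (DiffPoly ι F) k).restrictScalars F
      ∘ₗ masterLin (affineGen u κ z s) (jet u 0 a) ∘ₗ (G.lift u).toLinearMap) fun P Q => by
    simp only [LinearMap.comp_apply, AlgHom.toLinearMap_apply, map_mul, masterLin_apply,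
      masterBracket_mul, LinearMap.restrictScalars_apply, map_add, Polynomial.lcoeff_apply,
      Polynomial.coeff_C_mul, G.coord_lift u hinv ht, smul_eq_mul]

theorem gaugeDer_apply (a : 𝔤) (k : ℕ) (P : DiffPoly (I ⊕ J) F) :
    G.gaugeDer u hinv ht z s a k P
      = G.coord u ((masterBracket (affineGen u κ z s) (jet u 0 a) (G.lift u P)).coeff k) := rfl

theorem gaugeDer_mem_of_span {M : Submodule F (DiffPoly (I ⊕ J) F)} {k : ℕ}
    {P : DiffPoly (I ⊕ J) F} (hM : ∀ i, G.gaugeDer u hinv ht z s (G.a i) k P ∈ M) {a : 𝔤}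
    (ha : a ∈ D.n) : G.gaugeDer u hinv ht z s a k P ∈ M := by
  rw [← G.span_a] at ha
  induction ha using Submodule.span_induction with
  | mem x hx =>
    obtain ⟨i, rfl⟩ := hx
    exact hM i
  | zero =>
    rw [gaugeDer_apply, map_zero, ← masterLin_apply, map_zero]
    simp
  | add x y _ _ hx hy =>
    rw [gaugeDer_apply, map_add, masterBracket_add_left, Polynomial.coeff_add, map_add]
    exact M.add_mem hx hy
  | smul c x _ hx =>
    rw [gaugeDer_apply, map_smul, masterBracket_smul_left, Polynomial.coeff_smul, map_smul]
    exact M.smul_mem c hx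

variable (hs : ∀ a ∈ gradeGE F h 1, ∀ b : 𝔤, z * κ s ⁅a, b⁆ = 0)
include hs

theorem gaugeDer_coord {a : 𝔤} (ha : a ∈ D.n) (k : ℕ) (P : DiffPoly ι F) :
    G.gaugeDer u hinv ht z s a k (G.coord u P)
      = G.coord u ((masterBracket (affineGen u κ z s) (jet u 0 a) P).coeff k) := by
  have h1 : (masterBracket (affineGen u κ z s) (jet u 0 a) (G.lift u (G.coord u P))).map
        (G.coord u : DiffPoly ι F →+* DiffPoly (I ⊕ J) F)
      = (masterBracket (affineGen u κ z s) (jet u 0 a) P).map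
        (G.coord u : DiffPoly ι F →+* DiffPoly (I ⊕ J) F) :=
    ext_scalarEval (F := F) fun t => by
      rw [scalarEval_map, scalarEval_map, ← bracketAt_apply, ← bracketAt_apply, lift_coord,
        ← G.coord_rho u hinv ht, D.rho_bracket_n u hinv ht z s hs ha, G.coord_rho u hinv ht]
  have h2 := congrArg (fun Q => Q.coeff k) h1
  simp only [Polynomial.coeff_map] at h2
  exact h2

theorem gaugeDer_del_zero {a : 𝔤} (ha : a ∈ D.n) (P : DiffPoly (I ⊕ J) F) :
    G.gaugeDer u hinv ht z s a 0 (del _ F P) = del _ F (G.gaugeDer u hinv ht z s a 0 P) := by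
  rw [← G.coord_lift u hinv ht P, ← coord_del, G.gaugeDer_coord u hinv ht z s hs ha,
    G.gaugeDer_coord u hinv ht z s hs ha, masterBracket_del_right, lamD_coeff_zero, coord_del]

theorem gaugeDer_del_succ {a : 𝔤} (ha : a ∈ D.n) (k : ℕ) (P : DiffPoly (I ⊕ J) F) :
    G.gaugeDer u hinv ht z s a (k + 1) (del _ F P)
      = del _ F (G.gaugeDer u hinv ht z s a (k + 1) P) + G.gaugeDer u hinv ht z s a k P := by
  rw [← G.coord_lift u hinv ht P, ← coord_del, G.gaugeDer_coord u hinv ht z s hs ha,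
    G.gaugeDer_coord u hinv ht z s hs ha, G.gaugeDer_coord u hinv ht z s hs ha,
    masterBracket_del_right, lamD_coeff_succ, map_add, coord_del]

theorem gaugeDer_coordLin_zero {a : 𝔤} (ha : a ∈ D.n) (b : 𝔤) :
    G.gaugeDer u hinv ht z s a 0 (G.coordLin b) = G.coordLin ⁅a, b⁆ := by
  rw [← G.coord_jet_zero u, G.gaugeDer_coord u hinv ht z s hs ha, masterBracket_jet_jet,
    hs a (D.n_le ha)]
  simp [coord_jet_zero]

theorem gaugeDer_coordLin_one {a : 𝔤} (ha : a ∈ D.n) (b : 𝔤) :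
    G.gaugeDer u hinv ht z s a 1 (G.coordLin b) = C (κ a b) := by
  rw [← G.coord_jet_zero u, G.gaugeDer_coord u hinv ht z s hs ha, masterBracket_jet_jet]
  simp [Polynomial.coeff_C, ← algebraMap_eq]

theorem gaugeDer_coordLin_of_two_le {a : 𝔤} (ha : a ∈ D.n) {k : ℕ} (hk : 2 ≤ k) (b : 𝔤) :
    G.gaugeDer u hinv ht z s a k (G.coordLin b) = 0 := by
  obtain ⟨k, rfl⟩ := Nat.exists_eq_add_of_le' hk
  rw [← G.coord_jet_zero u, G.gaugeDer_coord u hinv ht z s hs ha, masterBracket_jet_jet]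
  simp

omit hs in
theorem gaugeDer_X_zero (a : 𝔤) (k : ℕ) (v : I ⊕ J) :
    G.gaugeDer u hinv ht z s a k (X (v, 0)) = G.gaugeDer u hinv ht z s a k (G.coordLin (G.b v)) := by
  rw [coordLin_b, map_add, derivation_C, zero_add]

/-- The gauge derivations represent the current algebra `𝔫[λ]`, in the basis of divided powers. -/
theorem gaugeDer_commutator {a b : 𝔤} (ha : a ∈ D.n) (hb : b ∈ D.n) (k l : ℕ)
    (P : DiffPoly (I ⊕ J) F) :
    G.gaugeDer u hinv ht z s a k (G.gaugeDer u hinv ht z s b l P)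
        - G.gaugeDer u hinv ht z s b l (G.gaugeDer u hinv ht z s a k P)
      = (k + l).choose k • G.gaugeDer u hinv ht z s ⁅a, b⁆ (k + l) P := by
  have hab : ⁅a, b⁆ ∈ D.n := D.lie_mem_n ha hb
  suffices h1 : ∀ (v : (I ⊕ J) × ℕ) (k l : ℕ),
      G.gaugeDer u hinv ht z s a k (G.gaugeDer u hinv ht z s b l (X v))
        - G.gaugeDer u hinv ht z s b l (G.gaugeDer u hinv ht z s a k (X v))
      = (k + l).choose k • G.gaugeDer u hinv ht z s ⁅a, b⁆ (k + l) (X v) by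
    have h2 : ⁅G.gaugeDer u hinv ht z s a k, G.gaugeDer u hinv ht z s b l⁆
        = (k + l).choose k • G.gaugeDer u hinv ht z s ⁅a, b⁆ (k + l) :=
      derivation_ext fun v => by
        rw [Derivation.commutator_apply, Derivation.smul_apply, h1]
    rw [← Derivation.smul_apply, ← h2, Derivation.commutator_apply]
  rintro ⟨v, n⟩
  induction n with
  | zero =>
    intro k l
    rw [gaugeDer_X_zero, gaugeDer_X_zero, gaugeDer_X_zero]
    generalize G.b v = x
    have h1 : κ b ⁅a, x⁆ = -κ ⁅a, b⁆ x := by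
      rw [form_lie_right hinv, ← lie_skew, map_neg, LinearMap.neg_apply]
    have h3 : ∀ k l, G.gaugeDer u hinv ht z s ⁅a, b⁆ (k + (l + 1 + 1)) (G.coordLin x) = 0 :=
      fun k l => G.gaugeDer_coordLin_of_two_le u hinv ht z s hs hab (by omega) x
    have h2 : ∀ k c y, c ∈ D.n → G.gaugeDer u hinv ht z s c (k + 1 + 1) (G.coordLin y) = 0 :=
      fun k c y hc => G.gaugeDer_coordLin_of_two_le u hinv ht z s hs hc (by omega) y
    obtain _ | _ | k := k <;> obtain _ | _ | l := l <;>
    simp [G.gaugeDer_coordLin_zero u hinv ht z s hs, G.gaugeDer_coordLin_one u hinv ht z s hs,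
      h2, h3, ha, hb, hab, form_lie_right hinv a b x, h1]
  | succ n ih =>
    intro k l
    have h1 := choose_commutator_step (x := X (v, n))
      (G.gaugeDer_del_zero u hinv ht z s hs ha) (G.gaugeDer_del_succ u hinv ht z s hs ha)
      (G.gaugeDer_del_zero u hinv ht z s hs hb) (G.gaugeDer_del_succ u hinv ht z s hs hb)
      (G.gaugeDer_del_zero u hinv ht z s hs hab) (G.gaugeDer_del_succ u hinv ht z s hs hab)
      ih k l
    rw [← del_X (v, n)]
    exact h1

end GaugeFrame
end GaugeDerivations

/-! ### The gauge fixing of the action of `𝔫` -/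

section GaugeSystem

open MvPolynomial

variable {F 𝔤 ι I J : Type*} [Field F] [LieRing 𝔤] [LieAlgebra F 𝔤]
  {κ : LinearMap.BilinForm F 𝔤} {h e f : 𝔤} {S : Slice F h f J} {D : ReductionDatum κ h f}

/-- The coordinates `X_i⁽ᵏ⁾` of `f + 𝔪^⊥` which are moved by the gauge action. -/
def gaugeVars (I J : Type*) : Set ((I ⊕ J) × ℕ) := {y | ∃ i k, y = (Sum.inl i, k)}

namespace GaugeFrame

variable (G : GaugeFrame S D I)

/-- The weight `n + 1` of `X_v⁽ⁿ⁾`, for which the gauge derivations are translations to leading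
order. -/
def order (v : (I ⊕ J) × ℕ) : ℕ := v.2 + 1

/-- The conformal weight of `X_v⁽ⁿ⁾`, doubled. -/
def confWeight (v : (I ⊕ J) × ℕ) : ℕ := (G.degW v.1 + 2).toNat + 2 * v.2

theorem degW_ge (v : I ⊕ J) : -1 ≤ G.degW v := by
  obtain i | j := v
  · have := G.degA_pos i
    simp only [degW, Sum.elim_inl]
    omega
  · have := S.deg_nonneg j
    simp only [degW, Sum.elim_inr]
    omega

theorem eq_degW_of_form_ne_zero {v : I ⊕ J} {k : ℤ} {x : 𝔤} (hx : x ∈ grade F h k)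
    (hxv : κ x (G.b v) ≠ 0) : k = G.degW v := by
  by_contra hk
  exact hxv (G.b_homogeneous v k hk x hx)

variable [Fintype I] [Fintype J] [CharZero F] (u : Module.Basis ι F 𝔤)
  (hinv : κ.lieInvariant 𝔤) (ht : IsSl2Triple h e f) (z : F) (s : 𝔤)

/-- The gauge derivation attached to a gauge coordinate. -/
noncomputable def gaugeDerVar (y : (I ⊕ J) × ℕ) :
    Derivation F (DiffPoly (I ⊕ J) F) (DiffPoly (I ⊕ J) F) :=
  Sum.elim (fun i => G.gaugeDer u hinv ht z s (G.a i) y.2) (fun _ => 0) y.1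

variable (hs : ∀ a ∈ gradeGE F h 1, ∀ b : 𝔤, z * κ s ⁅a, b⁆ = 0)
include hs

/-- To leading order in the coordinates, the gauge group acts by translations, because
`κ(f|[aᵢ, bᵥ]) = κ([f, aᵢ]|bᵥ)` and the `bᵥ` are dual to the `[f, aᵢ]`. -/
theorem gaugeDer_X_sub_pderiv (i : I) (v : I ⊕ J) (n k : ℕ) :
    G.gaugeDer u hinv ht z s (G.a i) k (X (v, n)) - pderiv (Sum.inl i, k) (X (v, n))
      ∈ weightGE F (order (I := I) (J := J)) (n + 1 - k) := by
  classical
  have hdel : ∀ {m : ℕ} {P : DiffPoly (I ⊕ J) F} (c : F), P - C c ∈ weightGE F order m →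
      del (I ⊕ J) F P ∈ weightGE F order (m + 1) := fun {m P} c hP => by
    have h1 := del_mem_restrictSupport (w := order) (c := 1) (t := {l | m + 1 ≤ Finsupp.weight order l})
      (fun v => rfl) (fun a ha b hb => by simp only [Set.mem_ofPred_eq] at ha ⊢; omega) hP
    rwa [map_sub, ← algebraMap_eq, Derivation.map_algebraMap, sub_zero] at h1
  have hconst : ∀ (v : I ⊕ J) (n k : ℕ), ∃ c : F,
      pderiv (Sum.inl i, k) (X (v, n) : DiffPoly (I ⊕ J) F) = C c := fun v n k => by
    rw [pderiv_X, Pi.single_apply]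
    split_ifs
    · exact ⟨1, C_1.symm⟩
    · exact ⟨0, C_0.symm⟩
  induction n generalizing k with
  | zero =>
    obtain _ | k := k
    · rw [gaugeDer_X_zero, G.gaugeDer_coordLin_zero u hinv ht z s hs (G.a_mem_n i), coordLin_apply]
      have h1 : C (κ f ⁅G.a i, G.b v⁆)
          = pderiv (Sum.inl i, 0) (X (v, 0) : DiffPoly (I ⊕ J) F) := by
        rw [pderiv_X, Pi.single_apply, form_lie_right hinv]
        by_cases hv : v = Sum.inl i
        · rw [hv, if_pos rfl]
          exact (congrArg C (G.dual_self (Sum.inl i))).trans C_1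
        · rw [if_neg fun h => hv (congrArg Prod.fst h)]
          exact (congrArg C (G.dual_ne (Sum.inl i) v (Ne.symm hv))).trans C_0
      rw [h1, add_sub_cancel_left]
      refine Submodule.sum_mem _ fun v' _ => Submodule.smul_mem _ _ ?_
      exact (monomial_mem_restrictSupport F).2 (Or.inl (by
        simp only [Set.mem_ofPred_eq, Finsupp.weight_single, one_smul, order]
        omega))
    · simpa using mem_weightGE_zero _ _
  | succ n ih =>
    rw [← del_X (v, n)]
    obtain _ | k := k
    · obtain ⟨c, hc⟩ := hconst v n 0
      have h1 := ih 0
      rw [hc] at h1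
      rw [G.gaugeDer_del_zero u hinv ht z s hs (G.a_mem_n i), del_X, pderiv_X,
        Pi.single_eq_of_ne (by simp), sub_zero]
      exact hdel c h1
    · obtain ⟨c, hc⟩ := hconst v n (k + 1)
      have h1 := ih (k + 1)
      rw [hc] at h1
      have h2 := ih k
      have h3 : pderiv (Sum.inl i, k + 1) (X (v, n + 1) : DiffPoly (I ⊕ J) F)
          = pderiv (Sum.inl i, k) (X (v, n)) := by
        rw [pderiv_X, pderiv_X, Pi.single_apply, Pi.single_apply]
        simp
      rw [G.gaugeDer_del_succ u hinv ht z s hs (G.a_mem_n i), del_X, h3, add_sub_assoc]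
      exact Submodule.add_mem _ (weightGE_mono _ (by omega) (hdel c h1))
        (weightGE_mono _ (by omega) h2)

/-- The coefficient of `λᵏ` in the gauge action of `aᵢ` lowers the conformal weight by that of
`X_i⁽ᵏ⁾`. -/
theorem gaugeDer_X_mem_weightLE (i : I) (v : I ⊕ J) (n k : ℕ) :
    G.gaugeDer u hinv ht z s (G.a i) k (X (v, n))
      ∈ weightLE F G.confWeight (G.confWeight (v, n)) (G.confWeight (Sum.inl i, k)) := by
  have hi : G.degW (Sum.inl i) = G.degA i - 2 := rfl
  have hpos := G.degA_pos i
  have hv := G.degW_ge v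
  have hC : ∀ (c : F) {m k : ℕ}, (c ≠ 0 → k ≤ m) →
      (C c : DiffPoly (I ⊕ J) F) ∈ weightLE F G.confWeight m k := fun c m k hc => by
    by_cases h0 : c = 0
    · rw [h0, map_zero]
      exact zero_mem _
    · exact (monomial_mem_restrictSupport F).2 (Or.inl (by simpa using hc h0))
  induction n generalizing k with
  | zero =>
    rw [gaugeDer_X_zero]
    obtain _ | _ | k := k
    · rw [G.gaugeDer_coordLin_zero u hinv ht z s hs (G.a_mem_n i), coordLin_apply]
      refine Submodule.add_mem _ (hC _ fun h0 => ?_) (Submodule.sum_mem _ fun v' _ => ?_)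
      · rw [form_lie_right hinv] at h0
        have h1 := G.eq_degW_of_form_ne_zero (G.w_mem ht (Sum.inl i)) h0
        simp only [confWeight]
        omega
      · by_cases h0 : κ (G.w v') ⁅G.a i, G.b v⁆ = 0
        · rw [h0, zero_smul]
          exact zero_mem _
        · refine Submodule.smul_mem _ _ ((monomial_mem_restrictSupport F).2 (Or.inl ?_))
          rw [form_lie_right hinv] at h0
          have h1 := G.eq_degW_of_form_ne_zero (lie_mem_grade (G.w_mem ht v') (G.a_mem i)) h0
          have hv' := G.degW_ge v'
          simp only [Set.mem_ofPred_eq, Finsupp.weight_single, one_smul, confWeight]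
          omega
    · rw [G.gaugeDer_coordLin_one u hinv ht z s hs (G.a_mem_n i)]
      refine hC _ fun h0 => ?_
      have h1 := G.eq_degW_of_form_ne_zero (G.a_mem i) h0
      simp only [confWeight]
      omega
    · rw [G.gaugeDer_coordLin_of_two_le u hinv ht z s hs (G.a_mem_n i) (by omega)]
      exact zero_mem _
  | succ n ih =>
    have hdel := del_mem_restrictSupport (w := G.confWeight) (c := 2)
      (t := {m | Finsupp.weight G.confWeight m + G.confWeight (Sum.inl i, k)
        ≤ G.confWeight (v, n + 1)})
      (fun v => by simp only [confWeight]; omega)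
      (fun a ha b hb => by simp only [Set.mem_ofPred_eq, confWeight] at ha ⊢; omega) (ih k)
    rw [← del_X (v, n)]
    obtain _ | k := k
    · rw [G.gaugeDer_del_zero u hinv ht z s hs (G.a_mem_n i)]
      exact hdel
    · rw [G.gaugeDer_del_succ u hinv ht z s hs (G.a_mem_n i)]
      refine Submodule.add_mem _ hdel (restrictSupport_mono _ (fun a ha => ?_) (ih k))
      simp only [Set.mem_ofPred_eq, confWeight] at ha ⊢
      omega

theorem isGaugeSystem : IsGaugeSystem order G.confWeight (gaugeVars I J)
    (G.gaugeDerVar u hinv ht z s) where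
  weight_le v := by
    have h1 := G.degW_ge v.1
    simp only [order, confWeight]
    omega
  finite w := by
    refine (Set.finite_range fun x : I × Fin (w + 1) => ((Sum.inl x.1 : I ⊕ J), (x.2 : ℕ))).subset ?_
    rintro _ ⟨⟨i, k, rfl⟩, hk⟩
    simp only [confWeight] at hk
    exact ⟨(i, ⟨k, by omega⟩), rfl⟩
  sub_pderiv := by
    rintro _ ⟨i, k, rfl⟩ ⟨v, n⟩
    have h1 := G.gaugeDer_X_sub_pderiv u hinv ht z s hs i v n k
    rwa [show n + 1 - k = order (v, n) + 1 - order ((Sum.inl i, k) : (I ⊕ J) × ℕ) by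
      simp only [order]; omega] at h1
  lower := by
    rintro _ ⟨i, k, rfl⟩ ⟨v, n⟩
    exact G.gaugeDer_X_mem_weightLE u hinv ht z s hs i v n k
  commutator := by
    rintro _ ⟨i, k, rfl⟩ _ ⟨j, l, rfl⟩ g n hg
    have h1 := G.gaugeDer_commutator u hinv ht z s hs (G.a_mem_n i) (G.a_mem_n j) k l g
    have h2 : G.gaugeDer u hinv ht z s ⁅G.a i, G.a j⁆ (k + l) g
        ∈ weightGE F order (n - (k + l + 1)) :=
      G.gaugeDer_mem_of_span u hinv ht z s (fun i' => hg _ ⟨i', k + l, rfl⟩)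
        (D.lie_mem_n (G.a_mem_n i) (G.a_mem_n j))
    refine weightGE_mono order (?_ : _ ≤ n - (k + l + 1)) ?_
    · simp only [order]
      omega
    · exact h1 ▸ nsmul_mem h2 _

end GaugeFrame
end GaugeSystem

/-! ### Restriction to the slice -/

section RestrictionToSlice

open MvPolynomial

variable {F 𝔤 ι I J : Type*} [Field F] [LieRing 𝔤] [LieAlgebra F 𝔤]
  {κ : LinearMap.BilinForm F 𝔤} {h e f : 𝔤} {S : Slice F h f J} {D : ReductionDatum κ h f}

/-- The homomorphism which sets the gauge variables to zero. -/
noncomputable def fixGauge (F I J : Type*) [Field F] : DiffPoly (I ⊕ J) F →ₐ[F] DiffPoly J F :=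
  aeval fun v => Sum.elim (fun _ => 0) (fun j => X (j, v.2)) v.1

theorem fixGauge_inl (i : I) (n : ℕ) : fixGauge F I J (X (Sum.inl i, n)) = 0 := aeval_X _ _

theorem fixGauge_inr (j : J) (n : ℕ) : fixGauge F I J (X (Sum.inr j, n)) = X (j, n) := aeval_X _ _

theorem fixGauge_del (P : DiffPoly (I ⊕ J) F) :
    fixGauge F I J (del (I ⊕ J) F P) = del J F (fixGauge F I J P) := by
  refine algHom_del _ (fun v n => ?_) P
  obtain i | j := v
  · rw [fixGauge_inl, fixGauge_inl, map_zero]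
  · rw [fixGauge_inr, fixGauge_inr, del_X]

theorem fixGauge_rename (P : DiffPoly J F) :
    fixGauge F I J (rename (fun v => (Sum.inr v.1, v.2)) P) = P := by
  induction P using MvPolynomial.induction_on with
  | C a => rw [rename_C, ← algebraMap_eq, AlgHom.commutes, algebraMap_eq]
  | add p q hp hq => rw [map_add, map_add, hp, hq]
  | mul_X p v hp => rw [map_mul, map_mul, hp, rename_X, fixGauge_inr]

theorem X_mul_mem_restrictSupport {σ : Type*} {Y : Set σ} {y : σ} (hy : y ∈ Y)
    (P : MvPolynomial σ F) : P * X y ∈ restrictSupport F {m | ∃ y ∈ Y, m y ≠ 0} :=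
  mul_mem_restrictSupport (s := Set.univ) (t := {Finsupp.single y 1})
    (mem_restrictSupport_iff_coeff.2 fun _ _ => Set.mem_univ _)
    ((monomial_mem_restrictSupport F).2 (Or.inl rfl)) fun a _ b hb => by
      rw [Set.mem_singleton_iff.1 hb]
      exact ⟨y, hy, by simp⟩

theorem sub_rename_fixGauge_mem (P : DiffPoly (I ⊕ J) F) :
    P - rename (fun v => (Sum.inr v.1, v.2)) (fixGauge F I J P)
      ∈ restrictSupport F {m | ∃ y ∈ gaugeVars I J, m y ≠ 0} := by
  induction P using MvPolynomial.induction_on with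
  | C a =>
    rw [← algebraMap_eq, AlgHom.commutes, AlgHom.commutes, sub_self]
    exact zero_mem _
  | add p q hp hq =>
    rw [map_add, map_add, add_sub_add_comm]
    exact add_mem hp hq
  | mul_X p v hp =>
    obtain ⟨i | j, n⟩ := v
    · rw [map_mul, fixGauge_inl, mul_zero, map_zero, sub_zero]
      exact X_mul_mem_restrictSupport (Y := gaugeVars I J) ⟨i, n, rfl⟩ p
    · rw [map_mul, fixGauge_inr, map_mul, rename_X, ← sub_mul]
      exact mul_mem_restrictSupport (t := Set.univ) hp
        (mem_restrictSupport_iff_coeff.2 fun _ _ => Set.mem_univ _) fun a ⟨y, hy, hay⟩ b _ =>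
          ⟨y, hy, by simp [hay]⟩

theorem fixGauge_eq_zero_iff {P : DiffPoly (I ⊕ J) F} : fixGauge F I J P = 0 ↔
    P ∈ restrictSupport F {m | ∃ y ∈ gaugeVars I J, m y ≠ 0} := by
  refine ⟨fun h => ?_, fun h => ?_⟩
  · have h1 := sub_rename_fixGauge_mem P
    rwa [h, map_zero, sub_zero] at h1
  · have h1 : restrictSupport F {m | ∃ y ∈ gaugeVars I J, m y ≠ 0}
        ≤ LinearMap.ker (fixGauge F I J).toLinearMap := by
      rw [restrictSupport_eq_span, Submodule.span_le]
      rintro _ ⟨m, ⟨_, ⟨i, n, rfl⟩, hm⟩, rfl⟩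
      have h2 : X (Sum.inl i, n) ∣ (monomial m (1 : F)) := by
        rw [X_dvd_monomial]
        exact Or.inr hm
      obtain ⟨Q, hQ⟩ := h2
      simp only [SetLike.mem_coe, LinearMap.mem_ker, AlgHom.toLinearMap_apply, hQ, map_mul,
        fixGauge_inl, zero_mul]
    exact h1 h

variable [Fintype J] (u : Module.Basis ι F 𝔤)

theorem Slice.restrict_del (P : DiffPoly ι F) :
    S.restrict κ u (del ι F P) = del J F (S.restrict κ u P) := jetHom_del u _ P

namespace GaugeFrame

variable (G : GaugeFrame S D I) [Fintype I]

/-- The slice is the locus in `f + 𝔪^⊥` where the gauge coordinates vanish. -/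
theorem fixGauge_coord (P : DiffPoly ι F) :
    fixGauge F I J (G.coord u P) = S.restrict κ u P := by
  refine congrArg (fun φ : DiffPoly ι F →ₐ[F] DiffPoly J F => φ P) (diffAlgHom_ext
    (φ := (fixGauge F I J).comp (G.coord u)) (d := del J F) (fun P => ?_)
    (S.restrict_del u) fun i => ?_)
  · rw [AlgHom.comp_apply, coord_del, fixGauge_del]
    rfl
  · rw [← jet_basis u, AlgHom.comp_apply, coord_jet_zero, coordLin_apply, Slice.restrict,
      jetHom_jet_zero, Slice.coordLin_apply, map_add, map_sum, Fintype.sum_sum_type]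
    simp only [map_smul, fixGauge_inl, fixGauge_inr, smul_zero, Finset.sum_const_zero, zero_add,
      w, Sum.elim_inr]
    rw [← algebraMap_eq, AlgHom.commutes, algebraMap_eq]

variable [CharZero F] (hinv : κ.lieInvariant 𝔤) (ht : IsSl2Triple h e f) (z : F) (s : 𝔤)
  (hs : ∀ a ∈ gradeGE F h 1, ∀ b : 𝔤, z * κ s ⁅a, b⁆ = 0)
include hinv ht hs

/-- Invariance can be tested on the gauge derivations. -/
theorem isInvariant_iff {g : DiffPoly ι F} : D.IsInvariant u z s g ↔
    ∀ y ∈ gaugeVars I J, G.gaugeDerVar u hinv ht z s y (G.coord u g) = 0 := by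
  have hcoord : ∀ P Q : DiffPoly ι F, D.rho u P = D.rho u Q ↔ G.coord u P = G.coord u Q :=
    fun P Q => ⟨fun h1 => by rw [← G.coord_rho u hinv ht, h1, G.coord_rho u hinv ht],
      fun h1 => by rw [← G.lift_coord, h1, G.lift_coord]⟩
  refine ⟨?_, fun hg a ha t => ?_⟩
  · rintro hg _ ⟨i, k, rfl⟩
    change G.gaugeDer u hinv ht z s (G.a i) k (G.coord u g) = 0
    rw [G.gaugeDer_coord u hinv ht z s hs (G.a_mem_n i), ← map_zero (G.coord u), ← hcoord, map_zero]
    have h1 : (masterBracket (affineGen u κ z s) (jet u 0 (G.a i)) g).map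
        (D.rho u : DiffPoly ι F →+* DiffPoly ι F) = 0 :=
      ext_scalarEval (F := F) fun t => by
        rw [scalarEval_map, ← bracketAt_apply, hg _ (G.a_mem_n i), map_zero]
    have h2 := congrArg (fun Q => Q.coeff k) h1
    rw [Polynomial.coeff_map, Polynomial.coeff_zero] at h2
    exact h2
  · rw [← map_zero (D.rho u), hcoord, map_zero, bracketAt_apply, ← scalarEval_map]
    have h1 : (masterBracket (affineGen u κ z s) (jet u 0 a) g).map
        (G.coord u : DiffPoly ι F →+* DiffPoly (I ⊕ J) F) = 0 := by
      ext1 k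
      rw [Polynomial.coeff_map, Polynomial.coeff_zero]
      refine (G.gaugeDer_coord u hinv ht z s hs ha k g).symm.trans ?_
      exact (Submodule.mem_bot F).1 (G.gaugeDer_mem_of_span u hinv ht z s
        (fun i => (Submodule.mem_bot F).2 (hg _ ⟨i, k, rfl⟩)) ha)
    rw [h1, map_zero]

include G in
/-- An element of the W-algebra is determined by its restriction to the slice. -/
theorem eq_zero_of_restrict_eq_zero {g : DiffPoly ι F} (hg : g ∈ D.W u z s)
    (h0 : S.restrict κ u g = 0) : g = 0 := by
  obtain ⟨hgp, hgi⟩ := (D.mem_W_iff u z s).1 hg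
  have h1 : G.coord u g = 0 := (G.isGaugeSystem u hinv ht z s hs).eq_zero
    (fixGauge_eq_zero_iff.1 ((G.fixGauge_coord u g).trans h0))
    ((G.isInvariant_iff u hinv ht z s hs).1 hgi)
  rw [← D.rho_of_mem_Vp u hinv ht hgp, ← G.lift_coord, h1, map_zero]

include G in
/-- Every differential polynomial on the slice extends to an element of the W-algebra. -/
theorem exists_restrict_eq (P : DiffPoly J F) : ∃ g ∈ D.W u z s, S.restrict κ u g = P := by
  obtain ⟨Q, hQ, hQi⟩ := (G.isGaugeSystem u hinv ht z s hs).exists_invariant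
    (rename (fun v => (Sum.inr v.1, v.2)) P)
  have h1 := fixGauge_eq_zero_iff.2 hQ
  rw [map_sub, fixGauge_rename, sub_eq_zero] at h1
  refine ⟨G.lift u Q, (D.mem_W_iff u z s).2 ⟨G.lift_mem_Vp u Q, ?_⟩, ?_⟩
  · rwa [G.isInvariant_iff u hinv ht z s hs, G.coord_lift u hinv ht]
  · rw [← G.fixGauge_coord, G.coord_lift u hinv ht, h1]

end GaugeFrame

end RestrictionToSlice

section Base

variable {F 𝔤 : Type*} [Field F] [CharZero F] [LieRing 𝔤] [LieAlgebra F 𝔤]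
  {κ : LinearMap.BilinForm F 𝔤} {h f : 𝔤}

/-- The choice `l = 0`, `𝔭 = 𝔤_{≤ 1/2}`, which does not depend on `D`: the datum `D` only serves to
show that `ad h` is diagonalizable. -/
noncomputable def ReductionDatum.base (D : ReductionDatum κ h f) : ReductionDatum κ h f where
  l := ⊥
  l_le := bot_le
  isotropic := fun a ha b _ => by rw [(Submodule.mem_bot F).1 ha, omega, zero_lie, map_zero]
  p := gradeLE F h 1
  p_le := le_rfl
  isCompl := by
    rw [bot_sup_eq]
    refine ⟨(iSupIndep_grade h).disjoint_biSup_biSup (s := {j | j ≤ 1}) (t := {j | 2 ≤ j}) ?_,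
      codisjoint_iff_le_sup.2 <| D.iSup_grade ▸ iSup_le fun j => ?_⟩
    · rw [Set.disjoint_left]
      intro j hj hj'
      simp only [Set.mem_ofPred_eq] at hj hj'
      omega
    · by_cases hj : j ≤ 1
      · exact (grade_le_gradeLE hj).trans le_sup_left
      · exact (grade_le_gradeGE (by omega)).trans le_sup_right

theorem ReductionDatum.base_n_eq (D : ReductionDatum κ h f) : D.base.n = gradeGE F h 1 := by
  refine le_antisymm (ReductionDatum.n_le _) (gradeGE_le_iff.2 fun j hj => ?_)
  obtain rfl | hj := hj.eq_or_lt
  · refine le_sup_of_le_left fun a ha => (mem_sympCompl ..).2 ⟨ha, fun b hb => ?_⟩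
    rw [(Submodule.mem_bot F).1 hb, omega, lie_zero, map_zero]
  · exact le_sup_of_le_right (grade_le_gradeGE hj)

end Base

/-! ### The isomorphism -/

section Comparison

variable {F 𝔤 ι J : Type*} [Field F] [CharZero F] [LieRing 𝔤] [LieAlgebra F 𝔤]
  {κ : LinearMap.BilinForm F 𝔤} {h e f : 𝔤} (D D₀ : ReductionDatum κ h f)
  (u : Module.Basis ι F 𝔤) (hsymm : κ.IsSymm) (hinv : κ.lieInvariant 𝔤) (ht : IsSl2Triple h e f)
  (z : F) (s : 𝔤)

include hinv ht

section Restrict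

variable [Fintype J] (S : Slice F h f J)

/-- Restriction to the slice factors through `ρ`, since the slice lies in `f + 𝔪^⊥`. -/
theorem Slice.restrict_rho (P : DiffPoly ι F) : S.restrict κ u (D.rho u P) = S.restrict κ u P := by
  refine congrArg (fun φ : DiffPoly ι F →ₐ[F] DiffPoly J F => φ P) (diffAlgHom_ext
    (φ := (S.restrict κ u).comp (D.rho u)) (d := del J F) (fun P => ?_)
    (S.restrict_del u) fun i => ?_)
  · rw [AlgHom.comp_apply, D.rho_del, S.restrict_del]
    rfl
  · have h1 : ∀ j, κ (S.c j) (D.proj (u i)) = κ (S.c j) (u i) := fun j => by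
      have h2 := form_eq_zero_of_gradeGE hinv (by norm_num)
        (grade_le_gradeGE (S.deg_nonneg j) (S.mem j)) (D.m_le (D.sub_proj_mem (u i)))
      rw [map_sub, sub_eq_zero] at h2
      exact h2.symm
    rw [← jet_basis u, AlgHom.comp_apply, D.rho_jet_zero, map_add, Slice.restrict, jetHom_jet_zero,
      jetHom_jet_zero, Slice.coordLin_apply, Slice.coordLin_apply, D.form_f_p hinv ht (D.proj_mem _),
      ← MvPolynomial.algebraMap_eq, ← MvPolynomial.algebraMap_eq, AlgHom.commutes, map_zero,
      zero_add, add_comm]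
    simp only [h1]

end Restrict

/-- `ρ` factors through the map `ρ₀` belonging to a smaller `𝔪`. -/
theorem ReductionDatum.rho_rho_of_le (hD : D₀.l ≤ D.l) (P : DiffPoly ι F) :
    D.rho u (D₀.rho u P) = D.rho u P := by
  refine congrArg (fun φ : DiffPoly ι F →ₐ[F] DiffPoly ι F => φ P) (diffAlgHom_ext
    (φ := (D.rho u).comp (D₀.rho u)) (d := del ι F) (fun P => ?_) (D.rho_del u) fun i => ?_)
  · rw [AlgHom.comp_apply, D₀.rho_del, D.rho_del]
    rfl
  · have h1 := D.proj_of_mem_m (sup_le_sup_right hD _ (D₀.sub_proj_mem (u i)))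
    rw [map_sub, sub_eq_zero] at h1
    rw [← jet_basis u, AlgHom.comp_apply, D₀.rho_jet_zero, map_add, D.rho_C, D.rho_jet_zero,
      D.rho_jet_zero, h1, D₀.form_f_p hinv ht (D₀.proj_mem _), map_zero, add_zero]

variable (hs : ∀ a ∈ gradeGE F h 1, ∀ b : 𝔤, z * κ s ⁅a, b⁆ = 0)

theorem ReductionDatum.IsInvariant.of_le (hD : D₀.l ≤ D.l) (hn : D.n ≤ D₀.n) {g : DiffPoly ι F}
    (hg : D₀.IsInvariant u z s g) : D.IsInvariant u z s g := fun a ha t => by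
  rw [← D.rho_rho_of_le D₀ u hinv ht hD, hg a (hn ha), map_zero]

include hs

theorem ReductionDatum.IsInvariant.rho {g : DiffPoly ι F} (hg : D.IsInvariant u z s g) :
    D.IsInvariant u z s (D.rho u g) := fun a ha t => by
  rw [D.rho_bracket_n u hinv ht z s hs ha, hg a ha]

include hsymm in
theorem ReductionDatum.rho_bracket_rho {g k : DiffPoly ι F} (hg : D.IsInvariant u z s g)
    (hk : D.IsInvariant u z s k) (t : F) :
    D.rho u (bracketAt (affineGen u κ z s) t (D.rho u g) (D.rho u k))
      = D.rho u (bracketAt (affineGen u κ z s) t g k) := by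
  rw [D.rho_bracket_left u hinv ht z s (hk.rho D u hinv ht z s hs),
    D.rho_bracket_right u hsymm hinv ht z s hg]

end Comparison

section Isomorphism

variable {F 𝔤 ι J : Type*} [Field F] [CharZero F] [LieRing 𝔤] [LieAlgebra F 𝔤] [Module.Finite F 𝔤]
  {κ : LinearMap.BilinForm F 𝔤} {h e f : 𝔤} (D : ReductionDatum κ h f)
  (u : Module.Basis ι F 𝔤) (hsymm : κ.IsSymm) (hnondeg : κ.Nondegenerate)
  (hinv : κ.lieInvariant 𝔤) (ht : IsSl2Triple h e f) [Fintype J] (S : Slice F h f J)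
  (z : F) (s : 𝔤)

/-- Restriction of the elements of the W-algebra to the slice. -/
noncomputable def ReductionDatum.restrictW : D.W u z s →ₐ[F] DiffPoly J F :=
  (S.restrict κ u).comp (D.W u z s).val

variable (hs : ∀ a ∈ gradeGE F h 1, ∀ b : 𝔤, z * κ s ⁅a, b⁆ = 0)
include hsymm hnondeg hinv ht hs

/-- The elements of the W-algebra are determined by their restriction to the slice, which is
arbitrary. -/
theorem ReductionDatum.restrictW_bijective : Function.Bijective (D.restrictW u S z s) := by
  obtain ⟨I, hI, ⟨G⟩⟩ := exists_gaugeFrame D hsymm hinv hnondeg ht S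
  have := hI.fintype
  refine ⟨(injective_iff_map_eq_zero _).2 fun g hg => Subtype.ext
    (G.eq_zero_of_restrict_eq_zero u hinv ht z s hs g.2 hg), fun P => ?_⟩
  obtain ⟨g, hg, hgP⟩ := G.exists_restrict_eq u hinv ht z s hs P
  exact ⟨⟨g, hg⟩, hgP⟩

/-- The restriction to the slice of the reduced λ-bracket of two elements of the W-algebra can be
computed in the W-algebra with `l = 0`. -/
theorem ReductionDatum.restrict_bracket {g k g₀ k₀ : DiffPoly ι F} (hg : g ∈ D.W u z s)
    (hk : k ∈ D.W u z s) (hg₀ : g₀ ∈ D.base.W u z s)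
    (hk₀ : k₀ ∈ D.base.W u z s) (hgg : S.restrict κ u g = S.restrict κ u g₀)
    (hkk : S.restrict κ u k = S.restrict κ u k₀) (t : F) :
    S.restrict κ u (D.rho u (bracketAt (affineGen u κ z s) t g k))
      = S.restrict κ u (bracketAt (affineGen u κ z s) t g₀ k₀) := by
  have hn : D.n ≤ D.base.n :=
    D.n_le.trans D.base_n_eq.ge
  have hrho : ∀ {g g₀ : DiffPoly ι F}, g ∈ D.W u z s → g₀ ∈ D.base.W u z s →
      S.restrict κ u g = S.restrict κ u g₀ → D.IsInvariant u z s g₀ ∧ g = D.rho u g₀ :=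
    fun {g g₀} hg hg₀ hgg => by
      have h1 := ((mem_W_iff _ u z s).1 hg₀).2.of_le D _ u hinv ht z s bot_le hn
      refine ⟨h1, ?_⟩
      have h2 : (⟨g, hg⟩ : D.W u z s) = ⟨D.rho u g₀,
          (D.mem_W_iff u z s).2 ⟨D.rho_mem_Vp u _, h1.rho D u hinv ht z s hs⟩⟩ :=
        (D.restrictW_bijective u hsymm hnondeg hinv ht S z s hs).1
          (hgg.trans (S.restrict_rho D u hinv ht g₀).symm)
      exact congrArg Subtype.val h2
  obtain ⟨h1, rfl⟩ := hrho hg hg₀ hgg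
  obtain ⟨h2, rfl⟩ := hrho hk hk₀ hkk
  rw [D.rho_bracket_rho u hsymm hinv ht z s hs h1 h2, S.restrict_rho D u hinv ht]

omit hsymm hnondeg hinv ht hs [Module.Finite F 𝔤] [CharZero F] [Fintype J] in
theorem ReductionDatum.IsWStructure.coe_scalarEval_br [Infinite F] {T : PVAStructure F (D.W u z s)}
    (hT : D.IsWStructure u z s T) (t : F) (g k : D.W u z s) :
    ((scalarEval t (T.br g k) : D.W u z s) : DiffPoly ι F)
      = D.rho u (bracketAt (affineGen u κ z s) t g k) := by
  change (D.W u z s).val _ = _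
  rw [← scalarEval_map, hT.2, bracketAt_apply, ← scalarEval_map]
  rfl

/-- The W-algebras of two data are isomorphic, by matching the restrictions to a common slice. -/
theorem ReductionDatum.nonempty_pvaEquiv (D' : ReductionDatum κ h f) {s' : 𝔤}
    (hs' : ∀ a ∈ gradeGE F h 1, ∀ b : 𝔤, z * κ s' ⁅a, b⁆ = 0)
    (hss : ∀ a b : 𝔤, z * κ s ⁅a, b⁆ = z * κ s' ⁅a, b⁆)
    {T : PVAStructure F (D.W u z s)} {T' : PVAStructure F (D'.W u z s')}
    (hT : D.IsWStructure u z s T) (hT' : D'.IsWStructure u z s' T') :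
    Nonempty (PVAEquiv T T') := by
  obtain ⟨J, hJ, ⟨S⟩⟩ := exists_slice (F := F) ht
  have := hJ.fintype
  have hgen : affineGen u κ z s = affineGen u κ z s' := by
    funext i j
    rw [affineGen, affineGen, hss]
  have hW₀ : D.base.W u z s = D'.base.W u z s' := by
    ext g
    rw [mem_W_iff, mem_W_iff]
    simp only [IsInvariant, hgen]
    rfl
  let E := AlgEquiv.ofBijective (D.restrictW u S z s)
    (D.restrictW_bijective u hsymm hnondeg hinv ht S z s hs)
  let E' := AlgEquiv.ofBijective (D'.restrictW u S z s')
    (D'.restrictW_bijective u hsymm hnondeg hinv ht S z s' hs')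
  have hE : ∀ g, E' ((E.trans E'.symm) g) = E g := fun g => E'.apply_symm_apply _
  refine ⟨⟨E.trans E'.symm, fun g => E'.injective ?_, fun g k => ext_scalarEval (F := F) fun t =>
    E'.injective ?_⟩⟩
  · rw [hE]
    change S.restrict κ u (T.der g) = S.restrict κ u (T'.der _)
    rw [hT.1, hT'.1, S.restrict_del, S.restrict_del]
    exact congrArg _ (hE g).symm
  · obtain ⟨g₀, hg₀⟩ := (D.base.restrictW_bijective u hsymm hnondeg hinv ht S z s hs).2
      (E g)
    obtain ⟨k₀, hk₀⟩ := (D.base.restrictW_bijective u hsymm hnondeg hinv ht S z s hs).2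
      (E k)
    rw [scalarEval_map_algEquiv, hE]
    change S.restrict κ u (scalarEval t (T.br g k) : D.W u z s)
      = S.restrict κ u (scalarEval t (T'.br _ _) : D'.W u z s')
    have hgg : S.restrict κ u g₀ = S.restrict κ u g := hg₀
    have hkk : S.restrict κ u k₀ = S.restrict κ u k := hk₀
    have hgg' : S.restrict κ u ((E.trans E'.symm) g) = S.restrict κ u g₀ := (hE g).trans hg₀.symm
    have hkk' : S.restrict κ u ((E.trans E'.symm) k) = S.restrict κ u k₀ := (hE k).trans hk₀.symm
    rw [hT.coe_scalarEval_br, hT'.coe_scalarEval_br,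
      D.restrict_bracket u hsymm hnondeg hinv ht S z s hs g.2 k.2 g₀.2 k₀.2 hgg.symm hkk.symm, hgen]
    exact (D'.restrict_bracket u hsymm hnondeg hinv ht S z s' hs' (Subtype.prop _)
      (Subtype.prop _) (hW₀.le g₀.2) (hW₀.le k₀.2) hgg' hkk' t).symm

end Isomorphism

end ClassicalW

theorem corollary3 {F 𝔤 ι : Type*} [Field F] [CharZero F] [LieRing 𝔤] [LieAlgebra F 𝔤]
    [Module.Finite F 𝔤] [LieAlgebra.HasCentralRadical F 𝔤]
    (κ : LinearMap.BilinForm F 𝔤) (hsymm : κ.IsSymm) (hnondeg : κ.Nondegenerate)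
    (hinv : κ.lieInvariant 𝔤)
    (h e f : 𝔤) (htriple : IsSl2Triple h e f) (u : Module.Basis ι F 𝔤)
    (D₁ D₂ : ClassicalW.ReductionDatum κ h f) :
    (∀ s₁ s₂ : 𝔤, (∀ a ∈ D₁.n, ⁅a, s₁⁆ = 0) → (∀ a ∈ D₂.n, ⁅a, s₂⁆ = 0) →
      ∃ (S₁ : ClassicalW.PVAStructure F (D₁.W u 0 s₁))
        (S₂ : ClassicalW.PVAStructure F (D₂.W u 0 s₂)),
        D₁.IsWStructure u 0 s₁ S₁ ∧ D₂.IsWStructure u 0 s₂ S₂ ∧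
          Nonempty (ClassicalW.PVAEquiv S₁ S₂)) ∧
    (∀ (z : F) (s : 𝔤), (∀ a ∈ ClassicalW.gradeGE F h 1, ⁅a, s⁆ = 0) →
      ∃ (S₁ : ClassicalW.PVAStructure F (D₁.W u z s))
        (S₂ : ClassicalW.PVAStructure F (D₂.W u z s)),
        D₁.IsWStructure u z s S₁ ∧ D₂.IsWStructure u z s S₂ ∧
          Nonempty (ClassicalW.PVAEquiv S₁ S₂)) := by
  have key : ∀ (z : F) (s₁ s₂ : 𝔤),
      (∀ a ∈ ClassicalW.gradeGE F h 1, ∀ b : 𝔤, z * κ s₁ ⁅a, b⁆ = 0) →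
      (∀ a b : 𝔤, z * κ s₁ ⁅a, b⁆ = z * κ s₂ ⁅a, b⁆) →
      ∃ (S₁ : ClassicalW.PVAStructure F (D₁.W u z s₁))
        (S₂ : ClassicalW.PVAStructure F (D₂.W u z s₂)),
        D₁.IsWStructure u z s₁ S₁ ∧ D₂.IsWStructure u z s₂ S₂ ∧
          Nonempty (ClassicalW.PVAEquiv S₁ S₂) := fun z s₁ s₂ hs hss => by
    have hs' : ∀ a ∈ ClassicalW.gradeGE F h 1, ∀ b : 𝔤, z * κ s₂ ⁅a, b⁆ = 0 :=
      fun a ha b => (hss a b).symm.trans (hs a ha b)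
    obtain ⟨S₁, hS₁⟩ := D₁.exists_isWStructure u hsymm hinv htriple z s₁ hs
    obtain ⟨S₂, hS₂⟩ := D₂.exists_isWStructure u hsymm hinv htriple z s₂ hs'
    exact ⟨S₁, S₂, hS₁, hS₂,
      D₁.nonempty_pvaEquiv u hsymm hnondeg hinv htriple z s₁ hs D₂ hs' hss hS₁ hS₂⟩
  refine ⟨fun s₁ s₂ _ _ => key 0 s₁ s₂ (by simp) (by simp), fun z s hs =>
    key z s s (fun a ha b => ?_) fun _ _ => rfl⟩
  rw [ClassicalW.form_lie_right hinv, ← lie_skew, hs a ha]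
  simp
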